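/- **Setting.** Let $l_1<l_2$, $T>0$, $r>0$, and let $\kappa>0,\alpha,\beta,\lambda$ be smooth on $[l_1,l_2]^2\times[0,T]$ (they are the coefficients of $u_t-\nabla\cdot(\kappa\nabla u)+\alpha u_x+\beta u_y+\lambda u=\phi$ with Dirichlet data). Put $h=(l_2-l_1)/N$ with $N\ge1$, $\tau=rh$, $(x_i,y_j)=(l_1+ih,l_1+jh)$, and let $(w,\theta)=(2,\tfrac12)$ for Crank–Nicolson, $(\tfrac{11}6,3)$ for BDF3, $(\tfrac{25}{12},4)$ for BDF4. At the time $t=(n+\theta)\tau\le T$, the time discretisation leads to $$\Delta u+a u_x+b u_y+\tfrac1{rh}d_1u+d_2u=f,\qquad a=\tfrac{\kappa_x-\alpha}{\kappa},\quad b=\tfrac{\kappa_y-\beta}{\kappa},\quad d_1=-\tfrac{w}{\kappa},\quad d_2=-\tfrac{\lambda}{\kappa}. \qquad(*)$$ **The stencil.** Solving $(*)$ and its derivatives for $u^{(m,n)}=\partial_x^m\partial_y^nu$, $m\ge2$, successively (with $rh$ treated as a constant), the degree-five Taylor polynomial of a solution $u$ at a point becomes $\sum_{m\le1,\,m+n\le5}u^{(m,n)}G_{m,n}(x,y)+\sum_{m+n\le3}f^{(m,n)}H_{m,n}(x,y)$.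 A stencil at this point is a family $C_{k,\ell}(h)=\sum_{p=0}^5c_{k,\ell,p}h^p$ ($k,\ell\in\{-1,0,1\}$) with real $c_{k,\ell,p}$ such that, the derivatives of $a,b,d_1,d_2$ at the point being fixed, 1. $\sum_{k,\ell}C_{k,\ell}(h)\,G_{m,n}(kh,\ell h)=\mathcal O(h^6)$ as $h\to0^+$ for all $m\le1$, $m+n\le5$; 2. the $h^0$ term, which is the lowest one, of $h^{-2}\sum_{m+n\le3}f^{(m,n)}\sum_{k,\ell}C_{k,\ell}(h)H_{m,n}(kh,\ell h)$ is $f$, whatever the values of the $f^{(m,n)}$; 3. $c_{0,0,0}=-\tfrac{10}3$, and $c_{-1,0,p},c_{0,-1,p}$ vanish for $p=5$; $c_{-1,1,p},c_{0,0,p}$ for $p\ge4$; $c_{0,1,p},c_{1,-1,p}$ for $p\ge3$; $c_{1,0,p}$ for $p\ge2$; $c_{1,1,p}$ for $p\ge1$. **Claim (2D).** For each of the three time discretisations, every $(x,y)\in(l_1,l_2)^2$ and every $t\in[0,T]$, there is exactly one such stencil, and it satisfies $$C_{\pm1,\pm1}|_{h=0}=C_{\pm1,\mp1}|_{h=0}=\tfrac16,\quad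 C_{\pm1,0}|_{h=0}=C_{0,\pm1}|_{h=0}=\tfrac23,\quad C_{0,0}|_{h=0}=-\tfrac{10}3,$$ $$\sum_{k,\ell}C_{k,\ell}=\sum_{q=0}^5\varpi_qh^q,\qquad \varpi_0=0,\quad \varpi_1=\tfrac{d_1}{r},\quad d_1=-\tfrac{w}{\kappa}<0.$$ Moreover, there is $h_0>0$ (depending on the data above, but not on $N$, $n$ or the node) such that for all $N$ with $h<h_0$ and all $n\ge 0$ with $(n+\theta)\tau\le T$, whatever the sign of $\lambda$, the scheme $$-\mathcal L_hv_{i,j}:=\frac1{h^2}\sum_{k,\ell}-C_{k,\ell}\big|_{(x_i,y_j)}(h)\,v_{i+k,j+\ell}\qquad(0<i,j<N),$$ built from these stencils at time $t=(n+\theta)\tau$, with Dirichlet values at the boundary nodes, has the following properties. * Sign and sum conditions: at every interior node $-C_{0,0}>0$, $-C_{k,\ell}\le0$ for $(k,\ell)\ne(0,0)$, and $\sum_{k,\ell}-C_{k,\ell}\ge0$. * Discrete maximum principle: if $-\mathcal L_hv\le0$ at all interior nodes and $v\le M$ at all boundary nodes with $M\ge0$, then $v\le M$ at all interior nodes. *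 Monotonicity: if $-\mathcal L_hv\ge0$ at all interior nodes and $v\ge0$ at all boundary nodes, then $v\ge0$ at all interior nodes. * M-matrix: the matrix of the system for the interior unknowns has positive diagonal entries, nonpositive off-diagonal entries, nonnegative row sums, and at least one positive row sum; it is invertible with an entrywise nonnegative inverse. **Claim (3D).** Let in the same way $\kappa>0,\alpha,\beta,\gamma,\lambda$ be smooth on $[l_1,l_2]^3\times[0,T]$, with the equation $\Delta u+au_x+bu_y+cu_z+\tfrac1{rh}d_1u+d_2u=f$, where $c=\tfrac{\kappa_z-\gamma}{\kappa}$ and $a,b,d_1,d_2$ are as before. Stencils $C_{k,\ell,s}(h)=\sum_{p=0}^5c_{k,\ell,s,p}h^p$ ($k,\ell,s\in\{-1,0,1\}$) are defined by the three-dimensional analogues of 1 and 2 (indices $m\le1$, $m+n+q\le5$, and $m+n+q\le3$), together with $C_{k,\ell,s}=0$ whenever $k,\ell,s$ are all nonzero, $c_{0,0,0,0}=-4$, and the vanishing of * $c_{-1,0,-1,p},\ c_{-1,0,0,p},\ c_{0,-1,-1,p}$ for $p=5$; * $c_{-1,0,1,p},\ c_{-1,1,0,p},\ c_{0,-1,0,p},\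 c_{0,0,-1,p},\ c_{0,0,0,p}$ for $p\ge4$; * $c_{0,-1,1,p},\ c_{0,0,1,p},\ c_{0,1,-1,p},\ c_{0,1,0,p},\ c_{1,-1,0,p},\ c_{1,0,-1,p}$ for $p\ge3$; * $c_{0,1,1,p},\ c_{1,0,0,p},\ c_{1,0,1,p}$ for $p\ge2$; * $c_{1,1,0,p}$ for $p\ge1$. Then for every interior point and every $t\in[0,T]$ there is exactly one such stencil. Its coefficients vanish identically if $k,\ell,s\neq0$; at $h=0$ they are $\tfrac16$ if exactly two of $k,\ell,s$ are nonzero, $\tfrac13$ if exactly one is, and $-4$ if none is; and $\sum_{k,\ell,s} C_{k,\ell,s}=\sum_{q=0}^5\varpi_qh^q$ with $\varpi_0=0$, $\varpi_1=d_1/r$, $d_1=-w/\kappa<0$. There is $h_0>0$, independent of $N$, $n$ and the node, such that for $h<h_0$ and all $n\ge 0$ with $(n+\theta)\tau\le T$, for any $\lambda$, the scheme built from these stencils has the same properties as in 2D. -/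

import Mathlib

open Filter Topology
open scoped ContDiff

noncomputable section

/-! ### Time discretisations -/

/-- The three time discretisations: Crank-Nicolson, BDF3, BDF4. -/
inductive TimeScheme
  | CN
  | BDF3
  | BDF4

/-- The spatial problem of the `n`-th step is posed at the time `(n + shift) * τ`. -/
def TimeScheme.shift : TimeScheme → ℝ
  | .CN => 1 / 2
  | .BDF3 => 3
  | .BDF4 => 4

/-- The weight `w` of the new unknown in the difference quotient `(w / τ) * u - ...`
that replaces `u_t`. -/
def TimeScheme.weight : TimeScheme → ℝ
  | .CN => 2
  | .BDF3 => 11 / 6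
  | .BDF4 => 25 / 12

/-! ### Coefficients of a stencil as polynomials in `h` -/

/-- The value at `h` of the polynomial `∑_{p ≤ 5} c_p h^p`. -/
def coeffPoly (c : Fin 6 → ℝ) (h : ℝ) : ℝ := ∑ p : Fin 6, c p * h ^ (p : ℕ)

/-- All coefficients `c_p` with `p ≥ q` vanish. -/
def VanishFrom (q : ℕ) (c : Fin 6 → ℝ) : Prop := ∀ p : Fin 6, q ≤ (p : ℕ) → c p = 0

/-! ### Schemes on a grid with Dirichlet boundary nodes -/

/-- `op` is the discrete operator acting on grid functions; the unknowns sit at the nodes of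
`inner`, the Dirichlet data at the nodes of `bdry`. If `op v ≤ 0` at all inner nodes then `v` does
not exceed, at inner nodes, any nonnegative upper bound of its boundary values. -/
def DiscreteMaxPrinciple {ι : Type} (inner bdry : Finset ι) (op : (ι → ℝ) → ι → ℝ) : Prop :=
  ∀ v : ι → ℝ, (∀ p ∈ inner, op v p ≤ 0) →
    ∀ M : ℝ, 0 ≤ M → (∀ p ∈ bdry, v p ≤ M) → ∀ p ∈ inner, v p ≤ M

/-- Nonnegative data (right-hand side and boundary values) force a nonnegative solution. -/
def MonotoneScheme {ι : Type} (inner bdry : Finset ι) (op : (ι → ℝ) → ι → ℝ) : Prop :=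
  ∀ v : ι → ℝ, (∀ p ∈ inner, 0 ≤ op v p) → (∀ p ∈ bdry, 0 ≤ v p) → ∀ p ∈ inner, 0 ≤ v p

/-- The matrix of the linear operator `op` for the unknowns at the inner nodes, after the known
boundary values have been moved to the right-hand side. -/
def systemMatrix {ι : Type} [DecidableEq ι] (inner : Finset ι) (op : (ι → ℝ) → ι → ℝ) :
    Matrix inner inner ℝ :=
  Matrix.of fun p q => op (Pi.single (q : ι) 1) (p : ι)

/-- Positive diagonal, nonpositive off-diagonal entries, nonnegative row sums, and at least one
strictly positive row sum. -/
def IsMMatrix {ι : Type} [Fintype ι] (A : Matrix ι ι ℝ) : Prop :=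
  (∀ i, 0 < A i i) ∧ (∀ i j, i ≠ j → A i j ≤ 0) ∧ (∀ i, 0 ≤ ∑ j, A i j) ∧ ∃ i, 0 < ∑ j, A i j

/-- The matrix is invertible and its inverse is entrywise nonnegative. -/
def InversePositive {ι : Type} [Fintype ι] [DecidableEq ι] (A : Matrix ι ι ℝ) : Prop :=
  IsUnit A.det ∧ ∀ i j, 0 ≤ A⁻¹ i j

/-! ### Two space dimensions -/

/-- The coefficients `c_{k,l,p}` with `k, l ∈ {-1, 0, 1}` and `0 ≤ p ≤ 5`. -/
abbrev Stencil2 : Type := SignType → SignType → Fin 6 → ℝ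

/-- The Kronecker symbol on pairs of derivative orders. -/
def delta2 (p q : ℕ) : ℕ → ℕ → ℝ := fun m n => if m = p ∧ n = q then 1 else 0

/-- The derivatives `u^{(m,n)}` at a point that are forced by `Δu + a u_x + b u_y + d u = f` and its
derivatives, when `u^{(0,n)} = w 0 n` and `u^{(1,n)} = w 1 n`; here `a m n`, `b m n`, `d m n`,
`f m n` are the derivatives of the coefficients and of the source at that point. -/
def pdeJet2 (a b d w f : ℕ → ℕ → ℝ) : ℕ → ℕ → ℝ
  | 0, n => w 0 n
  | 1, n => w 1 n
  | m + 2, n => f m n - pdeJet2 a b d w f m (n + 2)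
      - ∑ i : Fin (m + 1), ∑ j : Fin (n + 1),
          (m.choose i : ℝ) * (n.choose j : ℝ) *
            (a (m - i) (n - j) * pdeJet2 a b d w f (i + 1) j
              + b (m - i) (n - j) * pdeJet2 a b d w f i (j + 1)
              + d (m - i) (n - j) * pdeJet2 a b d w f i j)
  termination_by m _ => m
  decreasing_by all_goals omega

/-- The Taylor polynomial of degree at most five with derivatives `v m n` at the origin. -/
def taylor2 (v : ℕ → ℕ → ℝ) (x y : ℝ) : ℝ :=
  ∑ m ∈ Finset.range 6, ∑ n ∈ Finset.range (6 - m),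
    v m n * (x ^ m * y ^ n / ((m.factorial : ℝ) * (n.factorial : ℝ)))

/-- The polynomial `G_{5,m,n}` (used for `m ≤ 1`, `m + n ≤ 5`): the factor of `u^{(m,n)}` in the
degree-five Taylor polynomial of a solution `u`. -/
def polyG2 (a b d : ℕ → ℕ → ℝ) (m n : ℕ) : ℝ → ℝ → ℝ :=
  taylor2 (pdeJet2 a b d (delta2 m n) 0)

/-- The polynomial `H_{5,m,n}` (used for `m + n ≤ 3`): the factor of `f^{(m,n)}` in the
degree-five Taylor polynomial of a solution `u`. -/
def polyH2 (a b d : ℕ → ℕ → ℝ) (m n : ℕ) : ℝ → ℝ → ℝ :=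
  taylor2 (pdeJet2 a b d 0 (delta2 m n))

/-- `∑_{k,l} C_{k,l}(h) * P (k h, l h)`. -/
def applyStencil2 (c : Stencil2) (P : ℝ → ℝ → ℝ) (h : ℝ) : ℝ :=
  ∑ k : SignType, ∑ l : SignType, coeffPoly (c k l) h * P ((k : ℝ) * h) ((l : ℝ) * h)

/-- Derivatives of the full reaction coefficient `d₁ / (r h) + d₂`, where `τ = r h`. -/
def reaction2 (r : ℝ) (d₁ d₂ : ℕ → ℕ → ℝ) (h : ℝ) : ℕ → ℕ → ℝ :=
  fun m n => d₁ m n / (r * h) + d₂ m n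

/-- `c` is the compact 9-point stencil for `Δu + a u_x + b u_y + (d₁ / (r h)) u + d₂ u = f` at a
point where `a m n`, `b m n`, `d₁ m n`, `d₂ m n` are the derivatives of the coefficients. -/
def IsCompactStencil2 (r : ℝ) (a b d₁ d₂ : ℕ → ℕ → ℝ) (c : Stencil2) : Prop :=
  -- the consistency equations `I_{5,m,n} = O(h^6)`
  (∀ m n : ℕ, m ≤ 1 → m + n ≤ 5 →
    (fun h : ℝ => applyStencil2 c (polyG2 a b (reaction2 r d₁ d₂ h) m n) h)
      =O[𝓝[>] 0] fun h : ℝ => h ^ 6) ∧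
  -- the `h^0` term of the right-hand side is `f`, whatever the derivatives of `f` are
  (∀ f : ℕ → ℕ → ℝ, Tendsto
    (fun h : ℝ => (∑ m ∈ Finset.range 4, ∑ n ∈ Finset.range (4 - m),
      f m n * applyStencil2 c (polyH2 a b (reaction2 r d₁ d₂ h) m n) h) / h ^ 2)
    (𝓝[>] 0) (𝓝 (f 0 0))) ∧
  -- normalisation and prescribed zeros
  c 0 0 0 = -10 / 3 ∧
  VanishFrom 5 (c (-1) 0) ∧ VanishFrom 4 (c (-1) 1) ∧ VanishFrom 5 (c 0 (-1)) ∧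
  VanishFrom 4 (c 0 0) ∧ VanishFrom 3 (c 0 1) ∧ VanishFrom 3 (c 1 (-1)) ∧
  VanishFrom 2 (c 1 0) ∧ VanishFrom 1 (c 1 1)

/-- `∂_x^m ∂_y^n F` at `(x, y)`, the time `t` being fixed. -/
def jet2 (F : ℝ → ℝ → ℝ → ℝ) (x y t : ℝ) : ℕ → ℕ → ℝ :=
  fun m n => iteratedDeriv m (fun x' => iteratedDeriv n (fun y' => F x' y' t) y) x

/-- `a = (κ_x - α) / κ`. -/
def convX2 (κ α : ℝ → ℝ → ℝ → ℝ) : ℝ → ℝ → ℝ → ℝ :=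
  fun x y t => (deriv (fun x' => κ x' y t) x - α x y t) / κ x y t

/-- `b = (κ_y - β) / κ`. -/
def convY2 (κ β : ℝ → ℝ → ℝ → ℝ) : ℝ → ℝ → ℝ → ℝ :=
  fun x y t => (deriv (fun y' => κ x y' t) y - β x y t) / κ x y t

/-- The nine-point stencil at the space-time point `(x, y, t)` for the time discretisation `S` of
`u_t - ∇·(κ ∇u) + α u_x + β u_y + lam u = φ`: here `d₁ = -weight / κ` and `d₂ = -lam / κ`. -/
def IsParabolicStencil2 (S : TimeScheme) (r : ℝ) (κ α β lam : ℝ → ℝ → ℝ → ℝ) (x y t : ℝ)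
    (c : Stencil2) : Prop :=
  IsCompactStencil2 r (jet2 (convX2 κ α) x y t) (jet2 (convY2 κ β) x y t)
    (jet2 (fun x y t => -S.weight / κ x y t) x y t)
    (jet2 (fun x y t => -lam x y t / κ x y t) x y t) c

/-- `F` is smooth on `[l₁, l₂]² × [0, T]`. -/
def SmoothOnBox2 (l₁ l₂ T : ℝ) (F : ℝ → ℝ → ℝ → ℝ) : Prop :=
  ContDiffOn ℝ ∞ (fun p : ℝ × ℝ × ℝ => F p.1 p.2.1 p.2.2)
    (Set.Icc l₁ l₂ ×ˢ Set.Icc l₁ l₂ ×ˢ Set.Icc 0 T)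

/-- Indices of the interior nodes of the grid `{0, …, N}²`. -/
def gridInner2 (N : ℕ) : Finset (ℤ × ℤ) := Finset.Ioo (0 : ℤ) N ×ˢ Finset.Ioo (0 : ℤ) N

/-- Indices of the boundary nodes of the grid `{0, …, N}²`. -/
def gridBdry2 (N : ℕ) : Finset (ℤ × ℤ) :=
  (Finset.Icc (0 : ℤ) N ×ˢ Finset.Icc (0 : ℤ) N) \ gridInner2 N

/-- The operator `-ℒ_h` with the stencil `C p` at the node `p`. -/
def negL2 (h : ℝ) (C : ℤ × ℤ → Stencil2) (v : ℤ × ℤ → ℝ) (p : ℤ × ℤ) : ℝ :=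
  1 / h ^ 2 * ∑ k : SignType, ∑ l : SignType,
    -coeffPoly (C p k l) h * v (p.1 + (k : ℤ), p.2 + (l : ℤ))

/-- The sign condition and the sum condition at the mesh size `h`. -/
def SignSumCondition2 (h : ℝ) (c : Stencil2) : Prop :=
  0 < -coeffPoly (c 0 0) h ∧
  (∀ k l : SignType, (k, l) ≠ (0, 0) → -coeffPoly (c k l) h ≤ 0) ∧
  0 ≤ ∑ k : SignType, ∑ l : SignType, -coeffPoly (c k l) h

/-! ### Three space dimensions -/

/-- The coefficients `c_{k,l,s,p}` with `k, l, s ∈ {-1, 0, 1}` and `0 ≤ p ≤ 5`. -/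
abbrev Stencil3 : Type := SignType → SignType → SignType → Fin 6 → ℝ

/-- The Kronecker symbol on triples of derivative orders. -/
def delta3 (p q s : ℕ) : ℕ → ℕ → ℕ → ℝ :=
  fun m n o => if m = p ∧ n = q ∧ o = s then 1 else 0

/-- The derivatives `u^{(m,n,o)}` at a point that are forced by
`Δu + a u_x + b u_y + c u_z + d u = f` and its derivatives, when `u^{(0,n,o)} = w 0 n o` and
`u^{(1,n,o)} = w 1 n o`. -/
def pdeJet3 (a b c d w f : ℕ → ℕ → ℕ → ℝ) : ℕ → ℕ → ℕ → ℝ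
  | 0, n, o => w 0 n o
  | 1, n, o => w 1 n o
  | m + 2, n, o => f m n o - pdeJet3 a b c d w f m (n + 2) o - pdeJet3 a b c d w f m n (o + 2)
      - ∑ i : Fin (m + 1), ∑ j : Fin (n + 1), ∑ k : Fin (o + 1),
          (m.choose i : ℝ) * (n.choose j : ℝ) * (o.choose k : ℝ) *
            (a (m - i) (n - j) (o - k) * pdeJet3 a b c d w f (i + 1) j k
              + b (m - i) (n - j) (o - k) * pdeJet3 a b c d w f i (j + 1) k
              + c (m - i) (n - j) (o - k) * pdeJet3 a b c d w f i j (k + 1)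
              + d (m - i) (n - j) (o - k) * pdeJet3 a b c d w f i j k)
  termination_by m _ _ => m
  decreasing_by all_goals omega

/-- The Taylor polynomial of degree at most five with derivatives `v m n o` at the origin. -/
def taylor3 (v : ℕ → ℕ → ℕ → ℝ) (x y z : ℝ) : ℝ :=
  ∑ m ∈ Finset.range 6, ∑ n ∈ Finset.range (6 - m), ∑ o ∈ Finset.range (6 - m - n),
    v m n o * (x ^ m * y ^ n * z ^ o /
      ((m.factorial : ℝ) * (n.factorial : ℝ) * (o.factorial : ℝ)))

/-- The polynomial `G_{5,m,n,o}` (used for `m ≤ 1`, `m + n + o ≤ 5`). -/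
def polyG3 (a b c d : ℕ → ℕ → ℕ → ℝ) (m n o : ℕ) : ℝ → ℝ → ℝ → ℝ :=
  taylor3 (pdeJet3 a b c d (delta3 m n o) 0)

/-- The polynomial `H_{5,m,n,o}` (used for `m + n + o ≤ 3`). -/
def polyH3 (a b c d : ℕ → ℕ → ℕ → ℝ) (m n o : ℕ) : ℝ → ℝ → ℝ → ℝ :=
  taylor3 (pdeJet3 a b c d 0 (delta3 m n o))

/-- `∑_{k,l,s} C_{k,l,s}(h) * P (k h, l h, s h)`. -/
def applyStencil3 (C : Stencil3) (P : ℝ → ℝ → ℝ → ℝ) (h : ℝ) : ℝ :=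
  ∑ k : SignType, ∑ l : SignType, ∑ s : SignType,
    coeffPoly (C k l s) h * P ((k : ℝ) * h) ((l : ℝ) * h) ((s : ℝ) * h)

/-- Derivatives of the full reaction coefficient `d₁ / (r h) + d₂`, where `τ = r h`. -/
def reaction3 (r : ℝ) (d₁ d₂ : ℕ → ℕ → ℕ → ℝ) (h : ℝ) : ℕ → ℕ → ℕ → ℝ :=
  fun m n o => d₁ m n o / (r * h) + d₂ m n o

/-- `C` is the compact 19-point stencil for
`Δu + a u_x + b u_y + c u_z + (d₁ / (r h)) u + d₂ u = f` at a point where `a m n o`, … are the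
derivatives of the coefficients. -/
def IsCompactStencil3 (r : ℝ) (a b c d₁ d₂ : ℕ → ℕ → ℕ → ℝ) (C : Stencil3) : Prop :=
  -- the consistency equations `I_{5,m,n,o} = O(h^6)`
  (∀ m n o : ℕ, m ≤ 1 → m + n + o ≤ 5 →
    (fun h : ℝ => applyStencil3 C (polyG3 a b c (reaction3 r d₁ d₂ h) m n o) h)
      =O[𝓝[>] 0] fun h : ℝ => h ^ 6) ∧
  -- the `h^0` term of the right-hand side is `f`, whatever the derivatives of `f` are
  (∀ f : ℕ → ℕ → ℕ → ℝ, Tendsto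
    (fun h : ℝ => (∑ m ∈ Finset.range 4, ∑ n ∈ Finset.range (4 - m),
      ∑ o ∈ Finset.range (4 - m - n),
        f m n o * applyStencil3 C (polyH3 a b c (reaction3 r d₁ d₂ h) m n o) h) / h ^ 2)
    (𝓝[>] 0) (𝓝 (f 0 0 0))) ∧
  -- the eight corner coefficients vanish, normalisation, and prescribed zeros
  (∀ k l s : SignType, k ≠ 0 → l ≠ 0 → s ≠ 0 → VanishFrom 0 (C k l s)) ∧
  C 0 0 0 0 = -4 ∧
  VanishFrom 5 (C (-1) 0 (-1)) ∧ VanishFrom 5 (C (-1) 0 0) ∧ VanishFrom 4 (C (-1) 0 1) ∧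
  VanishFrom 4 (C (-1) 1 0) ∧ VanishFrom 5 (C 0 (-1) (-1)) ∧ VanishFrom 4 (C 0 (-1) 0) ∧
  VanishFrom 3 (C 0 (-1) 1) ∧ VanishFrom 4 (C 0 0 (-1)) ∧ VanishFrom 4 (C 0 0 0) ∧
  VanishFrom 3 (C 0 0 1) ∧ VanishFrom 3 (C 0 1 (-1)) ∧ VanishFrom 3 (C 0 1 0) ∧
  VanishFrom 2 (C 0 1 1) ∧ VanishFrom 3 (C 1 (-1) 0) ∧ VanishFrom 3 (C 1 0 (-1)) ∧
  VanishFrom 2 (C 1 0 0) ∧ VanishFrom 2 (C 1 0 1) ∧ VanishFrom 1 (C 1 1 0)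

/-- `∂_x^m ∂_y^n ∂_z^o F` at `(x, y, z)`, the time `t` being fixed. -/
def jet3 (F : ℝ → ℝ → ℝ → ℝ → ℝ) (x y z t : ℝ) : ℕ → ℕ → ℕ → ℝ :=
  fun m n o => iteratedDeriv m (fun x' => iteratedDeriv n
    (fun y' => iteratedDeriv o (fun z' => F x' y' z' t) z) y) x

/-- `a = (κ_x - α) / κ`. -/
def convX3 (κ α : ℝ → ℝ → ℝ → ℝ → ℝ) : ℝ → ℝ → ℝ → ℝ → ℝ :=
  fun x y z t => (deriv (fun x' => κ x' y z t) x - α x y z t) / κ x y z t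

/-- `b = (κ_y - β) / κ`. -/
def convY3 (κ β : ℝ → ℝ → ℝ → ℝ → ℝ) : ℝ → ℝ → ℝ → ℝ → ℝ :=
  fun x y z t => (deriv (fun y' => κ x y' z t) y - β x y z t) / κ x y z t

/-- `c = (κ_z - γ) / κ`. -/
def convZ3 (κ γ : ℝ → ℝ → ℝ → ℝ → ℝ) : ℝ → ℝ → ℝ → ℝ → ℝ :=
  fun x y z t => (deriv (fun z' => κ x y z' t) z - γ x y z t) / κ x y z t

/-- The 19-point stencil at the space-time point `(x, y, z, t)` for the time discretisation `S` of
`u_t - ∇·(κ ∇u) + α u_x + β u_y + γ u_z + lam u = φ`. -/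
def IsParabolicStencil3 (S : TimeScheme) (r : ℝ) (κ α β γ lam : ℝ → ℝ → ℝ → ℝ → ℝ)
    (x y z t : ℝ) (C : Stencil3) : Prop :=
  IsCompactStencil3 r (jet3 (convX3 κ α) x y z t) (jet3 (convY3 κ β) x y z t)
    (jet3 (convZ3 κ γ) x y z t)
    (jet3 (fun x y z t => -S.weight / κ x y z t) x y z t)
    (jet3 (fun x y z t => -lam x y z t / κ x y z t) x y z t) C

/-- `F` is smooth on `[l₁, l₂]³ × [0, T]`. -/
def SmoothOnBox3 (l₁ l₂ T : ℝ) (F : ℝ → ℝ → ℝ → ℝ → ℝ) : Prop :=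
  ContDiffOn ℝ ∞ (fun p : ℝ × ℝ × ℝ × ℝ => F p.1 p.2.1 p.2.2.1 p.2.2.2)
    (Set.Icc l₁ l₂ ×ˢ Set.Icc l₁ l₂ ×ˢ Set.Icc l₁ l₂ ×ˢ Set.Icc 0 T)

/-- Indices of the interior nodes of the grid `{0, …, N}³`. -/
def gridInner3 (N : ℕ) : Finset (ℤ × ℤ × ℤ) :=
  Finset.Ioo (0 : ℤ) N ×ˢ Finset.Ioo (0 : ℤ) N ×ˢ Finset.Ioo (0 : ℤ) N

/-- Indices of the boundary nodes of the grid `{0, …, N}³`. -/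
def gridBdry3 (N : ℕ) : Finset (ℤ × ℤ × ℤ) :=
  (Finset.Icc (0 : ℤ) N ×ˢ Finset.Icc (0 : ℤ) N ×ˢ Finset.Icc (0 : ℤ) N) \ gridInner3 N

/-- The operator `-ℒ_h` with the stencil `C p` at the node `p`. -/
def negL3 (h : ℝ) (C : ℤ × ℤ × ℤ → Stencil3) (v : ℤ × ℤ × ℤ → ℝ) (p : ℤ × ℤ × ℤ) : ℝ :=
  1 / h ^ 2 * ∑ k : SignType, ∑ l : SignType, ∑ s : SignType,
    -coeffPoly (C p k l s) h * v (p.1 + (k : ℤ), p.2.1 + (l : ℤ), p.2.2 + (s : ℤ))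

/-- The sign condition and the sum condition at the mesh size `h`. -/
def SignSumCondition3 (h : ℝ) (C : Stencil3) : Prop :=
  0 < -coeffPoly (C 0 0 0) h ∧
  (∀ k l s : SignType, (k, l, s) ≠ (0, 0, 0) → -coeffPoly (C k l s) h ≤ 0) ∧
  0 ≤ ∑ k : SignType, ∑ l : SignType, ∑ s : SignType, -coeffPoly (C k l s) h

end

/-! Replace `u` by `x ↦ u (h x)`. Because `τ = r h`, the reaction coefficient `d₁ / (r h) + d₂`
turns into `h d₁ / r + h² d₂`, so the rescaled equation is `Δv` plus lower-order terms that are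
polynomial in `h` and divisible by `h`. The consistency equation of `u^(e)`, divided by `h^|e|`, is
then a polynomial in `h`. Its `h^j` coefficient is `∑ₖ harm e (node k) * c_{k,j}` plus a term
containing only `c_{k,p}` with `p < j` (`residual_eq_add`), where `harm e` is a harmonic polynomial
of degree `|e|`; it has to vanish for `|e| + j ≤ 5` (`isBigO_iff_residual`). So a stencil is found
level by level, and the matrices are real and independent of the equation.

At each level the prescribed zeros leave as many unknowns as there are independent harmonic
polynomials on the nodes, and the homogeneous system has only the zero solution (`eq_zero_of_harm2`,
`eq_zero_of_harm3`). This gives uniqueness. For existence the redundant equations must be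
compatible. The level-0 solution is the compact Laplacian, which acts on polynomials of degree five
as `Δ + Δ² / 12`; hence the inhomogeneities at level 1 vanish for `|e| ≥ 2`
(`sum_lap3_mul_coeff_one`). The one redundant equation at a higher level is `e = (1, 1, 1)` at level
2 in three dimensions (`lower_two_of_lap3_eq_zero`). The level-1 equation for `e = 0` says that the
`h¹` coefficients add up to `d₁ / r`.

The systems are solved over an arbitrary commutative `ℝ`-algebra. Over the algebra of bounded
functions of the space-time point, this yields stencil coefficients bounded uniformly in the point
(`exists_bounded_isPartial`). For small `h` the signs are then those at `h = 0`, and the coefficient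
sum is at most `-δ h + O(h²) < 0`, since `d₁ < 0` and `κ` is bounded above; `λ` affects the sum only
from `h²` on. The weights of `-ℒ_h` thus have a strictly positive sum at every inner node, so the
maximum principle needs no connectivity argument, and it gives monotonicity; inverse positivity
follows from the same argument applied to zero extensions. -/

noncomputable section

open Polynomial

/-! ### Scaled jets of solutions -/

/-- The derivatives at a point of the coefficients of
`Δu + a u_x + b u_y + c u_z + (d₁ / h) u + d₂ u = f`, with values in a ring. -/
structure CoeffJets (A : Type*) where
  a : ℕ → ℕ → ℕ → A
  b : ℕ → ℕ → ℕ → A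
  c : ℕ → ℕ → ℕ → A
  d₁ : ℕ → ℕ → ℕ → A
  d₂ : ℕ → ℕ → ℕ → A

namespace CoeffJets

variable {A B : Type*} [CommRing A] [CommRing B]

/-- A first-order coefficient after the substitution `x ↦ h x`; the variable is `h`. -/
def scale (a : ℕ → ℕ → ℕ → A) (m n o : ℕ) : A[X] := C (a m n o) * X ^ (m + n + o + 1)

/-- The reaction coefficient after the substitution `x ↦ h x`. -/
def reac (J : CoeffJets A) (m n o : ℕ) : A[X] :=
  C (J.d₁ m n o) * X ^ (m + n + o + 1) + C (J.d₂ m n o) * X ^ (m + n + o + 2)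

/-- The derivatives of `x ↦ u (h x)`, as polynomials in `h`, that are forced by the equation. -/
def jet (J : CoeffJets A) (w f : ℕ → ℕ → ℕ → A) : ℕ → ℕ → ℕ → A[X]
  | 0, n, o => C (w 0 n o)
  | 1, n, o => C (w 1 n o)
  | m + 2, n, o => C (f m n o) - jet J w f m (n + 2) o - jet J w f m n (o + 2)
      - ∑ i : Fin (m + 1), ∑ j : Fin (n + 1), ∑ k : Fin (o + 1),
          ((m.choose i : A[X]) * (n.choose j : A[X]) * (o.choose k : A[X])) *
            (scale J.a (m - i) (n - j) (o - k) * jet J w f (i + 1) j k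
              + scale J.b (m - i) (n - j) (o - k) * jet J w f i (j + 1) k
              + scale J.c (m - i) (n - j) (o - k) * jet J w f i j (k + 1)
              + J.reac (m - i) (n - j) (o - k) * jet J w f i j k)
  termination_by m _ _ => m
  decreasing_by all_goals omega

theorem jet_add_two (J : CoeffJets A) (w f : ℕ → ℕ → ℕ → A) (m n o : ℕ) :
    J.jet w f (m + 2) n o = C (f m n o) - J.jet w f m (n + 2) o - J.jet w f m n (o + 2)
      - ∑ i : Fin (m + 1), ∑ j : Fin (n + 1), ∑ k : Fin (o + 1),
          ((m.choose i : A[X]) * (n.choose j : A[X]) * (o.choose k : A[X])) *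
            (scale J.a (m - i) (n - j) (o - k) * J.jet w f (i + 1) j k
              + scale J.b (m - i) (n - j) (o - k) * J.jet w f i (j + 1) k
              + scale J.c (m - i) (n - j) (o - k) * J.jet w f i j (k + 1)
              + J.reac (m - i) (n - j) (o - k) * J.jet w f i j k) := by
  rw [jet]

/-- The image of the data under a ring homomorphism. -/
def map (φ : A →+* B) (J : CoeffJets A) : CoeffJets B where
  a m n o := φ (J.a m n o)
  b m n o := φ (J.b m n o)
  c m n o := φ (J.c m n o)
  d₁ m n o := φ (J.d₁ m n o)
  d₂ m n o := φ (J.d₂ m n o)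

/-- The recursion uses ring operations only. This naturality is what allows a computation with
bounded functions as coefficients to be evaluated at each point. -/
theorem jet_map (φ : A →+* B) (J : CoeffJets A) (w f : ℕ → ℕ → ℕ → A) (m n o : ℕ) :
    (J.map φ).jet (fun m n o => φ (w m n o)) (fun m n o => φ (f m n o)) m n o
      = (J.jet w f m n o).map φ := by
  induction m using Nat.strong_induction_on generalizing n o with
  | _ m ih =>
    match m with
    | 0 => simp [jet]
    | 1 => simp [jet]
    | m + 2 =>
      rw [jet_add_two, jet_add_two, ih m (by omega), ih m (by omega)]
      simp only [Polynomial.map_sub, Polynomial.map_sum, Polynomial.map_mul, Polynomial.map_add,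
        Polynomial.map_natCast, map_C]
      rw [sub_right_inj]
      refine Finset.sum_congr rfl fun i _ => Finset.sum_congr rfl fun j _ =>
        Finset.sum_congr rfl fun k _ => ?_
      rw [ih (i + 1) (by omega), ih i (by omega), ih i (by omega), ih i (by omega)]
      simp [scale, reac, map]

theorem coeff_scale_mul (a : ℕ → ℕ → ℕ → A) (m n o : ℕ) (Q : A[X]) (j : ℕ) :
    (scale a m n o * Q).coeff j =
      if m + n + o + 1 ≤ j then a m n o * Q.coeff (j - (m + n + o + 1)) else 0 := by
  rw [scale, mul_assoc, coeff_C_mul, coeff_X_pow_mul']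
  split_ifs <;> simp

theorem coeff_reac_mul (J : CoeffJets A) (m n o : ℕ) (Q : A[X]) (j : ℕ) :
    (J.reac m n o * Q).coeff j =
      (if m + n + o + 1 ≤ j then J.d₁ m n o * Q.coeff (j - (m + n + o + 1)) else 0) +
      (if m + n + o + 2 ≤ j then J.d₂ m n o * Q.coeff (j - (m + n + o + 2)) else 0) := by
  rw [reac, add_mul, coeff_add, mul_assoc, mul_assoc, coeff_C_mul, coeff_X_pow_mul', coeff_C_mul,
    coeff_X_pow_mul']
  split_ifs <;> simp

theorem coeff_binom_mul (p q s : ℕ) (Q : A[X]) (j : ℕ) :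
    (((p : A[X]) * (q : A[X]) * (s : A[X])) * Q).coeff j = (p : A) * q * s * Q.coeff j := by
  have : ((p : A[X]) * (q : A[X]) * (s : A[X])) = C ((p : A) * q * s) := by simp
  rw [this, coeff_C_mul]

/-- `scale` and `reac` are divisible by `X`, so at lowest order only the Laplacian and the source
survive. -/
theorem coeff_zero_jet_add_two (J : CoeffJets A) (w f : ℕ → ℕ → ℕ → A) (m n o : ℕ) :
    (J.jet w f (m + 2) n o).coeff 0 =
      f m n o - (J.jet w f m (n + 2) o).coeff 0 - (J.jet w f m n (o + 2)).coeff 0 := by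
  rw [jet]
  simp only [coeff_sub, finsetSum_coeff, coeff_binom_mul, coeff_add, coeff_scale_mul,
    coeff_reac_mul]
  simp

/-- A derivative of order `q` of `a`, `b`, `c` or `d₁` carries `h^(q+1)`, and `d₂` carries at least
`h²`. So the `h¹` coefficient sees only coefficients frozen at the point, that is, the summand with
the last indices. -/
theorem coeff_one_jet_add_two (J : CoeffJets A) (w f : ℕ → ℕ → ℕ → A) (m n o : ℕ) :
    (J.jet w f (m + 2) n o).coeff 1 =
      - (J.jet w f m (n + 2) o).coeff 1 - (J.jet w f m n (o + 2)).coeff 1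
      - (J.a 0 0 0 * (J.jet w f (m + 1) n o).coeff 0 + J.b 0 0 0 * (J.jet w f m (n + 1) o).coeff 0
        + J.c 0 0 0 * (J.jet w f m n (o + 1)).coeff 0
        + J.d₁ 0 0 0 * (J.jet w f m n o).coeff 0) := by
  rw [jet]
  simp only [coeff_sub, finsetSum_coeff, coeff_binom_mul, coeff_add, coeff_scale_mul,
    coeff_reac_mul]
  rw [Finset.sum_eq_single_of_mem (Fin.last m) (Finset.mem_univ _),
    Finset.sum_eq_single_of_mem (Fin.last n) (Finset.mem_univ _),
    Finset.sum_eq_single_of_mem (Fin.last o) (Finset.mem_univ _)]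
  · simp
  · intro k _ hk
    have : (k : ℕ) < o := lt_of_le_of_ne (by omega) (fun h => hk (Fin.ext h))
    have h0 : o - (k : ℕ) ≠ 0 := by omega
    simp [h0]
  · intro k _ hk
    have : (k : ℕ) < n := lt_of_le_of_ne (by omega) (fun h => hk (Fin.ext h))
    have h0 : n - (k : ℕ) ≠ 0 := by omega
    simp [h0]
  · intro k _ hk
    have : (k : ℕ) < m := lt_of_le_of_ne (by omega) (fun h => hk (Fin.ext h))
    have h0 : m - (k : ℕ) ≠ 0 := by omega
    simp [h0]

/-- The Kronecker symbol with values in a ring. -/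
def kron (A : Type*) [CommRing A] (e : ℕ × ℕ × ℕ) : ℕ → ℕ → ℕ → A :=
  fun m n o => if m = e.1 ∧ n = e.2.1 ∧ o = e.2.2 then 1 else 0

/-- The order of a derivative. -/
def order (e : ℕ × ℕ × ℕ) : ℕ := e.1 + e.2.1 + e.2.2

/-- Each power of `h` costs at least one order of differentiation, and the recursion starts from
data of order `|e|` without any power of `h`. -/
theorem coeff_jet_eq_zero (J : CoeffJets A) (e : ℕ × ℕ × ℕ) (m n o j : ℕ)
    (h : m + n + o < order e + j) : (J.jet (kron A e) 0 m n o).coeff j = 0 := by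
  induction m using Nat.strong_induction_on generalizing n o j with
  | _ m ih =>
    match m with
    | 0 | 1 =>
      simp only [jet, coeff_C, kron, ite_eq_right_iff]
      rintro rfl ⟨h1, h2, h3⟩
      simp only [order] at h
      omega
    | m + 2 =>
      rw [jet]
      simp only [coeff_sub, finsetSum_coeff, coeff_binom_mul, coeff_add, coeff_scale_mul,
        coeff_reac_mul]
      rw [ih m (by omega) _ _ _ (by omega), ih m (by omega) _ _ _ (by omega),
        Finset.sum_eq_zero]
      · simp
      intro i _
      refine Finset.sum_eq_zero fun k _ => Finset.sum_eq_zero fun l _ => ?_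
      have hi := i.2
      have hk := k.2
      have hl := l.2
      refine mul_eq_zero_of_right _ ?_
      have e1 : ∀ s, m - i + (n - k) + (o - l) + 1 ≤ s → s = j →
          (J.jet (kron A e) 0 (i + 1) k l).coeff (s - (m - i + (n - k) + (o - l) + 1)) = 0 :=
        fun s hs hj => ih _ (by omega) _ _ _ (by omega)
      have e2 : ∀ s, m - i + (n - k) + (o - l) + 1 ≤ s → s = j →
          (J.jet (kron A e) 0 i (k + 1) l).coeff (s - (m - i + (n - k) + (o - l) + 1)) = 0 :=
        fun s hs hj => ih _ (by omega) _ _ _ (by omega)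
      have e3 : ∀ s, m - i + (n - k) + (o - l) + 1 ≤ s → s = j →
          (J.jet (kron A e) 0 i k (l + 1)).coeff (s - (m - i + (n - k) + (o - l) + 1)) = 0 :=
        fun s hs hj => ih _ (by omega) _ _ _ (by omega)
      have e4 : ∀ s, m - i + (n - k) + (o - l) + 1 ≤ s → s = j →
          (J.jet (kron A e) 0 i k l).coeff (s - (m - i + (n - k) + (o - l) + 1)) = 0 :=
        fun s hs hj => ih _ (by omega) _ _ _ (by omega)
      have e5 : ∀ s, m - i + (n - k) + (o - l) + 2 ≤ s → s = j →
          (J.jet (kron A e) 0 i k l).coeff (s - (m - i + (n - k) + (o - l) + 2)) = 0 :=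
        fun s hs hj => ih _ (by omega) _ _ _ (by omega)
      split_ifs with h1 h2
      · rw [e1 _ h1 rfl, e2 _ h1 rfl, e3 _ h1 rfl, e4 _ h1 rfl, e5 _ h2 rfl]; simp
      · rw [e1 _ h1 rfl, e2 _ h1 rfl, e3 _ h1 rfl, e4 _ h1 rfl]; simp
      · omega
      · simp

/-- Undoing the substitution `x ↦ h x` recovers the jet of the equation with reaction coefficient
`d₁ / (r h) + d₂`. -/
theorem eval_jet (a b c d₁ d₂ : ℕ → ℕ → ℕ → ℝ) (r h : ℝ) (hh : h ≠ 0) (s : ℕ)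
    (w f w' f' : ℕ → ℕ → ℕ → ℝ)
    (hw : ∀ m n o, w' m n o * h ^ s = h ^ (m + n + o) * w m n o)
    (hf : ∀ m n o, f' m n o * h ^ s = h ^ (m + n + o + 2) * f m n o) (m n o : ℕ) :
    ((CoeffJets.mk a b c (fun m n o => d₁ m n o / r) d₂).jet w' f' m n o).eval h * h ^ s =
      h ^ (m + n + o) * pdeJet3 a b c (reaction3 r d₁ d₂ h) w f m n o := by
  induction m using Nat.strong_induction_on generalizing n o with
  | _ m ih =>
    match m with
    | 0 => simpa [jet, pdeJet3] using hw 0 n o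
    | 1 => simpa [jet, pdeJet3] using hw 1 n o
    | m + 2 =>
      rw [jet, pdeJet3]
      simp only [eval_sub, eval_finsetSum, eval_mul, eval_add, eval_natCast, eval_C]
      rw [sub_mul, sub_mul, sub_mul, hf, ih m (by omega), ih m (by omega)]
      simp only [mul_sub, Finset.sum_mul, Finset.mul_sum]
      congr 1
      · congr 2 <;> ring
      refine Finset.sum_congr rfl fun i _ => Finset.sum_congr rfl fun j _ =>
        Finset.sum_congr rfl fun k _ => ?_
      have h1 := ih (i + 1) (by omega) j k
      have h2 := ih i (by omega) (j + 1) k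
      have h3 := ih i (by omega) j (k + 1)
      have h4 := ih i (by omega) j k
      obtain ⟨p, hp⟩ : ∃ p, m = i + p := ⟨m - i, by omega⟩
      obtain ⟨q, hq⟩ : ∃ q, n = j + q := ⟨n - j, by omega⟩
      obtain ⟨t, ht⟩ : ∃ t, o = k + t := ⟨o - k, by omega⟩
      have ep : m - i = p := by omega
      have eq : n - j = q := by omega
      have et : o - k = t := by omega
      rw [ep, eq, et]
      simp only [scale, reac, eval_add, eval_mul, eval_C, eval_pow, eval_X, reaction3]
      -- Weights: `p + q + t` from the derivatives of the coefficient, `2` from multiplying the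
      -- equation by `h²`, the rest from the lower derivative of the solution.
      have key : h ^ (m + 2 + n + o) = h ^ (p + q + t) * h ^ 2 * h ^ ((i : ℕ) + j + k) := by
        rw [← pow_add, ← pow_add]; congr 1; omega
      rw [key]
      have e1 : h ^ ((i : ℕ) + 1 + j + k) = h * h ^ ((i : ℕ) + j + k) := by ring
      have e2 : h ^ ((i : ℕ) + (j + 1) + k) = h * h ^ ((i : ℕ) + j + k) := by ring
      have e3 : h ^ ((i : ℕ) + j + (k + 1)) = h * h ^ ((i : ℕ) + j + k) := by ring
      rw [e1] at h1
      rw [e2] at h2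
      rw [e3] at h3
      -- One of the two factors `h` absorbs the singularity of `d₁ / (r h)`; the other remains, as
      -- in `reac`.
      have hd : d₁ p q t / (r * h) * h = d₁ p q t / r := by
        rw [div_mul_eq_mul_div, mul_div_mul_right _ _ hh]
      rw [← hd]
      linear_combination ((m.choose i : ℝ) * (n.choose j : ℝ) * (o.choose k : ℝ)) *
        (a p q t * h ^ (p + q + t + 1) * h1 + b p q t * h ^ (p + q + t + 1) * h2
          + c p q t * h ^ (p + q + t + 1) * h3
          + (d₁ p q t / (r * h) * h * h ^ (p + q + t + 1)
            + d₂ p q t * h ^ (p + q + t + 2)) * h4)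

variable [Algebra ℝ A] [Algebra ℝ B]

/-- The value at `(x, y, z)` of a Taylor monomial. -/
def mono (x y z : ℝ) (m n o : ℕ) : ℝ :=
  x ^ m * y ^ n * z ^ o / ((m.factorial : ℝ) * (n.factorial : ℝ) * (o.factorial : ℝ))

/-- The degree-five Taylor polynomial with derivatives `v m n o`. -/
def taylor {M : Type*} [AddCommMonoid M] [Module ℝ M] (v : ℕ → ℕ → ℕ → M) (x y z : ℝ) : M :=
  ∑ m ∈ Finset.range 6, ∑ n ∈ Finset.range (6 - m), ∑ o ∈ Finset.range (6 - m - n),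
    mono x y z m n o • v m n o

theorem taylor_map {M N : Type*} [AddCommMonoid M] [Module ℝ M] [AddCommMonoid N] [Module ℝ N]
    (φ : M →ₗ[ℝ] N) (v : ℕ → ℕ → ℕ → M) (x y z : ℝ) :
    φ (taylor v x y z) = taylor (fun m n o => φ (v m n o)) x y z := by
  simp [taylor]

theorem taylor3_eq (v : ℕ → ℕ → ℕ → ℝ) (x y z : ℝ) : taylor3 v x y z = taylor v x y z := by
  simp only [taylor3, taylor, mono, smul_eq_mul]
  exact Finset.sum_congr rfl fun _ _ => Finset.sum_congr rfl fun _ _ =>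
    Finset.sum_congr rfl fun _ _ => mul_comm _ _

/-- The factor of the derivative `u^{(e)}` in the scaled Taylor polynomial, divided by
`h ^ |e|`. -/
def gPoly (J : CoeffJets A) (e : ℕ × ℕ × ℕ) (x y z : ℝ) : A[X] :=
  taylor (J.jet (kron A e) 0) x y z

/-- The factor of the source derivative `f^{(e)}` in the scaled Taylor polynomial, divided by
`h ^ (|e| + 2)`. -/
def hPoly (J : CoeffJets A) (e : ℕ × ℕ × ℕ) (x y z : ℝ) : A[X] :=
  taylor (J.jet 0 (kron A e)) x y z

theorem coeff_taylor (v : ℕ → ℕ → ℕ → A[X]) (x y z : ℝ) (j : ℕ) :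
    (taylor v x y z).coeff j = taylor (fun m n o => (v m n o).coeff j) x y z := by
  simp [taylor]

theorem gPoly_map (φ : A →ₐ[ℝ] B) (J : CoeffJets A) (e : ℕ × ℕ × ℕ) (x y z : ℝ) (j : ℕ) :
    ((J.map (φ : A →+* B)).gPoly e x y z).coeff j = φ ((J.gPoly e x y z).coeff j) := by
  rw [gPoly, gPoly, coeff_taylor, coeff_taylor]
  have := taylor_map φ.toLinearMap (fun m n o => (J.jet (kron A e) 0 m n o).coeff j) x y z
  rw [AlgHom.toLinearMap_apply] at this
  rw [this]
  congr 1
  funext m n o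
  have h := jet_map (φ : A →+* B) J (kron A e) 0 m n o
  have h1 : (fun m n o => (φ : A →+* B) (kron A e m n o)) = kron B e := by
    funext m n o; simp [kron]
  have h2 : (fun m n o => (φ : A →+* B) ((0 : ℕ → ℕ → ℕ → A) m n o)) = 0 := by
    funext m n o; simp
  rw [h1, h2] at h
  rw [h]
  simp

theorem taylor_scale (v : ℕ → ℕ → ℕ → ℝ) (x y z h : ℝ) :
    taylor v (x * h) (y * h) (z * h) = taylor (fun m n o => h ^ (m + n + o) * v m n o) x y z := by
  simp only [taylor, mono, smul_eq_mul]
  refine Finset.sum_congr rfl fun _ _ => Finset.sum_congr rfl fun _ _ =>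
    Finset.sum_congr rfl fun _ _ => ?_
  rw [mul_pow, mul_pow, mul_pow, pow_add, pow_add]
  ring

theorem taylor_mul_right (v : ℕ → ℕ → ℕ → ℝ) (x y z s : ℝ) :
    taylor v x y z * s = taylor (fun m n o => v m n o * s) x y z := by
  simp only [taylor, smul_eq_mul, Finset.sum_mul, mul_assoc]

theorem eval_taylor (v : ℕ → ℕ → ℕ → ℝ[X]) (x y z h : ℝ) :
    (taylor v x y z).eval h = taylor (fun m n o => (v m n o).eval h) x y z := by
  simp [taylor, eval_finsetSum]

/-- Rescaling turns the datum `u^(e) = 1` into `h^|e|`; this factor is taken out so that `gPoly`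
starts from the datum `1`. -/
theorem polyG3_eq_eval (a b c d₁ d₂ : ℕ → ℕ → ℕ → ℝ) (r h : ℝ) (hh : h ≠ 0) (m n o : ℕ)
    (x y z : ℝ) :
    polyG3 a b c (reaction3 r d₁ d₂ h) m n o (x * h) (y * h) (z * h) =
      h ^ (m + n + o) *
        ((CoeffJets.mk a b c (fun m n o => d₁ m n o / r) d₂).gPoly (m, n, o) x y z).eval h := by
  rw [polyG3, taylor3_eq, taylor_scale, gPoly, eval_taylor, mul_comm, taylor_mul_right]
  congr 1
  funext m' n' o'
  refine (eval_jet a b c d₁ d₂ r h hh (m + n + o) (delta3 m n o) 0 _ 0 (fun m' n' o' => ?_)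
    (fun _ _ _ => by simp) m' n' o').symm
  simp only [kron, delta3]
  split_ifs with hc
  · obtain ⟨rfl, rfl, rfl⟩ := hc; ring
  · simp

/-- The two extra powers of `h` come from the source, which becomes `h² f (h x)` under rescaling. -/
theorem polyH3_eq_eval (a b c d₁ d₂ : ℕ → ℕ → ℕ → ℝ) (r h : ℝ) (hh : h ≠ 0) (m n o : ℕ)
    (x y z : ℝ) :
    polyH3 a b c (reaction3 r d₁ d₂ h) m n o (x * h) (y * h) (z * h) =
      h ^ (m + n + o + 2) *
        ((CoeffJets.mk a b c (fun m n o => d₁ m n o / r) d₂).hPoly (m, n, o) x y z).eval h := by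
  rw [polyH3, taylor3_eq, taylor_scale, hPoly, eval_taylor, mul_comm, taylor_mul_right]
  congr 1
  funext m' n' o'
  refine (eval_jet a b c d₁ d₂ r h hh (m + n + o + 2) 0 (delta3 m n o) 0 _
    (fun _ _ _ => by simp) (fun m' n' o' => ?_) m' n' o').symm
  simp only [kron, delta3]
  split_ifs with hc
  · obtain ⟨rfl, rfl, rfl⟩ := hc; ring
  · simp

/-- The lowest coefficient is the value of a harmonic polynomial. -/
theorem coeff_zero_gPoly (J : CoeffJets A) (e : ℕ × ℕ × ℕ) (x y z : ℝ) :
    (J.gPoly e x y z).coeff 0 = algebraMap ℝ A (polyG3 0 0 0 0 e.1 e.2.1 e.2.2 x y z) := by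
  have key : ∀ m n o, (J.jet (kron A e) 0 m n o).coeff 0 =
      algebraMap ℝ A (pdeJet3 0 0 0 0 (delta3 e.1 e.2.1 e.2.2) 0 m n o) := by
    intro m
    induction m using Nat.strong_induction_on with
    | _ m ih =>
      intro n o
      match m with
      | 0 | 1 => simp only [jet, pdeJet3, kron, delta3, coeff_C_zero]; split_ifs <;> simp
      | m + 2 =>
        rw [coeff_zero_jet_add_two, ih m (by omega), ih m (by omega), pdeJet3]
        simp
  rw [gPoly, coeff_taylor, polyG3, taylor3_eq]
  have := taylor_map (Algebra.linearMap ℝ A) (pdeJet3 0 0 0 0 (delta3 e.1 e.2.1 e.2.2) 0) x y z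
  rw [Algebra.linearMap_apply] at this
  rw [this]
  simp only [key, Algebra.linearMap_apply]

end CoeffJets

end

noncomputable section

open Polynomial

/-! ### Consistency equations as coefficient equations -/

/-- Turns a one-sided asymptotic condition into finitely many algebraic ones. Inductively `X ^ N`
divides `Q`; the quotient is then `O(h)`, so its constant term, which is the next coefficient of
`Q`, vanishes. -/
theorem isBigO_eval_pow_iff (Q : ℝ[X]) (N : ℕ) :
    (fun h : ℝ => Q.eval h) =O[𝓝[>] 0] (fun h : ℝ => h ^ N) ↔ ∀ j < N, Q.coeff j = 0 := by
  constructor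
  · induction N with
    | zero => intro _ j hj; omega
    | succ N ih =>
      intro hO
      have hO' : (fun h : ℝ => Q.eval h) =O[𝓝[>] 0] (fun h : ℝ => h ^ N) := by
        refine hO.trans ?_
        have h1 : (fun h : ℝ => h) =O[𝓝[>] 0] (fun _ : ℝ => (1 : ℝ)) :=
          ((continuous_id.tendsto (0 : ℝ)).mono_left nhdsWithin_le_nhds).isBigO_one ℝ
        simpa [pow_succ] using (Asymptotics.isBigO_refl (fun h : ℝ => h ^ N) _).mul h1
      have hlt := ih hO'
      obtain ⟨R, hR⟩ := X_pow_dvd_iff.mpr hlt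
      have h2 : (fun h : ℝ => R.eval h) =O[𝓝[>] 0] (fun h : ℝ => h) := by
        have h3 := (Asymptotics.isBigO_refl (fun h : ℝ => (h ^ N)⁻¹) (𝓝[>] 0)).mul hO
        refine h3.congr' ?_ ?_
        · filter_upwards [self_mem_nhdsWithin] with h hh
          have : h ≠ 0 := ne_of_gt hh
          rw [hR]; simp only [eval_mul, eval_pow, eval_X]; field_simp
        · filter_upwards [self_mem_nhdsWithin] with h hh
          have : h ≠ 0 := ne_of_gt hh
          rw [pow_succ]; field_simp
      have h4 : Tendsto (fun h : ℝ => R.eval h) (𝓝[>] 0) (𝓝 0) :=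
        h2.trans_tendsto ((continuous_id.tendsto (0 : ℝ)).mono_left nhdsWithin_le_nhds)
      have h5 : Tendsto (fun h : ℝ => R.eval h) (𝓝[>] 0) (𝓝 (R.eval 0)) :=
        (R.continuous.tendsto 0).mono_left nhdsWithin_le_nhds
      have h6 : R.coeff 0 = 0 := by
        rw [coeff_zero_eq_eval_zero]; exact tendsto_nhds_unique h5 h4
      intro j hj
      rcases Nat.lt_succ_iff_lt_or_eq.mp hj with h7 | rfl
      · exact hlt j h7
      · rw [hR, coeff_X_pow_mul']; simpa using h6
  · intro hc
    obtain ⟨R, hR⟩ := X_pow_dvd_iff.mpr hc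
    have h1 : (fun h : ℝ => R.eval h) =O[𝓝[>] 0] (fun _ : ℝ => (1 : ℝ)) :=
      ((R.continuous.tendsto (0 : ℝ)).mono_left nhdsWithin_le_nhds).isBigO_one ℝ
    have h2 := (Asymptotics.isBigO_refl (fun h : ℝ => h ^ N) (𝓝[>] 0)).mul h1
    simpa [hR] using h2

namespace CoeffJets

variable {A B K : Type*} [CommRing A] [CommRing B] [Algebra ℝ A] [Algebra ℝ B] [Fintype K]

/-- The `h^{|e| + j}` coefficient of the consistency equation that belongs to `u^{(e)}`, for a
stencil with nodes `pos k`. -/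
def residual (J : CoeffJets A) (pos : K → ℝ × ℝ × ℝ) (c : K → Fin 6 → A) (e : ℕ × ℕ × ℕ)
    (j : ℕ) : A :=
  ∑ p : Fin 6, ∑ k, if (p : ℕ) ≤ j then
    c k p * (J.gPoly e (pos k).1 (pos k).2.1 (pos k).2.2).coeff (j - p) else 0

/-- The coefficients of a stencil as a polynomial. -/
def cPoly (c : Fin 6 → A) : A[X] := ∑ p : Fin 6, C (c p) * X ^ (p : ℕ)

theorem eval_cPoly (c : Fin 6 → ℝ) (h : ℝ) : (cPoly c).eval h = coeffPoly c h := by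
  simp [cPoly, coeffPoly, eval_finsetSum]

theorem residual_eq_coeff (J : CoeffJets A) (pos : K → ℝ × ℝ × ℝ) (c : K → Fin 6 → A)
    (e : ℕ × ℕ × ℕ) (j : ℕ) :
    J.residual pos c e j =
      (∑ k, cPoly (c k) * J.gPoly e (pos k).1 (pos k).2.1 (pos k).2.2).coeff j := by
  rw [residual, Finset.sum_comm, finsetSum_coeff]
  refine Finset.sum_congr rfl fun k _ => ?_
  rw [cPoly, Finset.sum_mul, finsetSum_coeff]
  refine Finset.sum_congr rfl fun p _ => ?_
  rw [mul_assoc, coeff_C_mul, coeff_X_pow_mul']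
  split_ifs <;> simp

theorem residual_map (φ : A →ₐ[ℝ] B) (J : CoeffJets A) (pos : K → ℝ × ℝ × ℝ)
    (c : K → Fin 6 → A) (e : ℕ × ℕ × ℕ) (j : ℕ) :
    (J.map (φ : A →+* B)).residual pos (fun k p => φ (c k p)) e j = φ (J.residual pos c e j) := by
  simp only [residual, map_sum, gPoly_map]
  refine Finset.sum_congr rfl fun _ _ => Finset.sum_congr rfl fun _ _ => ?_
  split_ifs <;> simp

/-- The factor `h^|e|` shifts the coefficients, so the equation of `e` constrains only the levels `j
≤ 5 - |e|`. High levels therefore meet only harmonic polynomials of low degree. -/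
theorem isBigO_iff_residual (a b c d₁ d₂ : ℕ → ℕ → ℕ → ℝ) (r : ℝ) (pos : K → ℝ × ℝ × ℝ)
    (s : K → Fin 6 → ℝ) (m n o : ℕ) :
    (fun h : ℝ => ∑ k, coeffPoly (s k) h * polyG3 a b c (reaction3 r d₁ d₂ h) m n o
        ((pos k).1 * h) ((pos k).2.1 * h) ((pos k).2.2 * h)) =O[𝓝[>] 0] (fun h : ℝ => h ^ 6) ↔
      ∀ j, m + n + o + j ≤ 5 →
        (CoeffJets.mk a b c (fun m n o => d₁ m n o / r) d₂).residual pos s (m, n, o) j = 0 := by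
  set J : CoeffJets ℝ := CoeffJets.mk a b c (fun m n o => d₁ m n o / r) d₂ with hJ
  set Q : ℝ[X] := ∑ k, cPoly (s k) * J.gPoly (m, n, o) (pos k).1 (pos k).2.1 (pos k).2.2 with hQ
  have h1 : (fun h : ℝ => ∑ k, coeffPoly (s k) h * polyG3 a b c (reaction3 r d₁ d₂ h) m n o
        ((pos k).1 * h) ((pos k).2.1 * h) ((pos k).2.2 * h)) =ᶠ[𝓝[>] 0]
      (fun h : ℝ => (X ^ (m + n + o) * Q).eval h) := by
    filter_upwards [self_mem_nhdsWithin] with h hh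
    have hh0 : h ≠ 0 := ne_of_gt hh
    simp only [hQ, eval_mul, eval_pow, eval_X, eval_finsetSum, Finset.mul_sum, eval_cPoly]
    refine Finset.sum_congr rfl fun k _ => ?_
    rw [polyG3_eq_eval a b c d₁ d₂ r h hh0]
    ring
  rw [Asymptotics.isBigO_congr h1 (EventuallyEq.refl _ _), isBigO_eval_pow_iff]
  simp only [residual_eq_coeff, ← hQ, coeff_X_pow_mul']
  constructor
  · intro H j hj
    have := H (m + n + o + j) (by omega)
    simpa using this
  · intro H j hj
    split_ifs with hle
    · exact H _ (by omega)
    · rfl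

theorem taylor_eq_of_single {M : Type*} [AddCommMonoid M] [Module ℝ M] (v : ℕ → ℕ → ℕ → M)
    (t : M) (hv : ∀ m n o, m < 6 → v m n o = if m = 2 ∧ n = 0 ∧ o = 0 then t else 0)
    (x y z : ℝ) : taylor v x y z = (x ^ 2 / 2) • t := by
  rw [taylor, Finset.sum_eq_single_of_mem 2 (by simp), Finset.sum_eq_single_of_mem 0 (by simp),
    Finset.sum_eq_single_of_mem 0 (by simp), hv _ _ _ (by norm_num)]
  · simp [mono]
  · intro o _ ho
    rw [hv _ _ _ (by norm_num)]; simp [ho]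
  · intro n _ hn
    refine Finset.sum_eq_zero fun o _ => ?_
    rw [hv _ _ _ (by norm_num)]; simp [hn]
  · intro m hm hm2
    refine Finset.sum_eq_zero fun n _ => Finset.sum_eq_zero fun o _ => ?_
    rw [hv _ _ _ (by simpa using hm)]; simp [hm2]

/-- At lowest order this is the solution of `Δu = 1` with zero data for `u` and `u_x` on `x = 0`,
namely `x² / 2`. -/
theorem coeff_zero_hPoly_zero (J : CoeffJets A) (x y z : ℝ) :
    (J.hPoly (0, 0, 0) x y z).coeff 0 = algebraMap ℝ A (x ^ 2 / 2) := by
  have h2 : ∀ n o, (J.jet 0 (kron A (0, 0, 0)) 2 n o).coeff 0 =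
      if n = 0 ∧ o = 0 then 1 else 0 := by
    intro n o
    rw [coeff_zero_jet_add_two]
    simp [jet, kron]
  have h3 : ∀ n o, (J.jet 0 (kron A (0, 0, 0)) 3 n o).coeff 0 = 0 := by
    intro n o
    rw [coeff_zero_jet_add_two]
    simp [jet, kron]
  have h4 : ∀ n o, (J.jet 0 (kron A (0, 0, 0)) 4 n o).coeff 0 = 0 := by
    intro n o
    rw [coeff_zero_jet_add_two, h2, h2]
    simp [kron]
  have h5 : ∀ n o, (J.jet 0 (kron A (0, 0, 0)) 5 n o).coeff 0 = 0 := by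
    intro n o
    rw [coeff_zero_jet_add_two, h3, h3]
    simp [kron]
  rw [hPoly, coeff_taylor, taylor_eq_of_single _ (1 : A), Algebra.algebraMap_eq_smul_one]
  intro m n o hm
  interval_cases m
  · simp [jet]
  · simp [jet]
  · simp [h2]
  · simp [h3]
  · simp [h4]
  · simp [h5]

/-- The source derivative `f^(e)` enters with `h^(|e|+2)`, so after division by `h²` only `e = 0`
survives, with half the second `x`-moment of the `h⁰` coefficients. The source condition thus
follows from the level-0 values alone. -/
theorem tendsto_source (a b c d₁ d₂ : ℕ → ℕ → ℕ → ℝ) (r : ℝ) (pos : K → ℝ × ℝ × ℝ)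
    (s : K → Fin 6 → ℝ) (hs : ∑ k, s k 0 * ((pos k).1 ^ 2 / 2) = 1) (m n o : ℕ) :
    Tendsto (fun h : ℝ => (∑ k, coeffPoly (s k) h * polyH3 a b c (reaction3 r d₁ d₂ h) m n o
        ((pos k).1 * h) ((pos k).2.1 * h) ((pos k).2.2 * h)) / h ^ 2) (𝓝[>] 0)
      (𝓝 (if m = 0 ∧ n = 0 ∧ o = 0 then 1 else 0)) := by
  set J : CoeffJets ℝ := CoeffJets.mk a b c (fun m n o => d₁ m n o / r) d₂ with hJ
  set Q : ℝ[X] := ∑ k, cPoly (s k) * J.hPoly (m, n, o) (pos k).1 (pos k).2.1 (pos k).2.2 with hQ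
  have h1 : (fun h : ℝ => (∑ k, coeffPoly (s k) h * polyH3 a b c (reaction3 r d₁ d₂ h) m n o
        ((pos k).1 * h) ((pos k).2.1 * h) ((pos k).2.2 * h)) / h ^ 2) =ᶠ[𝓝[>] 0]
      (fun h : ℝ => (X ^ (m + n + o) * Q).eval h) := by
    filter_upwards [self_mem_nhdsWithin] with h hh
    have hh0 : h ≠ 0 := ne_of_gt hh
    simp only [hQ, eval_mul, eval_pow, eval_X, eval_finsetSum, Finset.mul_sum, eval_cPoly,
      Finset.sum_div]
    refine Finset.sum_congr rfl fun k _ => ?_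
    rw [polyH3_eq_eval a b c d₁ d₂ r h hh0, ← hJ, pow_add]
    field_simp
  have h2 := (((X ^ (m + n + o) * Q).continuous.tendsto 0).mono_left
    (nhdsWithin_le_nhds (s := Set.Ioi 0))).congr' h1.symm
  convert h2 using 2
  split_ifs with h0
  · obtain ⟨rfl, rfl, rfl⟩ := h0
    rw [← hs, hQ]
    simp only [add_zero, pow_zero, one_mul, eval_finsetSum, eval_mul]
    refine Finset.sum_congr rfl fun k _ => ?_
    rw [← coeff_zero_eq_eval_zero, ← coeff_zero_eq_eval_zero, coeff_zero_hPoly_zero]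
    simp [cPoly, Fin.sum_univ_succ]
  · have : m + n + o ≠ 0 := by omega
    rw [eval_mul, eval_pow, eval_X, zero_pow this, zero_mul]

end CoeffJets

/-! ### Two-dimensional data as three-dimensional data -/

/-- The jet of a function that does not depend on `z`. -/
def liftJet (v : ℕ → ℕ → ℝ) : ℕ → ℕ → ℕ → ℝ := fun m n o => if o = 0 then v m n else 0

/-- For `o ≠ 0` every summand contains a `z`-derivative, either of a coefficient or of the solution,
and vanishes by induction. This reduces the planar problem to the spatial one. -/
theorem pdeJet3_liftJet (a b d w f : ℕ → ℕ → ℝ) (m n o : ℕ) :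
    pdeJet3 (liftJet a) (liftJet b) 0 (liftJet d) (liftJet w) (liftJet f) m n o =
      liftJet (pdeJet2 a b d w f) m n o := by
  induction m using Nat.strong_induction_on generalizing n o with
  | _ m ih =>
    match m with
    | 0 | 1 => simp [pdeJet3, pdeJet2, liftJet]
    | m + 2 =>
      rw [pdeJet3, ih m (by omega), ih m (by omega)]
      have hs : ∀ (i : Fin (m + 1)) (j : Fin (n + 1)) (k : Fin (o + 1)),
          ((m.choose i : ℝ) * (n.choose j : ℝ) * (o.choose k : ℝ)) *
            (liftJet a (m - i) (n - j) (o - k) *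
                pdeJet3 (liftJet a) (liftJet b) 0 (liftJet d) (liftJet w) (liftJet f) (i + 1) j k
              + liftJet b (m - i) (n - j) (o - k) *
                pdeJet3 (liftJet a) (liftJet b) 0 (liftJet d) (liftJet w) (liftJet f) i (j + 1) k
              + (0 : ℕ → ℕ → ℕ → ℝ) (m - i) (n - j) (o - k) *
                pdeJet3 (liftJet a) (liftJet b) 0 (liftJet d) (liftJet w) (liftJet f) i j (k + 1)
              + liftJet d (m - i) (n - j) (o - k) *
                pdeJet3 (liftJet a) (liftJet b) 0 (liftJet d) (liftJet w) (liftJet f) i j k) =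
          if o = 0 then (m.choose i : ℝ) * (n.choose j : ℝ) *
            (a (m - i) (n - j) * pdeJet2 a b d w f (i + 1) j
              + b (m - i) (n - j) * pdeJet2 a b d w f i (j + 1)
              + d (m - i) (n - j) * pdeJet2 a b d w f i j) else 0 := by
        intro i j k
        rw [ih (i + 1) (by omega), ih i (by omega), ih i (by omega), ih i (by omega)]
        by_cases ho : o = 0
        · subst ho
          simp [liftJet]
        · by_cases hk : k = 0
          · simp [liftJet, ho, hk]
          · simp [liftJet, ho, hk]
      rw [Finset.sum_congr rfl fun i _ => Finset.sum_congr rfl fun j _ =>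
        Finset.sum_congr rfl fun k _ => hs i j k]
      by_cases ho : o = 0
      · subst ho
        simp only [liftJet, if_true]
        rw [pdeJet2]
        simp
      · simp [liftJet, ho]

theorem taylor3_liftJet (v : ℕ → ℕ → ℝ) (x y : ℝ) :
    taylor3 (liftJet v) x y 0 = taylor2 v x y := by
  simp only [taylor3, taylor2]
  refine Finset.sum_congr rfl fun m hm => Finset.sum_congr rfl fun n hn => ?_
  simp only [Finset.mem_range] at hm hn
  rw [Finset.sum_eq_single_of_mem 0 (by simp; omega)]
  · simp [liftJet]
  · intro o _ ho
    simp [liftJet, ho]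

theorem polyG2_eq (a b d : ℕ → ℕ → ℝ) (m n : ℕ) (x y : ℝ) :
    polyG2 a b d m n x y = polyG3 (liftJet a) (liftJet b) 0 (liftJet d) m n 0 x y 0 := by
  rw [polyG2, polyG3, ← taylor3_liftJet]
  congr 1
  funext i j k
  rw [← pdeJet3_liftJet]
  congr 1
  · funext i j k
    simp only [liftJet, delta2, delta3]
    split_ifs <;> simp_all
  · funext i j k; simp [liftJet]

theorem polyH2_eq (a b d : ℕ → ℕ → ℝ) (m n : ℕ) (x y : ℝ) :
    polyH2 a b d m n x y = polyH3 (liftJet a) (liftJet b) 0 (liftJet d) m n 0 x y 0 := by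
  rw [polyH2, polyH3, ← taylor3_liftJet]
  congr 1
  funext i j k
  rw [← pdeJet3_liftJet]
  congr 1
  · funext i j k; simp [liftJet]
  · funext i j k
    simp only [liftJet, delta2, delta3]
    split_ifs <;> simp_all

theorem liftJet_reaction2 (r : ℝ) (d₁ d₂ : ℕ → ℕ → ℝ) (h : ℝ) :
    liftJet (reaction2 r d₁ d₂ h) = reaction3 r (liftJet d₁) (liftJet d₂) h := by
  funext m n o
  simp only [liftJet, reaction2, reaction3]
  split_ifs <;> simp

end

noncomputable section

open Polynomial

/-! ### The lowest-order stencils -/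

theorem sum_signType {M : Type*} [AddCommMonoid M] (f : SignType → M) :
    ∑ k : SignType, f k = f .zero + f .neg + f .pos := by
  rw [SignType.univ_eq]
  simp [add_assoc]

theorem cast_sign_zero : ((SignType.zero : SignType) : ℝ) = 0 := rfl

theorem cast_sign_neg : ((SignType.neg : SignType) : ℝ) = -1 := rfl

theorem cast_sign_pos : ((SignType.pos : SignType) : ℝ) = 1 := rfl

/-- The nodes of the 9-point stencil. -/
def pos2 (k : SignType × SignType) : ℝ × ℝ × ℝ := (k.1, k.2, 0)

/-- The nodes of the 27-point stencil. -/
def pos3 (k : SignType × SignType × SignType) : ℝ × ℝ × ℝ := (k.1, k.2.1, k.2.2)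

/-- The 9-point Laplacian. -/
def lap2 : SignType × SignType → ℝ
  | (.zero, .zero) => -10 / 3
  | (.zero, _) => 2 / 3
  | (_, .zero) => 2 / 3
  | _ => 1 / 6

/-- The 19-point Laplacian. -/
def lap3 : SignType × SignType × SignType → ℝ
  | (.zero, .zero, .zero) => -4
  | (.zero, .zero, _) => 1 / 3
  | (.zero, _, .zero) => 1 / 3
  | (_, .zero, .zero) => 1 / 3
  | (.zero, _, _) => 1 / 6
  | (_, .zero, _) => 1 / 6
  | (_, _, .zero) => 1 / 6
  | _ => 0

namespace CoeffJets

theorem sum_smul_taylor {K M : Type*} [Fintype K] [AddCommGroup M] [Module ℝ M]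
    (g : K → ℝ) (pos : K → ℝ × ℝ × ℝ) (v : ℕ → ℕ → ℕ → M) :
    ∑ k, g k • taylor v (pos k).1 (pos k).2.1 (pos k).2.2 =
      ∑ m ∈ Finset.range 6, ∑ n ∈ Finset.range (6 - m), ∑ o ∈ Finset.range (6 - m - n),
        (∑ k, g k * mono (pos k).1 (pos k).2.1 (pos k).2.2 m n o) • v m n o := by
  simp only [taylor, Finset.smul_sum, Finset.sum_smul, smul_smul]
  rw [Finset.sum_comm]
  refine Finset.sum_congr rfl fun m _ => ?_
  rw [Finset.sum_comm]
  refine Finset.sum_congr rfl fun n _ => ?_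
  rw [Finset.sum_comm]

/-- The right-hand side is `Δ + Δ² / 12` in the plane: odd moments cancel by symmetry, and the
weights `2/3`, `1/6` make the fourth-order part a multiple of the bilaplacian. -/
theorem sum_lap2_smul_taylor {M : Type*} [AddCommGroup M] [Module ℝ M] (v : ℕ → ℕ → ℕ → M) :
    ∑ k, lap2 k • taylor v (pos2 k).1 (pos2 k).2.1 (pos2 k).2.2 =
      v 2 0 0 + v 0 2 0 + (1 / 12 : ℝ) • (v 4 0 0 + v 0 4 0) + (1 / 6 : ℝ) • v 2 2 0 := by
  rw [sum_smul_taylor]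
  simp only [Finset.sum_range_succ, Finset.sum_range_zero, Nat.reduceSub, Fintype.sum_prod_type,
    sum_signType, lap2, mono, pos2, cast_sign_zero, cast_sign_neg, cast_sign_pos, Nat.factorial]
  norm_num
  module

/-- Again `Δ + Δ² / 12`, now without the help of the eight corner nodes. -/
theorem sum_lap3_smul_taylor {M : Type*} [AddCommGroup M] [Module ℝ M] (v : ℕ → ℕ → ℕ → M) :
    ∑ k, lap3 k • taylor v (pos3 k).1 (pos3 k).2.1 (pos3 k).2.2 =
      v 2 0 0 + v 0 2 0 + v 0 0 2 + (1 / 12 : ℝ) • (v 4 0 0 + v 0 4 0 + v 0 0 4)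
        + (1 / 6 : ℝ) • (v 2 2 0 + v 2 0 2 + v 0 2 2) := by
  rw [sum_smul_taylor]
  simp only [Finset.sum_range_succ, Finset.sum_range_zero, Nat.reduceSub, Fintype.sum_prod_type,
    sum_signType, lap3, mono, pos3, cast_sign_zero, cast_sign_neg, cast_sign_pos, Nat.factorial]
  norm_num
  module

end CoeffJets

/-- A solution of `Δu = 0`, up to order five. -/
theorem taylor3_harmonic (w : ℕ → ℕ → ℕ → ℝ) (x y z : ℝ) :
    taylor3 (pdeJet3 0 0 0 0 w 0) x y z =
      (∑ n ∈ Finset.range 6, ∑ o ∈ Finset.range (6 - n), w 0 n o *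
        (y ^ n * z ^ o / ((n.factorial : ℝ) * (o.factorial : ℝ))))
      + x * (∑ n ∈ Finset.range 5, ∑ o ∈ Finset.range (5 - n), w 1 n o *
        (y ^ n * z ^ o / ((n.factorial : ℝ) * (o.factorial : ℝ))))
      - x ^ 2 / 2 * (∑ n ∈ Finset.range 4, ∑ o ∈ Finset.range (4 - n),
        (w 0 (n + 2) o + w 0 n (o + 2)) *
        (y ^ n * z ^ o / ((n.factorial : ℝ) * (o.factorial : ℝ))))
      - x ^ 3 / 6 * (∑ n ∈ Finset.range 3, ∑ o ∈ Finset.range (3 - n),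
        (w 1 (n + 2) o + w 1 n (o + 2)) *
        (y ^ n * z ^ o / ((n.factorial : ℝ) * (o.factorial : ℝ))))
      + x ^ 4 / 24 * (∑ n ∈ Finset.range 2, ∑ o ∈ Finset.range (2 - n),
        (w 0 (n + 4) o + 2 * w 0 (n + 2) (o + 2) + w 0 n (o + 4)) *
        (y ^ n * z ^ o / ((n.factorial : ℝ) * (o.factorial : ℝ))))
      + x ^ 5 / 120 * (w 1 4 0 + 2 * w 1 2 2 + w 1 0 4) := by
  have hr : ∀ m n o, pdeJet3 0 0 0 0 w 0 (m + 2) n o =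
      - pdeJet3 0 0 0 0 w 0 m (n + 2) o - pdeJet3 0 0 0 0 w 0 m n (o + 2) := by
    intro m n o; rw [pdeJet3]; simp
  generalize hv : pdeJet3 0 0 0 0 w 0 = v at hr
  have h0 : ∀ n o, v 0 n o = w 0 n o := by intro n o; rw [← hv, pdeJet3]
  have h1 : ∀ n o, v 1 n o = w 1 n o := by intro n o; rw [← hv, pdeJet3]
  have h2 : ∀ n o, v 2 n o = - w 0 (n + 2) o - w 0 n (o + 2) := by
    intro n o; rw [hr 0, h0, h0]
  have h3 : ∀ n o, v 3 n o = - w 1 (n + 2) o - w 1 n (o + 2) := by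
    intro n o; rw [hr 1, h1, h1]
  have h4 : ∀ n o, v 4 n o = w 0 (n + 4) o + 2 * w 0 (n + 2) (o + 2) + w 0 n (o + 4) := by
    intro n o; rw [hr 2, h2, h2]; ring
  have h5 : ∀ n o, v 5 n o = w 1 (n + 4) o + 2 * w 1 (n + 2) (o + 2) + w 1 n (o + 4) := by
    intro n o; rw [hr 3, h3, h3]; ring
  rw [taylor3]
  simp only [Finset.sum_range_succ, Finset.sum_range_zero, Nat.reduceSub, h0, h1, h2, h3, h4, h5,
    Nat.factorial]
  norm_num
  ring

end

/-! ### Harmonic polynomials and the real linear systems of each level. -/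

noncomputable section

open Polynomial

/-- The harmonic polynomial that belongs to the derivative `u^{(e)}`. -/
def harm (e : ℕ × ℕ × ℕ) (p : ℝ × ℝ × ℝ) : ℝ := polyG3 0 0 0 0 e.1 e.2.1 e.2.2 p.1 p.2.1 p.2.2

theorem harm_eq (e : ℕ × ℕ × ℕ) (p : ℝ × ℝ × ℝ) :
    harm e p = taylor3 (pdeJet3 0 0 0 0 (delta3 e.1 e.2.1 e.2.2) 0) p.1 p.2.1 p.2.2 := rfl

section table

variable (p : ℝ × ℝ × ℝ)

theorem harm_000 : harm (0, 0, 0) p = 1 := by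
  rw [harm_eq, taylor3_harmonic]; simp [Finset.sum_range_succ, delta3]

theorem harm_100 : harm (1, 0, 0) p = p.1 := by
  rw [harm_eq, taylor3_harmonic]; simp [Finset.sum_range_succ, delta3]

theorem harm_010 : harm (0, 1, 0) p = p.2.1 := by
  rw [harm_eq, taylor3_harmonic]; simp [Finset.sum_range_succ, delta3]

theorem harm_001 : harm (0, 0, 1) p = p.2.2 := by
  rw [harm_eq, taylor3_harmonic]; simp [Finset.sum_range_succ, delta3]

theorem harm_110 : harm (1, 1, 0) p = p.1 * p.2.1 := by
  rw [harm_eq, taylor3_harmonic]; simp [Finset.sum_range_succ, delta3]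

theorem harm_101 : harm (1, 0, 1) p = p.1 * p.2.2 := by
  rw [harm_eq, taylor3_harmonic]; simp [Finset.sum_range_succ, delta3]

theorem harm_011 : harm (0, 1, 1) p = p.2.1 * p.2.2 := by
  rw [harm_eq, taylor3_harmonic]; simp [Finset.sum_range_succ, delta3]

theorem harm_020 : harm (0, 2, 0) p = p.2.1 ^ 2 / 2 - p.1 ^ 2 / 2 := by
  rw [harm_eq, taylor3_harmonic]; simp [Finset.sum_range_succ, delta3]

theorem harm_002 : harm (0, 0, 2) p = p.2.2 ^ 2 / 2 - p.1 ^ 2 / 2 := by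
  rw [harm_eq, taylor3_harmonic]; simp [Finset.sum_range_succ, delta3]

theorem harm_111 : harm (1, 1, 1) p = p.1 * p.2.1 * p.2.2 := by
  rw [harm_eq, taylor3_harmonic]; simp [Finset.sum_range_succ, delta3]; ring

theorem harm_030 : harm (0, 3, 0) p = p.2.1 ^ 3 / 6 - p.1 ^ 2 / 2 * p.2.1 := by
  rw [harm_eq, taylor3_harmonic]; simp [Finset.sum_range_succ, delta3, Nat.factorial]

theorem harm_003 : harm (0, 0, 3) p = p.2.2 ^ 3 / 6 - p.1 ^ 2 / 2 * p.2.2 := by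
  rw [harm_eq, taylor3_harmonic]; simp [Finset.sum_range_succ, delta3, Nat.factorial]

theorem harm_021 : harm (0, 2, 1) p = p.2.1 ^ 2 * p.2.2 / 2 - p.1 ^ 2 / 2 * p.2.2 := by
  rw [harm_eq, taylor3_harmonic]; simp [Finset.sum_range_succ, delta3, Nat.factorial]
  try ring

theorem harm_012 : harm (0, 1, 2) p = p.2.1 * p.2.2 ^ 2 / 2 - p.1 ^ 2 / 2 * p.2.1 := by
  rw [harm_eq, taylor3_harmonic]; simp [Finset.sum_range_succ, delta3, Nat.factorial]
  try ring

theorem harm_120 : harm (1, 2, 0) p = p.1 * p.2.1 ^ 2 / 2 - p.1 ^ 3 / 6 := by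
  rw [harm_eq, taylor3_harmonic]; simp [Finset.sum_range_succ, delta3, Nat.factorial]
  try ring

theorem harm_102 : harm (1, 0, 2) p = p.1 * p.2.2 ^ 2 / 2 - p.1 ^ 3 / 6 := by
  rw [harm_eq, taylor3_harmonic]; simp [Finset.sum_range_succ, delta3, Nat.factorial]
  try ring

theorem harm_040 : harm (0, 4, 0) p = p.2.1 ^ 4 / 24 - p.1 ^ 2 * p.2.1 ^ 2 / 4 + p.1 ^ 4 / 24 := by
  rw [harm_eq, taylor3_harmonic]; simp [Finset.sum_range_succ, delta3, Nat.factorial]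
  try ring

theorem harm_004 : harm (0, 0, 4) p = p.2.2 ^ 4 / 24 - p.1 ^ 2 * p.2.2 ^ 2 / 4 + p.1 ^ 4 / 24 := by
  rw [harm_eq, taylor3_harmonic]; simp [Finset.sum_range_succ, delta3, Nat.factorial]
  try ring

theorem harm_022 : harm (0, 2, 2) p = p.2.1 ^ 2 * p.2.2 ^ 2 / 4 - p.1 ^ 2 * p.2.1 ^ 2 / 4 -
    p.1 ^ 2 * p.2.2 ^ 2 / 4 + p.1 ^ 4 / 12 := by
  rw [harm_eq, taylor3_harmonic]; simp [Finset.sum_range_succ, delta3, Nat.factorial]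
  try ring

theorem harm_031 : harm (0, 3, 1) p = p.2.1 ^ 3 * p.2.2 / 6 - p.1 ^ 2 * p.2.1 * p.2.2 / 2 := by
  rw [harm_eq, taylor3_harmonic]; simp [Finset.sum_range_succ, delta3, Nat.factorial]
  try ring

theorem harm_013 : harm (0, 1, 3) p = p.2.1 * p.2.2 ^ 3 / 6 - p.1 ^ 2 * p.2.1 * p.2.2 / 2 := by
  rw [harm_eq, taylor3_harmonic]; simp [Finset.sum_range_succ, delta3, Nat.factorial]
  try ring

theorem harm_130 : harm (1, 3, 0) p = p.1 * p.2.1 ^ 3 / 6 - p.1 ^ 3 * p.2.1 / 6 := by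
  rw [harm_eq, taylor3_harmonic]; simp [Finset.sum_range_succ, delta3, Nat.factorial]
  try ring

theorem harm_103 : harm (1, 0, 3) p = p.1 * p.2.2 ^ 3 / 6 - p.1 ^ 3 * p.2.2 / 6 := by
  rw [harm_eq, taylor3_harmonic]; simp [Finset.sum_range_succ, delta3, Nat.factorial]
  try ring

theorem harm_121 : harm (1, 2, 1) p = p.1 * p.2.1 ^ 2 * p.2.2 / 2 - p.1 ^ 3 * p.2.2 / 6 := by
  rw [harm_eq, taylor3_harmonic]; simp [Finset.sum_range_succ, delta3, Nat.factorial]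
  try ring

theorem harm_112 : harm (1, 1, 2) p = p.1 * p.2.1 * p.2.2 ^ 2 / 2 - p.1 ^ 3 * p.2.1 / 6 := by
  rw [harm_eq, taylor3_harmonic]; simp [Finset.sum_range_succ, delta3, Nat.factorial]
  try ring

end table

/-- From this power of `h` on the coefficients of the 19-point stencil are prescribed to vanish. -/
def lev3 : SignType × SignType × SignType → ℕ
  | (.neg, .neg, .zero) => 6
  | (.neg, .zero, .neg) => 5
  | (.neg, .zero, .zero) => 5
  | (.zero, .neg, .neg) => 5
  | (.neg, .zero, .pos) => 4
  | (.neg, .pos, .zero) => 4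
  | (.zero, .neg, .zero) => 4
  | (.zero, .zero, .neg) => 4
  | (.zero, .zero, .zero) => 4
  | (.zero, .neg, .pos) => 3
  | (.zero, .zero, .pos) => 3
  | (.zero, .pos, .neg) => 3
  | (.zero, .pos, .zero) => 3
  | (.pos, .neg, .zero) => 3
  | (.pos, .zero, .neg) => 3
  | (.zero, .pos, .pos) => 2
  | (.pos, .zero, .zero) => 2
  | (.pos, .zero, .pos) => 2
  | (.pos, .pos, .zero) => 1
  | _ => 0

/-- From this power of `h` on the coefficients of the 9-point stencil are prescribed to vanish. -/
def lev2 : SignType × SignType → ℕ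
  | (.neg, .neg) => 6
  | (.neg, .zero) => 5
  | (.zero, .neg) => 5
  | (.neg, .pos) => 4
  | (.zero, .zero) => 4
  | (.zero, .pos) => 3
  | (.pos, .neg) => 3
  | (.pos, .zero) => 2
  | (.pos, .pos) => 1

/-- The nodes whose `h^j` coefficient is unknown; the one of the centre is prescribed for
`j = 0`. -/
def free2 : ℕ → SignType × SignType → Bool
  | 0, (.zero, .zero) => false
  | 0, _ => true
  | j + 1, k => j + 1 < lev2 k

/-- The nodes whose `h^j` coefficient is unknown; the one of the centre is prescribed for
`j = 0`. -/
def free3 : ℕ → SignType × SignType × SignType → Bool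
  | 0, (.zero, .zero, .zero) => false
  | 0, k => 0 < lev3 k
  | j + 1, k => j + 1 < lev3 k

/-- Independent equations for the coefficients of `h^j`. -/
def basis2 : ℕ → Finset (ℕ × ℕ × ℕ)
  | 0 | 1 => {(0, 0, 0), (1, 0, 0), (0, 1, 0), (1, 1, 0), (0, 2, 0), (1, 2, 0), (0, 3, 0),
      (0, 4, 0)}
  | 2 => {(0, 0, 0), (1, 0, 0), (0, 1, 0), (1, 1, 0), (0, 2, 0), (1, 2, 0), (0, 3, 0)}
  | 3 => {(0, 0, 0), (1, 0, 0), (0, 1, 0), (1, 1, 0), (0, 2, 0)}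
  | 4 => {(0, 0, 0), (1, 0, 0), (0, 1, 0)}
  | _ => {(0, 0, 0)}

/-- Independent equations for the coefficients of `h^j`. -/
def basis3 : ℕ → Finset (ℕ × ℕ × ℕ)
  | 0 | 1 => {(0, 0, 0), (1, 0, 0), (0, 1, 0), (0, 0, 1), (1, 1, 0), (1, 0, 1), (0, 1, 1),
      (0, 2, 0), (0, 0, 2), (0, 3, 0), (0, 2, 1), (0, 1, 2), (0, 0, 3), (1, 2, 0), (1, 0, 2),
      (0, 4, 0), (0, 2, 2), (0, 0, 4)}
  | 2 => {(0, 0, 0), (1, 0, 0), (0, 1, 0), (0, 0, 1), (1, 1, 0), (1, 0, 1), (0, 1, 1),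
      (0, 2, 0), (0, 0, 2), (0, 3, 0), (0, 2, 1), (0, 1, 2), (0, 0, 3), (1, 2, 0), (1, 0, 2)}
  | 3 => {(0, 0, 0), (1, 0, 0), (0, 1, 0), (0, 0, 1), (1, 1, 0), (1, 0, 1), (0, 1, 1),
      (0, 2, 0), (0, 0, 2)}
  | 4 => {(0, 0, 0), (1, 0, 0), (0, 1, 0), (0, 0, 1)}
  | _ => {(0, 0, 0)}

set_option linter.unusedSimpArgs false in
-- A finite check, one real square system per level. At level 0 the Laplacian weights solve the same
-- homogeneous equations; they are excluded because the value at the centre is set to zero.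
theorem eq_zero_of_harm2 (j : ℕ) (hj : j ≤ 5) (v : SignType × SignType → ℝ)
    (hv : ∀ k, free2 j k = false → v k = 0)
    (he : ∀ e ∈ basis2 j, ∑ k, harm e (pos2 k) * v k = 0) (k : SignType × SignType) :
    v k = 0 := by
  -- With `v` written as a masked `u`, the prescribed zeros disappear from the equations.
  obtain ⟨u, rfl⟩ : ∃ u : SignType × SignType → ℝ,
      v = fun k => if free2 j k = true then u k else 0 := ⟨v, by
    funext k
    split_ifs with h
    · rfl
    · exact hv k (by simpa using h)⟩
  clear hv
  interval_cases j <;>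
  · simp only [basis2, Finset.forall_mem_insert, Finset.mem_singleton, forall_eq, harm_000,
      harm_100, harm_010, harm_110, harm_020, harm_120, harm_030, harm_040,
      Fintype.sum_prod_type, sum_signType, pos2, cast_sign_zero, cast_sign_neg, cast_sign_pos] at he
    norm_num [free2, lev2, -SignType.zero_eq_zero, -SignType.neg_eq_neg_one,
      -SignType.pos_eq_one] at he ⊢
    obtain ⟨k1, k2⟩ := k
    cases k1 <;> cases k2 <;>
    simp only [free2, lev2, Nat.reduceLT, Nat.reduceAdd,
      decide_true, decide_false, if_true, if_false, Bool.false_eq_true] <;> grind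

set_option linter.unusedSimpArgs false in
set_option maxHeartbeats 4000000 in
-- There are `(6 - j)²` harmonic polynomials of degree at most `5 - j`. For `j = 1, …, 5`, `basis3
-- j` keeps 18, 15, 9, 4, 1 of them, so above level 0 something is left out only at level 1 (seven
-- equations) and at level 2 (one).
theorem eq_zero_of_harm3 (j : ℕ) (hj : j ≤ 5) (v : SignType × SignType × SignType → ℝ)
    (hv : ∀ k, free3 j k = false → v k = 0)
    (he : ∀ e ∈ basis3 j, ∑ k, harm e (pos3 k) * v k = 0) (k : SignType × SignType × SignType) :
    v k = 0 := by
  obtain ⟨u, rfl⟩ : ∃ u : SignType × SignType × SignType → ℝ,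
      v = fun k => if free3 j k = true then u k else 0 := ⟨v, by
    funext k
    split_ifs with h
    · rfl
    · exact hv k (by simpa using h)⟩
  clear hv
  interval_cases j <;>
  · simp only [basis3, Finset.forall_mem_insert, Finset.mem_singleton, forall_eq, harm_000,
      harm_100, harm_010, harm_001, harm_110, harm_101, harm_011, harm_020, harm_002, harm_030,
      harm_021, harm_012, harm_003, harm_120, harm_102, harm_040, harm_022, harm_004,
      Fintype.sum_prod_type, sum_signType, pos3, cast_sign_zero, cast_sign_neg, cast_sign_pos] at he
    norm_num [free3, lev3, -SignType.zero_eq_zero, -SignType.neg_eq_neg_one,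
      -SignType.pos_eq_one] at he ⊢
    obtain ⟨k1, k2, k3⟩ := k
    cases k1 <;> cases k2 <;> cases k3 <;>
    simp only [free3, lev3, Nat.reduceLT, Nat.reduceAdd,
      Nat.not_lt_zero, decide_true, decide_false, if_true, if_false, Bool.false_eq_true] <;> grind

end

noncomputable section

open Polynomial

/-! ### Solving the consistency equations level by level -/

section linear

variable {A K ε : Type*} [CommRing A] [Algebra ℝ A] [Fintype K]

/-- A square homogeneous real system without nontrivial solutions is solvable over every algebra. -/
theorem exists_solution [DecidableEq ε] (U : K → Bool) (E : Finset ε) (g : ε → K → ℝ)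
    (hcard : Fintype.card {k // U k = true} = E.card)
    (inj : ∀ v : K → ℝ, (∀ k, U k = false → v k = 0) → (∀ e ∈ E, ∑ k, g e k * v k = 0) →
      ∀ k, v k = 0) (ρ : ε → A) :
    ∃ v : K → A, (∀ k, U k = false → v k = 0) ∧ ∀ e ∈ E, ∑ k, g e k • v k = ρ e := by
  set ext : ({k // U k = true} → ℝ) →ₗ[ℝ] (K → ℝ) :=
    Function.ExtendByZero.linearMap ℝ Subtype.val with hext
  have hext0 : ∀ w k, U k = false → ext w k = 0 := by
    intro w k hk
    rw [hext, Function.ExtendByZero.linearMap_apply, Function.extend_apply']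
    · rfl
    · rintro ⟨a, rfl⟩
      have := a.2
      simp_all
  have hext1 : ∀ w (k : {k // U k = true}), ext w k = w k := by
    intro w k
    rw [hext, Function.ExtendByZero.linearMap_apply,
      Function.Injective.extend_apply Subtype.val_injective]
  let L : ({k // U k = true} → ℝ) →ₗ[ℝ] (E → ℝ) :=
    (LinearMap.pi fun e : E => ∑ k, g e k • LinearMap.proj k) ∘ₗ ext
  have hL : ∀ w (e : E), L w e = ∑ k, g e k * ext w k := by
    intro w e; simp [L, LinearMap.sum_apply]
  have hLinj : Function.Injective L := by
    rw [← LinearMap.ker_eq_bot, LinearMap.ker_eq_bot']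
    intro w hw
    have h0 := inj (ext w) (hext0 w) fun e he => by
      rw [← hL w ⟨e, he⟩, hw]; rfl
    funext k
    rw [← hext1 w k, h0]; rfl
  have hLsurj : Function.Surjective L := by
    refine (LinearMap.injective_iff_surjective_of_finrank_eq_finrank ?_).mp hLinj
    simp [hcard]
  -- `w e` solves the real system with unit datum at `e`. Superposing these with the scalars `ρ e`
  -- solves it for data in `A`, so no linear algebra over `A` is needed.
  choose w hw using fun e : E => hLsurj (Pi.single e 1)
  refine ⟨fun k => ∑ e : E, ext (w e) k • ρ e, fun k hk => ?_, fun e he => ?_⟩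
  · exact Finset.sum_eq_zero fun e _ => by rw [hext0 _ _ hk, zero_smul]
  · simp only [Finset.smul_sum, smul_smul]
    rw [Finset.sum_comm]
    simp only [← Finset.sum_smul]
    rw [Finset.sum_eq_single_of_mem (⟨e, he⟩ : E) (Finset.mem_univ _)]
    · rw [← hL (w ⟨e, he⟩) ⟨e, he⟩, hw]; simp
    · intro e' _ hne
      rw [← hL (w e') ⟨e, he⟩, hw, Pi.single_eq_of_ne (Ne.symm hne), zero_smul]

end linear

namespace CoeffJets

variable {A K : Type*} [CommRing A]

theorem coeff_jet_zero (J : CoeffJets A) (w f : ℕ → ℕ → ℕ → A) (n o j : ℕ) :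
    (J.jet w f 0 n o).coeff j = if j = 0 then w 0 n o else 0 := by
  rw [jet, coeff_C]

theorem coeff_jet_one (J : CoeffJets A) (w f : ℕ → ℕ → ℕ → A) (n o j : ℕ) :
    (J.jet w f 1 n o).coeff j = if j = 0 then w 1 n o else 0 := by
  rw [jet, coeff_C]

variable [Algebra ℝ A] [Fintype K]

/-- The contribution of the coefficients of `h^p`, `p < j`, to `residual`. -/
def lower (J : CoeffJets A) (pos : K → ℝ × ℝ × ℝ) (c : K → Fin 6 → A) (e : ℕ × ℕ × ℕ)
    (j : ℕ) : A :=
  ∑ p : Fin 6, ∑ k, if (p : ℕ) < j then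
    c k p * (J.gPoly e (pos k).1 (pos k).2.1 (pos k).2.2).coeff (j - p) else 0

/-- The unknowns of level `j` are multiplied by the constant coefficient of `gPoly`, which is the
value of a harmonic polynomial. This triangular form serves both existence and uniqueness. -/
theorem residual_eq_add (J : CoeffJets A) (pos : K → ℝ × ℝ × ℝ) (c : K → Fin 6 → A)
    (e : ℕ × ℕ × ℕ) (j : Fin 6) :
    J.residual pos c e j = J.lower pos c e j + ∑ k, harm e (pos k) • c k j := by
  have h1 : ∑ k, harm e (pos k) • c k j = ∑ p : Fin 6, ∑ k, if p = j then
      c k p * (J.gPoly e (pos k).1 (pos k).2.1 (pos k).2.2).coeff (j - p) else 0 := by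
    rw [Finset.sum_eq_single_of_mem j (Finset.mem_univ _)]
    · refine Finset.sum_congr rfl fun k _ => ?_
      rw [if_pos rfl, Nat.sub_self, coeff_zero_gPoly, Algebra.smul_def, mul_comm]
      rfl
    · intro p _ hp
      simp [hp]
  rw [h1, residual, lower, ← Finset.sum_add_distrib]
  refine Finset.sum_congr rfl fun p _ => ?_
  rw [← Finset.sum_add_distrib]
  refine Finset.sum_congr rfl fun k _ => ?_
  rcases lt_trichotomy p j with h | h | h
  · have h' : (p : ℕ) < j := h
    simp [h', h'.le, h.ne]
  · simp [h]
  · have h' : ¬ (p : ℕ) < j := not_lt.mpr h.le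
    have h'' : ¬ (p : ℕ) ≤ j := not_le.mpr h
    simp [h', h'', h.ne']

theorem lower_congr (J : CoeffJets A) (pos : K → ℝ × ℝ × ℝ) (c c' : K → Fin 6 → A)
    (e : ℕ × ℕ × ℕ) (j : ℕ) (h : ∀ k (p : Fin 6), (p : ℕ) < j → c k p = c' k p) :
    J.lower pos c e j = J.lower pos c' e j := by
  refine Finset.sum_congr rfl fun p _ => Finset.sum_congr rfl fun k _ => ?_
  split_ifs with hp
  · rw [h k p hp]
  · rfl

theorem lower_one (J : CoeffJets A) (pos : K → ℝ × ℝ × ℝ) (c : K → Fin 6 → A)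
    (e : ℕ × ℕ × ℕ) : J.lower pos c e 1 =
      ∑ k, c k 0 * (J.gPoly e (pos k).1 (pos k).2.1 (pos k).2.2).coeff 1 := by
  simp [lower]

theorem lower_two (J : CoeffJets A) (pos : K → ℝ × ℝ × ℝ) (c : K → Fin 6 → A)
    (e : ℕ × ℕ × ℕ) : J.lower pos c e 2 =
      ∑ k, c k 0 * (J.gPoly e (pos k).1 (pos k).2.1 (pos k).2.2).coeff 2 +
      ∑ k, c k 1 * (J.gPoly e (pos k).1 (pos k).2.1 (pos k).2.2).coeff 1 := by
  simp [lower, Fin.sum_univ_succ]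

/-- The coefficients of `h^p`, `p < j`, of a stencil have been found. -/
structure IsPartial (J : CoeffJets A) (pos : K → ℝ × ℝ × ℝ) (lap : K → ℝ) (lev : K → ℕ)
    (E : ℕ × ℕ × ℕ → Prop) (j : ℕ) (c : K → Fin 6 → A) : Prop where
  lap_eq : ∀ k, c k 0 = algebraMap ℝ A (lap k)
  vanish : ∀ k (p : Fin 6), lev k ≤ p → c k p = 0
  residual_eq : ∀ e, E e → ∀ i < j, order e + i ≤ 5 → J.residual pos c e i = 0

/-- The residual at level `i` reads only the coefficients of `h^p` with `p ≤ i`, so choosing those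
of `h^j` does not disturb the earlier equations; `1 ≤ j` protects the level-0 values. -/
theorem IsPartial.step {J : CoeffJets A} {pos : K → ℝ × ℝ × ℝ} {lap : K → ℝ} {lev : K → ℕ}
    {E : ℕ × ℕ × ℕ → Prop} {j : ℕ} {c : K → Fin 6 → A} (hc : J.IsPartial pos lap lev E j c)
    (hj : 1 ≤ j) (hj5 : j < 6) (v : K → A) (hv : ∀ k, lev k ≤ j → v k = 0)
    (he : ∀ e, E e → order e + j ≤ 5 → ∑ k, harm e (pos k) • v k = - J.lower pos c e j) :
    ∃ c', J.IsPartial pos lap lev E (j + 1) c' := by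
  have hlt : ∀ k (p : Fin 6), (p : ℕ) < j →
      Function.update (c k) ⟨j, hj5⟩ (v k) p = c k p := by
    intro k p hp
    rw [Function.update_of_ne]
    rintro rfl
    exact lt_irrefl _ hp
  refine ⟨fun k => Function.update (c k) ⟨j, hj5⟩ (v k), fun k => ?_, fun k p hp => ?_,
    fun e hE i hi ho => ?_⟩
  · rw [hlt k 0 hj, hc.lap_eq]
  · by_cases h : p = ⟨j, hj5⟩
    · subst h
      rw [Function.update_self]
      exact hv k hp
    · rw [Function.update_of_ne h]
      exact hc.vanish k p hp
  · have hr := residual_eq_add J pos (fun k => Function.update (c k) ⟨j, hj5⟩ (v k)) e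
      ⟨i, by omega⟩
    have hl := lower_congr J pos (fun k => Function.update (c k) ⟨j, hj5⟩ (v k)) c e i
      (fun k p hp => hlt k p (by omega))
    rw [hr, hl]
    rcases Nat.lt_succ_iff_lt_or_eq.mp hi with h | rfl
    · rw [← hc.residual_eq e hE i h ho]
      have hr' := residual_eq_add J pos c e ⟨i, by omega⟩
      rw [hr']
      congr 1
      exact Finset.sum_congr rfl fun k _ => by rw [hlt k _ h]
    · simp only [Function.update_self]
      rw [he e hE ho, add_neg_cancel]

/-- Level 0 is written down rather than solved: its equations say that the weights annihilate
harmonic polynomials. `hlev` concerns nodes where even the `h⁰` coefficient is prescribed to be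
zero. -/
theorem isPartial_one (J : CoeffJets A) (pos : K → ℝ × ℝ × ℝ) (lap : K → ℝ) (lev : K → ℕ)
    (E : ℕ × ℕ × ℕ → Prop) (hlev : ∀ k, lev k = 0 → lap k = 0)
    (hlap : ∀ e, E e → ∑ k, lap k * harm e (pos k) = 0) :
    J.IsPartial pos lap lev E 1 (fun k p => if p = 0 then algebraMap ℝ A (lap k) else 0) := by
  refine ⟨fun k => by simp, fun k p hp => ?_, fun e hE i hi _ => ?_⟩
  · split_ifs with h
    · subst h
      rw [hlev k (by simpa using hp), map_zero]
    · rfl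
  · have hi0 : i = 0 := by omega
    subst hi0
    have h := residual_eq_add J pos (fun k p => if p = 0 then algebraMap ℝ A (lap k) else 0) e 0
    rw [Fin.val_zero] at h
    rw [h]
    have h1 : ∑ k, harm e (pos k) • (if (0 : Fin 6) = 0 then algebraMap ℝ A (lap k) else 0) =
        algebraMap ℝ A (∑ k, lap k * harm e (pos k)) := by
      rw [map_sum]
      refine Finset.sum_congr rfl fun k _ => ?_
      rw [if_pos rfl, Algebra.smul_def, map_mul, mul_comm]
    rw [h1, hlap e hE, map_zero, lower]
    simp

/-- A stencil is determined level by level. -/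
theorem eq_of_residual_eq {J : CoeffJets ℝ} {pos : K → ℝ × ℝ × ℝ} {E : ℕ × ℕ × ℕ → Prop}
    (free : ℕ → K → Bool) (basis : ℕ → Finset (ℕ × ℕ × ℕ))
    (hbasis : ∀ j ≤ 5, ∀ e ∈ basis j, E e ∧ order e + j ≤ 5)
    (inj : ∀ j ≤ 5, ∀ v : K → ℝ, (∀ k, free j k = false → v k = 0) →
      (∀ e ∈ basis j, ∑ k, harm e (pos k) * v k = 0) → ∀ k, v k = 0)
    {c c' : K → Fin 6 → ℝ} (hfree : ∀ (j : Fin 6) k, free j k = false → c k j = c' k j)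
    (h : ∀ e, E e → ∀ i, order e + i ≤ 5 → J.residual pos c e i = 0)
    (h' : ∀ e, E e → ∀ i, order e + i ≤ 5 → J.residual pos c' e i = 0) : c = c' := by
  have key : ∀ j : ℕ, ∀ hj : j < 6, ∀ k, c k ⟨j, hj⟩ = c' k ⟨j, hj⟩ := by
    intro j
    induction j using Nat.strong_induction_on with
    | _ j ih =>
      intro hj k
      rw [← sub_eq_zero]
      -- The lower levels agree, so the `lower` terms cancel and the difference solves the
      -- homogeneous system.
      refine inj j (by omega) (fun k => c k ⟨j, hj⟩ - c' k ⟨j, hj⟩) (fun k hk => ?_)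
        (fun e he => ?_) k
      · rw [sub_eq_zero]; exact hfree ⟨j, hj⟩ k hk
      · obtain ⟨hE, ho⟩ := hbasis j (by omega) e he
        have h1 := h e hE j ho
        have h2 := h' e hE j ho
        have e1 := residual_eq_add J pos c e ⟨j, hj⟩
        have e2 := residual_eq_add J pos c' e ⟨j, hj⟩
        have e3 := lower_congr J pos c c' e j (fun k p hp => ih p hp p.2 k)
        simp only [smul_eq_mul] at e1 e2
        simp only [mul_sub, Finset.sum_sub_distrib]
        linarith
  funext k p
  exact key p p.2 k

/-! ### Moments of the lowest-order stencils -/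

theorem harm_eq_taylor (e : ℕ × ℕ × ℕ) (p : ℝ × ℝ × ℝ) : harm e p =
    taylor (pdeJet3 0 0 0 0 (delta3 e.1 e.2.1 e.2.2) 0) p.1 p.2.1 p.2.2 := by
  rw [harm_eq, taylor3_eq]

/-- `Δ + Δ² / 12` annihilates harmonic jets. Since `e.2.2 = 0`, the `z`-derivatives drop out and the
planar Laplacian is the full one. -/
theorem sum_lap2_mul_harm (e : ℕ × ℕ × ℕ) (he : e.2.2 = 0) :
    ∑ k, lap2 k * harm e (pos2 k) = 0 := by
  have hr : ∀ m n o, pdeJet3 0 0 0 0 (delta3 e.1 e.2.1 e.2.2) 0 (m + 2) n o =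
      - pdeJet3 0 0 0 0 (delta3 e.1 e.2.1 e.2.2) 0 m (n + 2) o
      - pdeJet3 0 0 0 0 (delta3 e.1 e.2.1 e.2.2) 0 m n (o + 2) := by
    intro m n o; rw [pdeJet3]; simp
  have h0 : ∀ n o, 0 < o → pdeJet3 0 0 0 0 (delta3 e.1 e.2.1 e.2.2) 0 0 n o = 0 := by
    intro n o ho; rw [pdeJet3]; simp [delta3, he, ho.ne']
  simp only [harm_eq_taylor, ← smul_eq_mul (α := ℝ)]
  rw [sum_lap2_smul_taylor, hr 2, hr 0, hr 0, hr 0]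
  simp only [Nat.reduceAdd, zero_add, smul_eq_mul, h0 _ 2 (by norm_num), h0 _ 4 (by norm_num)]
  ring

theorem sum_lap3_mul_harm (e : ℕ × ℕ × ℕ) : ∑ k, lap3 k * harm e (pos3 k) = 0 := by
  have hr : ∀ m n o, pdeJet3 0 0 0 0 (delta3 e.1 e.2.1 e.2.2) 0 (m + 2) n o =
      - pdeJet3 0 0 0 0 (delta3 e.1 e.2.1 e.2.2) 0 m (n + 2) o
      - pdeJet3 0 0 0 0 (delta3 e.1 e.2.1 e.2.2) 0 m n (o + 2) := by
    intro m n o; rw [pdeJet3]; simp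
  simp only [harm_eq_taylor, ← smul_eq_mul (α := ℝ)]
  rw [sum_lap3_smul_taylor, hr 2, hr 0, hr 0, hr 0]
  simp only [smul_eq_mul]
  ring

/-- Write the jet as `v₀ + h v₁ + …` with `Δv₀ = 0` and `Δv₁ = -(a ∂x + b ∂y + c ∂z + d₁) v₀`, the
coefficients being frozen. They commute with `Δ`, so `Δ²v₁ = 0`, and `Δ + Δ² / 12` leaves only `Δv₁`
at the point, which involves data of order at most one. -/
theorem sum_lap3_mul_coeff_one (J : CoeffJets A) (e : ℕ × ℕ × ℕ) :
    ∑ k, algebraMap ℝ A (lap3 k) *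
        (J.gPoly e (pos3 k).1 (pos3 k).2.1 (pos3 k).2.2).coeff 1 =
      - (J.a 0 0 0 * kron A e 1 0 0 + J.b 0 0 0 * kron A e 0 1 0 + J.c 0 0 0 * kron A e 0 0 1
        + J.d₁ 0 0 0 * kron A e 0 0 0) := by
  simp only [gPoly, coeff_taylor, ← Algebra.smul_def]
  rw [sum_lap3_smul_taylor]
  have h1 := J.coeff_one_jet_add_two (kron A e) 0
  have h0 := J.coeff_zero_jet_add_two (kron A e) 0
  rw [h1 2, h1 0, h1 0, h1 0, h0 1, h0 0, h0 0, h0 0]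
  simp only [coeff_jet_zero, coeff_jet_one, Nat.reduceAdd, zero_add, one_ne_zero, if_true,
    if_false, Pi.zero_apply]
  -- Leaves the image of `1/12` as the only constant, so that the parts of `Δ² / 12` cancel.
  rw [show (1 / 6 : ℝ) = 2 * (1 / 12) by norm_num]
  simp only [Algebra.smul_def, map_mul, map_ofNat]
  ring

theorem sum_lap2_mul_coeff_one (J : CoeffJets A) (hJ : J.c 0 0 0 = 0) (e : ℕ × ℕ × ℕ)
    (he : e.2.2 = 0) :
    ∑ k, algebraMap ℝ A (lap2 k) *
        (J.gPoly e (pos2 k).1 (pos2 k).2.1 (pos2 k).2.2).coeff 1 =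
      - (J.a 0 0 0 * kron A e 1 0 0 + J.b 0 0 0 * kron A e 0 1 0
        + J.d₁ 0 0 0 * kron A e 0 0 0) := by
  simp only [gPoly, coeff_taylor, ← Algebra.smul_def]
  rw [sum_lap2_smul_taylor]
  have h1 := J.coeff_one_jet_add_two (kron A e) 0
  have h0 := J.coeff_zero_jet_add_two (kron A e) 0
  have hk : ∀ m n o, 0 < o → kron A e m n o = 0 := by
    intro m n o ho; simp [kron, he, ho.ne']
  rw [h1 2, h1 0, h1 0, h1 0, h0 1, h0 0, h0 0, h0 0]
  simp only [coeff_jet_zero, coeff_jet_one, Nat.reduceAdd, zero_add, one_ne_zero, if_true,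
    if_false, Pi.zero_apply, hJ, hk _ _ 2 (by norm_num)]
  rw [show (1 / 6 : ℝ) = 2 * (1 / 12) by norm_num]
  simp only [Algebra.smul_def, map_mul, map_ofNat]
  ring

/-- Only derivatives of order at most four occur, and their degree in `h` is at most `4 - |e| ≤ 1`.
-/
theorem sum_lap3_mul_coeff_two (J : CoeffJets A) (e : ℕ × ℕ × ℕ) (he : 3 ≤ order e) :
    ∑ k, algebraMap ℝ A (lap3 k) *
        (J.gPoly e (pos3 k).1 (pos3 k).2.1 (pos3 k).2.2).coeff 2 = 0 := by
  simp only [gPoly, coeff_taylor, ← Algebra.smul_def]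
  have h := J.coeff_jet_eq_zero e
  rw [sum_lap3_smul_taylor, h _ _ _ _ (by omega), h _ _ _ _ (by omega), h _ _ _ _ (by omega),
    h _ _ _ _ (by omega), h _ _ _ _ (by omega), h _ _ _ _ (by omega), h _ _ _ _ (by omega),
    h _ _ _ _ (by omega), h _ _ _ _ (by omega)]
  simp

end CoeffJets

end

/-! ### Compatibility of the redundant equations, and existence of stencils over any algebra. -/

noncomputable section

open Polynomial

theorem free2_eq_false_iff (j : ℕ) (hj : 1 ≤ j) (k : SignType × SignType) :
    free2 j k = false ↔ lev2 k ≤ j := by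
  obtain ⟨i, rfl⟩ := Nat.exists_eq_add_of_le' hj
  simp [free2]

theorem free3_eq_false_iff (j : ℕ) (hj : 1 ≤ j) (k : SignType × SignType × SignType) :
    free3 j k = false ↔ lev3 k ≤ j := by
  obtain ⟨i, rfl⟩ := Nat.exists_eq_add_of_le' hj
  simp [free3]

theorem card_free2 (j : ℕ) (hj : j ≤ 5) :
    Fintype.card {k // free2 j k = true} = (basis2 j).card := by
  interval_cases j <;> decide

theorem card_free3 (j : ℕ) (hj : j ≤ 5) :
    Fintype.card {k // free3 j k = true} = (basis3 j).card := by
  interval_cases j <;> decide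

theorem mem_basis2 (j : ℕ) (hj : 1 ≤ j) (e : ℕ × ℕ × ℕ) (he : e.1 ≤ 1 ∧ e.2.2 = 0)
    (ho : CoeffJets.order e + j ≤ 5) : e ∈ basis2 j ∨ j = 1 ∧ e = (1, 3, 0) := by
  obtain ⟨m, n, o⟩ := e
  obtain ⟨hm, rfl : o = 0⟩ := he
  simp only [CoeffJets.order] at hm ho
  have hn : n ≤ 4 := by omega
  have hj' : j ≤ 5 := by omega
  interval_cases j <;> interval_cases m <;> interval_cases n <;> first | omega | simp [basis2]

/-- The exceptions are the equations that are redundant on the nodes; each has to be proved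
compatible with the basis equations. -/
theorem mem_basis3 (j : ℕ) (hj : 1 ≤ j) (e : ℕ × ℕ × ℕ) (he : e.1 ≤ 1)
    (ho : CoeffJets.order e + j ≤ 5) : e ∈ basis3 j ∨ j = 2 ∧ e = (1, 1, 1) ∨
      j = 1 ∧ (e = (1, 1, 1) ∨ e = (0, 3, 1) ∨ e = (0, 1, 3) ∨ e = (1, 3, 0) ∨ e = (1, 0, 3) ∨
        e = (1, 2, 1) ∨ e = (1, 1, 2)) := by
  obtain ⟨m, n, o⟩ := e
  simp only [CoeffJets.order] at he ho
  have hn : n ≤ 4 := by omega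
  have ho' : o ≤ 4 := by omega
  have hj' : j ≤ 5 := by omega
  interval_cases j <;> interval_cases m <;> interval_cases n <;> interval_cases o <;>
    first | omega | simp [basis3]

theorem basis2_spec : ∀ j ≤ 5, ∀ e ∈ basis2 j,
    (e.1 ≤ 1 ∧ e.2.2 = 0) ∧ CoeffJets.order e + j ≤ 5 := by
  intro j hj
  interval_cases j <;> simp [basis2, CoeffJets.order]

theorem basis3_spec : ∀ j ≤ 5, ∀ e ∈ basis3 j, e.1 ≤ 1 ∧ CoeffJets.order e + j ≤ 5 := by
  intro j hj
  interval_cases j <;> simp [basis3, CoeffJets.order]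

/-- On the nodes of the 19-point stencil the remaining harmonic polynomials are redundant. -/
theorem harm3_redundant (e : ℕ × ℕ × ℕ)
    (he : e = (1, 1, 1) ∨ e = (0, 3, 1) ∨ e = (0, 1, 3) ∨ e = (1, 3, 0) ∨ e = (1, 0, 3) ∨
        e = (1, 2, 1) ∨ e = (1, 1, 2)) :
    ∃ (e' : ℕ × ℕ × ℕ) (t : ℝ), e' ∈ basis3 1 ∧ 2 ≤ CoeffJets.order e' ∧
      ∀ k, 1 < lev3 k → harm e (pos3 k) = t * harm e' (pos3 k) := by
  -- On the 19 nodes each coordinate equals its cube and the product of the three coordinates is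
  -- zero, so each polynomial collapses to a multiple of a quadratic one. Where it vanishes, `t = 0`
  -- and `e'` is an arbitrary index of order two.
  rcases he with rfl | rfl | rfl | rfl | rfl | rfl | rfl
  · refine ⟨(0, 1, 1), 0, by simp [basis3], by simp [CoeffJets.order], ?_⟩
    rintro ⟨k1, k2, k3⟩ hk
    cases k1 <;> cases k2 <;> cases k3 <;> first
    | exact absurd hk (by decide)
    | norm_num [harm_111, harm_011, pos3]
  · refine ⟨(0, 1, 1), 1 / 6, by simp [basis3], by simp [CoeffJets.order], ?_⟩
    rintro ⟨k1, k2, k3⟩ hk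
    cases k1 <;> cases k2 <;> cases k3 <;> first
    | exact absurd hk (by decide)
    | norm_num [harm_031, harm_011, pos3]
  · refine ⟨(0, 1, 1), 1 / 6, by simp [basis3], by simp [CoeffJets.order], ?_⟩
    rintro ⟨k1, k2, k3⟩ hk
    cases k1 <;> cases k2 <;> cases k3 <;> first
    | exact absurd hk (by decide)
    | norm_num [harm_013, harm_011, pos3]
  · refine ⟨(0, 1, 1), 0, by simp [basis3], by simp [CoeffJets.order], ?_⟩
    rintro ⟨k1, k2, k3⟩ hk
    cases k1 <;> cases k2 <;> cases k3 <;> first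
    | exact absurd hk (by decide)
    | norm_num [harm_130, harm_011, pos3]
  · refine ⟨(0, 1, 1), 0, by simp [basis3], by simp [CoeffJets.order], ?_⟩
    rintro ⟨k1, k2, k3⟩ hk
    cases k1 <;> cases k2 <;> cases k3 <;> first
    | exact absurd hk (by decide)
    | norm_num [harm_103, harm_011, pos3]
  · refine ⟨(1, 0, 1), -1 / 6, by simp [basis3], by simp [CoeffJets.order], ?_⟩
    rintro ⟨k1, k2, k3⟩ hk
    cases k1 <;> cases k2 <;> cases k3 <;> first
    | exact absurd hk (by decide)
    | norm_num [harm_121, harm_101, pos3]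
  · refine ⟨(1, 1, 0), -1 / 6, by simp [basis3], by simp [CoeffJets.order], ?_⟩
    rintro ⟨k1, k2, k3⟩ hk
    cases k1 <;> cases k2 <;> cases k3 <;> first
    | exact absurd hk (by decide)
    | norm_num [harm_112, harm_110, pos3]

/-- The polynomial is `x y (y² - x²) / 6`, and nodes with `x y ≠ 0` have `x² = y² = 1`. -/
theorem harm2_redundant (k : SignType × SignType) : harm (1, 3, 0) (pos2 k) = 0 := by
  obtain ⟨k1, k2⟩ := k
  cases k1 <;> cases k2 <;> norm_num [harm_130, pos2]

namespace CoeffJets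

variable {A : Type*} [CommRing A]

theorem kron_eq_zero (e : ℕ × ℕ × ℕ) (m n o : ℕ) (h : m + n + o < order e) :
    kron A e m n o = 0 := by
  rw [kron, if_neg]
  rintro ⟨rfl, rfl, rfl⟩
  simp [order] at h

variable [Algebra ℝ A]

/-- Here `v₀ = x y z`, and the right-hand side is the solution of `Δv₁ = -(a y z + b x z + c x y +
d₁ x y z)` with zero data on `x = 0`. It is needed for the redundant equation at level 2. -/
theorem coeff_one_gPoly_111 (J : CoeffJets A) (x y z : ℝ) :
    (J.gPoly (1, 1, 1) x y z).coeff 1 =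
      - ((x ^ 2 * y * z / 2) • J.a 0 0 0 + (x ^ 3 * z / 6) • J.b 0 0 0
        + (x ^ 3 * y / 6) • J.c 0 0 0 + (x ^ 3 * y * z / 6) • J.d₁ 0 0 0) := by
  have h1 := J.coeff_one_jet_add_two (kron A (1, 1, 1)) 0
  have h0 := J.coeff_zero_jet_add_two (kron A (1, 1, 1)) 0
  have l2 : ∀ n o, (J.jet (kron A (1, 1, 1)) 0 2 n o).coeff 0 = 0 := by
    intro n o; rw [h0 0, coeff_jet_zero, coeff_jet_zero]; simp [kron]
  have l3 : ∀ n o, (J.jet (kron A (1, 1, 1)) 0 3 n o).coeff 0 = 0 := by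
    intro n o; rw [h0 1, coeff_jet_one, coeff_jet_one]; simp [kron]
  have l4 : ∀ n o, (J.jet (kron A (1, 1, 1)) 0 4 n o).coeff 0 = 0 := by
    intro n o; rw [h0 2, l2, l2]; simp
  have v0 : ∀ n o, (J.jet (kron A (1, 1, 1)) 0 0 n o).coeff 1 = 0 := by
    intro n o; rw [coeff_jet_zero]; simp
  have v1 : ∀ n o, (J.jet (kron A (1, 1, 1)) 0 1 n o).coeff 1 = 0 := by
    intro n o; rw [coeff_jet_one]; simp
  have v2 : ∀ n o, (J.jet (kron A (1, 1, 1)) 0 2 n o).coeff 1 =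
      if n = 1 ∧ o = 1 then - J.a 0 0 0 else 0 := by
    intro n o
    rw [h1 0, v0, v0, coeff_jet_zero, coeff_jet_zero, coeff_jet_zero, coeff_jet_one]
    by_cases h : n = 1 ∧ o = 1 <;> simp [kron, h]
  have v3 : ∀ n o, (J.jet (kron A (1, 1, 1)) 0 3 n o).coeff 1 =
      - (J.b 0 0 0 * kron A (1, 1, 1) 1 (n + 1) o + J.c 0 0 0 * kron A (1, 1, 1) 1 n (o + 1)
        + J.d₁ 0 0 0 * kron A (1, 1, 1) 1 n o) := by
    intro n o
    rw [h1 1, v1, v1, coeff_jet_one, coeff_jet_one, coeff_jet_one, l2]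
    simp
  have v4 : ∀ n o, (J.jet (kron A (1, 1, 1)) 0 4 n o).coeff 1 = 0 := by
    intro n o
    rw [h1 2, v2, v2, l2, l2, l2, l3]
    simp
  have v5 : ∀ n o, (J.jet (kron A (1, 1, 1)) 0 5 n o).coeff 1 = 0 := by
    intro n o
    rw [h1 3, v3, v3, l3, l3, l3, l4]
    simp [kron]
  rw [gPoly, coeff_taylor, taylor]
  generalize J.jet (kron A (1, 1, 1)) 0 = v at v0 v1 v2 v3 v4 v5 ⊢
  simp only [Finset.sum_range_succ, Finset.sum_range_zero, Nat.reduceSub, v0, v1, v2, v3, v4, v5]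
  simp only [kron, mono, Nat.factorial]
  norm_num
  module

theorem lower_one_of_lap3 (J : CoeffJets A)
    (c : SignType × SignType × SignType → Fin 6 → A)
    (hc : ∀ k, c k 0 = algebraMap ℝ A (lap3 k)) (e : ℕ × ℕ × ℕ) :
    J.lower pos3 c e 1 = - (J.a 0 0 0 * kron A e 1 0 0 + J.b 0 0 0 * kron A e 0 1 0
      + J.c 0 0 0 * kron A e 0 0 1 + J.d₁ 0 0 0 * kron A e 0 0 0) := by
  rw [lower_one, ← sum_lap3_mul_coeff_one]
  simp only [hc]

theorem lower_one_of_lap2 (J : CoeffJets A) (hJ : J.c 0 0 0 = 0)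
    (c : SignType × SignType → Fin 6 → A)
    (hc : ∀ k, c k 0 = algebraMap ℝ A (lap2 k)) (e : ℕ × ℕ × ℕ) (he : e.2.2 = 0) :
    J.lower pos2 c e 1 = - (J.a 0 0 0 * kron A e 1 0 0 + J.b 0 0 0 * kron A e 0 1 0
      + J.d₁ 0 0 0 * kron A e 0 0 0) := by
  rw [lower_one, ← sum_lap2_mul_coeff_one J hJ e he]
  simp only [hc]

theorem lower_one_of_lap3_eq_zero (J : CoeffJets A)
    (c : SignType × SignType × SignType → Fin 6 → A)
    (hc : ∀ k, c k 0 = algebraMap ℝ A (lap3 k)) (e : ℕ × ℕ × ℕ) (he : 2 ≤ order e) :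
    J.lower pos3 c e 1 = 0 := by
  rw [lower_one_of_lap3 J c hc, kron_eq_zero, kron_eq_zero, kron_eq_zero, kron_eq_zero]
  · simp
  all_goals omega

/-- The contribution of `h⁰` vanishes by the degree bound. In that of `h¹`, the terms with `x² y z`
and `x³ y z` vanish on the nodes, while `x³ z = x z` and `x³ y = x y` there. What remains is a
combination of the level-1 equations of `(1, 0, 1)` and `(1, 1, 0)`, whose own inhomogeneities are
zero. -/
theorem lower_two_of_lap3_eq_zero (J : CoeffJets A)
    (c : SignType × SignType × SignType → Fin 6 → A)
    (hc : J.IsPartial pos3 lap3 lev3 (fun e => e.1 ≤ 1) 2 c) :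
    J.lower pos3 c (1, 1, 1) 2 = 0 := by
  have hz : ∀ e : ℕ × ℕ × ℕ, e.1 ≤ 1 → order e = 2 → ∑ k, harm e (pos3 k) • c k 1 = 0 := by
    intro e he ho
    have h1 := hc.residual_eq e he 1 (by norm_num) (by omega)
    have h2 := residual_eq_add J pos3 c e 1
    rw [Fin.val_one, h1, lower_one_of_lap3_eq_zero J c hc.lap_eq e (by omega), zero_add] at h2
    exact h2.symm
  rw [lower_two]
  simp only [hc.lap_eq]
  rw [sum_lap3_mul_coeff_two J _ (by simp [order]), zero_add]
  have hp : ∀ k, c k 1 * (J.gPoly (1, 1, 1) (pos3 k).1 (pos3 k).2.1 (pos3 k).2.2).coeff 1 =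
      (-1 / 6 : ℝ) • (J.b 0 0 0 * harm (1, 0, 1) (pos3 k) • c k 1
        + J.c 0 0 0 * harm (1, 1, 0) (pos3 k) • c k 1) := by
    rintro ⟨k1, k2, k3⟩
    rw [coeff_one_gPoly_111]
    cases k1 <;> cases k2 <;> cases k3 <;> first
    | (rw [hc.vanish _ 1 (by decide)]; simp)
    | (simp only [pos3, cast_sign_zero, cast_sign_neg, cast_sign_pos, harm_101, harm_110,
        Algebra.smul_def]
       norm_num
       try ring)
  simp only [hp]
  rw [← Finset.smul_sum, Finset.sum_add_distrib, ← Finset.mul_sum, ← Finset.mul_sum,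
    hz (1, 0, 1) le_rfl rfl, hz (1, 1, 0) le_rfl rfl]
  simp

/-- The basis equations form a solvable square system. Every other equation is, on the unknown
nodes, a multiple of a basis equation (possibly the zero multiple). Its own inhomogeneity vanishes,
as does that of the basis equation when the multiple is not zero, so it holds automatically. -/
theorem IsPartial.succ3 {J : CoeffJets A} {j : ℕ}
    {c : SignType × SignType × SignType → Fin 6 → A}
    (hc : J.IsPartial pos3 lap3 lev3 (fun e => e.1 ≤ 1) j c) (hj : 1 ≤ j) (hj5 : j ≤ 5) :
    ∃ c', J.IsPartial pos3 lap3 lev3 (fun e => e.1 ≤ 1) (j + 1) c' := by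
  obtain ⟨v, hv, he⟩ := exists_solution (free3 j) (basis3 j) (fun e k => harm e (pos3 k))
    (card_free3 j hj5) (eq_zero_of_harm3 j hj5) (fun e => - J.lower pos3 c e j)
  refine hc.step hj (by omega) v (fun k hk => hv k ((free3_eq_false_iff j hj k).mpr hk)) ?_
  intro e hE ho
  have hprop : ∀ (e' : ℕ × ℕ × ℕ) (t : ℝ),
      (∀ k, 1 < lev3 k → harm e (pos3 k) = t * harm e' (pos3 k)) →
      ∑ k, harm e (pos3 k) • v k = t • ∑ k, harm e' (pos3 k) • v k := by
    intro e' t ht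
    rw [Finset.smul_sum]
    refine Finset.sum_congr rfl fun k _ => ?_
    by_cases hk : 1 < lev3 k
    · rw [ht k hk, mul_smul]
    · rw [hv k ((free3_eq_false_iff j hj k).mpr (by omega))]; simp
  rcases mem_basis3 j hj e hE ho with hb | ⟨rfl, rfl⟩ | ⟨rfl, hs⟩
  · exact he e hb
  · rw [lower_two_of_lap3_eq_zero J c hc, neg_zero, hprop (0, 0, 0) 0, zero_smul]
    rintro ⟨k1, k2, k3⟩ hk
    cases k1 <;> cases k2 <;> cases k3 <;> first
    | exact absurd hk (by decide)
    | norm_num [harm_111, pos3]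
  · obtain ⟨e', t, hb, ho', ht⟩ := harm3_redundant e hs
    have h2 : 2 ≤ order e := by
      rcases hs with rfl | rfl | rfl | rfl | rfl | rfl | rfl <;> simp [order]
    rw [hprop e' t ht, he e' hb, lower_one_of_lap3_eq_zero J c hc.lap_eq e' ho',
      lower_one_of_lap3_eq_zero J c hc.lap_eq e h2]
    simp

/-- Only `(1, 3, 0)` at level 1 is outside the basis. Its polynomial vanishes on the nodes, and so
does its inhomogeneity, the order being four. -/
theorem IsPartial.succ2 {J : CoeffJets A} (hJ : J.c 0 0 0 = 0) {j : ℕ}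
    {c : SignType × SignType → Fin 6 → A}
    (hc : J.IsPartial pos2 lap2 lev2 (fun e => e.1 ≤ 1 ∧ e.2.2 = 0) j c)
    (hj : 1 ≤ j) (hj5 : j ≤ 5) :
    ∃ c', J.IsPartial pos2 lap2 lev2 (fun e => e.1 ≤ 1 ∧ e.2.2 = 0) (j + 1) c' := by
  obtain ⟨v, hv, he⟩ := exists_solution (free2 j) (basis2 j) (fun e k => harm e (pos2 k))
    (card_free2 j hj5) (eq_zero_of_harm2 j hj5) (fun e => - J.lower pos2 c e j)
  refine hc.step hj (by omega) v (fun k hk => hv k ((free2_eq_false_iff j hj k).mpr hk)) ?_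
  intro e hE ho
  rcases mem_basis2 j hj e hE ho with hb | ⟨rfl, rfl⟩
  · exact he e hb
  · rw [lower_one_of_lap2 J hJ c hc.lap_eq _ rfl, kron_eq_zero, kron_eq_zero, kron_eq_zero]
    · simp [harm2_redundant]
    all_goals simp [order]

theorem exists_isPartial3 (J : CoeffJets A) :
    ∃ c, J.IsPartial pos3 lap3 lev3 (fun e => e.1 ≤ 1) 6 c := by
  have h1 := isPartial_one J pos3 lap3 lev3 (fun e => e.1 ≤ 1) (by
    rintro ⟨k1, k2, k3⟩
    cases k1 <;> cases k2 <;> cases k3 <;> simp [lev3, lap3]) (fun e _ => sum_lap3_mul_harm e)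
  obtain ⟨c2, h2⟩ := h1.succ3 (by norm_num) (by norm_num)
  obtain ⟨c3, h3⟩ := h2.succ3 (by norm_num) (by norm_num)
  obtain ⟨c4, h4⟩ := h3.succ3 (by norm_num) (by norm_num)
  obtain ⟨c5, h5⟩ := h4.succ3 (by norm_num) (by norm_num)
  exact h5.succ3 (by norm_num) (by norm_num)

theorem exists_isPartial2 (J : CoeffJets A) (hJ : J.c 0 0 0 = 0) :
    ∃ c, J.IsPartial pos2 lap2 lev2 (fun e => e.1 ≤ 1 ∧ e.2.2 = 0) 6 c := by
  have h1 := isPartial_one J pos2 lap2 lev2 (fun e => e.1 ≤ 1 ∧ e.2.2 = 0) (by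
    rintro ⟨k1, k2⟩
    cases k1 <;> cases k2 <;> simp [lev2]) (fun e he => sum_lap2_mul_harm e he.2)
  obtain ⟨c2, h2⟩ := h1.succ2 hJ (by norm_num) (by norm_num)
  obtain ⟨c3, h3⟩ := h2.succ2 hJ (by norm_num) (by norm_num)
  obtain ⟨c4, h4⟩ := h3.succ2 hJ (by norm_num) (by norm_num)
  obtain ⟨c5, h5⟩ := h4.succ2 hJ (by norm_num) (by norm_num)
  exact h5.succ2 hJ (by norm_num) (by norm_num)

end CoeffJets

end

noncomputable section

open Polynomial CoeffJets

/-! ### Compact stencils and the coefficient equations -/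

/-- The data of `Δu + a u_x + b u_y + c u_z + (d₁ / (r h)) u + d₂ u = f`. -/
def dataJets (r : ℝ) (a b c d₁ d₂ : ℕ → ℕ → ℕ → ℝ) : CoeffJets ℝ :=
  ⟨a, b, c, fun m n o => d₁ m n o / r, d₂⟩

theorem sum_triple {M : Type*} [AddCommMonoid M] (f : SignType → SignType → SignType → M) :
    ∑ k : SignType, ∑ l : SignType, ∑ s : SignType, f k l s =
      ∑ k : SignType × SignType × SignType, f k.1 k.2.1 k.2.2 := by
  rw [Fintype.sum_prod_type]
  exact Finset.sum_congr rfl fun k _ => (Fintype.sum_prod_type' (f k)).symm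

theorem applyStencil3_eq (C : Stencil3) (P : ℝ → ℝ → ℝ → ℝ) (h : ℝ) :
    applyStencil3 C P h = ∑ k, coeffPoly (C k.1 k.2.1 k.2.2) h *
      P ((pos3 k).1 * h) ((pos3 k).2.1 * h) ((pos3 k).2.2 * h) :=
  sum_triple _

theorem applyStencil2_eq (C : Stencil2) (P : ℝ → ℝ → ℝ) (h : ℝ) :
    applyStencil2 C P h = ∑ k, coeffPoly (C k.1 k.2) h *
      P ((pos2 k).1 * h) ((pos2 k).2.1 * h) :=
  (Fintype.sum_prod_type' _).symm

theorem IsCompactStencil3.residual_eq {r : ℝ} {a b c d₁ d₂ : ℕ → ℕ → ℕ → ℝ} {C : Stencil3}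
    (h : IsCompactStencil3 r a b c d₁ d₂ C) (e : ℕ × ℕ × ℕ) (he : e.1 ≤ 1) (i : ℕ)
    (hi : order e + i ≤ 5) :
    (dataJets r a b c d₁ d₂).residual pos3 (fun k => C k.1 k.2.1 k.2.2) e i = 0 := by
  obtain ⟨m, n, o⟩ := e
  simp only [order] at hi
  have h1 := h.1 m n o he (by omega)
  simp only [applyStencil3_eq] at h1
  exact (isBigO_iff_residual a b c d₁ d₂ r pos3 (fun k => C k.1 k.2.1 k.2.2) m n o).mp h1 i hi

theorem IsCompactStencil3.vanish {r : ℝ} {a b c d₁ d₂ : ℕ → ℕ → ℕ → ℝ} {C : Stencil3}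
    (h : IsCompactStencil3 r a b c d₁ d₂ C) (k : SignType × SignType × SignType) :
    VanishFrom (lev3 k) (C k.1 k.2.1 k.2.2) := by
  obtain ⟨-, -, h0, -, h1, h2, h3, h4, h5, h6, h7, h8, h9, h10, h11, h12, h13, h14, h15, h16, h17,
    h18⟩ := h
  obtain ⟨k1, k2, k3⟩ := k
  cases k1 <;> cases k2 <;> cases k3 <;> first
  | exact h0 _ _ _ (by decide) (by decide) (by decide)
  | exact h1 | exact h2 | exact h3 | exact h4 | exact h5 | exact h6 | exact h7 | exact h8
  | exact h9 | exact h10 | exact h11 | exact h12 | exact h13 | exact h14 | exact h15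
  | exact h16 | exact h17 | exact h18
  | (intro p hp; simp only [lev3] at hp; omega)

theorem sum_lap3_mul_sq : ∑ k, lap3 k * ((pos3 k).1 ^ 2 / 2) = 1 := by
  simp only [Fintype.sum_prod_type, sum_signType, lap3, pos3, cast_sign_zero, cast_sign_neg,
    cast_sign_pos]
  norm_num

theorem sum_lap2_mul_sq : ∑ k, lap2 k * ((pos2 k).1 ^ 2 / 2) = 1 := by
  simp only [Fintype.sum_prod_type, sum_signType, lap2, pos2, cast_sign_zero, cast_sign_neg,
    cast_sign_pos]
  norm_num

theorem sum_lap3 : ∑ k, lap3 k = 0 := by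
  simp only [Fintype.sum_prod_type, sum_signType, lap3]
  norm_num

theorem sum_lap2 : ∑ k, lap2 k = 0 := by
  simp only [Fintype.sum_prod_type, sum_signType, lap2]
  norm_num

theorem CoeffJets.IsPartial.isCompactStencil3 {r : ℝ} {a b c d₁ d₂ : ℕ → ℕ → ℕ → ℝ}
    {s : SignType × SignType × SignType → Fin 6 → ℝ}
    (h : (dataJets r a b c d₁ d₂).IsPartial pos3 lap3 lev3 (fun e => e.1 ≤ 1) 6 s) :
    IsCompactStencil3 r a b c d₁ d₂ (fun k l o => s (k, l, o)) := by
  have hv : ∀ k l o q, lev3 (k, l, o) = q → VanishFrom q (s (k, l, o)) := by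
    rintro k l o q rfl
    exact h.vanish (k, l, o)
  refine ⟨fun m n o hm hmn => ?_, fun f => ?_, fun k l o hk hl ho => ?_, h.lap_eq (0, 0, 0),
    hv (-1) 0 (-1) 5 (by decide), hv (-1) 0 0 5 (by decide),
    hv (-1) 0 1 4 (by decide), hv (-1) 1 0 4 (by decide),
    hv 0 (-1) (-1) 5 (by decide), hv 0 (-1) 0 4 (by decide),
    hv 0 (-1) 1 3 (by decide), hv 0 0 (-1) 4 (by decide),
    hv 0 0 0 4 (by decide), hv 0 0 1 3 (by decide),
    hv 0 1 (-1) 3 (by decide), hv 0 1 0 3 (by decide),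
    hv 0 1 1 2 (by decide), hv 1 (-1) 0 3 (by decide),
    hv 1 0 (-1) 3 (by decide), hv 1 0 0 2 (by decide),
    hv 1 0 1 2 (by decide), hv 1 1 0 1 (by decide)⟩
  · simp only [applyStencil3_eq]
    exact (isBigO_iff_residual a b c d₁ d₂ r pos3 s m n o).mpr fun j hj =>
      h.residual_eq (m, n, o) hm j (by omega) hj
  · have ht := tendsto_source a b c d₁ d₂ r pos3 s (by
      simp only [h.lap_eq]; exact sum_lap3_mul_sq)
    have := tendsto_finsetSum (Finset.range 4) fun m _ =>
      tendsto_finsetSum (Finset.range (4 - m)) fun n _ =>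
        tendsto_finsetSum (Finset.range (4 - m - n)) fun o _ => (ht m n o).const_mul (f m n o)
    simp only [applyStencil3_eq]
    refine (this.congr fun t => ?_).trans_eq ?_
    · simp only [Finset.sum_div, mul_div_assoc]
    · congr 1
      simp [Finset.sum_range_succ]
  · have := h.vanish (k, l, o)
    have h0 : lev3 (k, l, o) = 0 := by
      revert hk hl ho; cases k <;> cases l <;> cases o <;> decide
    rw [h0] at this
    exact this

/-- Consistency, the normalisation at the centre and the prescribed zeros already determine the
stencil. -/
theorem IsCompactStencil3.eq {r : ℝ} {a b c d₁ d₂ : ℕ → ℕ → ℕ → ℝ} {C C' : Stencil3}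
    (h : IsCompactStencil3 r a b c d₁ d₂ C) (h' : IsCompactStencil3 r a b c d₁ d₂ C') :
    C = C' := by
  have key := eq_of_residual_eq (E := fun e => e.1 ≤ 1) free3 basis3 basis3_spec eq_zero_of_harm3
    (c := fun k => C k.1 k.2.1 k.2.2) (c' := fun k => C' k.1 k.2.1 k.2.2) (fun j k hk => ?_)
    h.residual_eq h'.residual_eq
  · funext k l o
    exact congrFun key (k, l, o)
  · by_cases hj : 1 ≤ (j : ℕ)
    · rw [free3_eq_false_iff _ hj] at hk
      rw [h.vanish k j hk, h'.vanish k j hk]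
    -- At level 0 the coefficients fixed in advance are those of the centre and of the eight
    -- corners.
    · have hj0 : j = 0 := by ext; simp; omega
      subst hj0
      by_cases hk0 : k = (0, 0, 0)
      · subst hk0
        exact h.2.2.2.1.trans h'.2.2.2.1.symm
      · have hl : lev3 k = 0 := by
          revert hk hk0
          obtain ⟨k1, k2, k3⟩ := k
          cases k1 <;> cases k2 <;> cases k3 <;> decide
        rw [h.vanish k 0 (by simp [hl]), h'.vanish k 0 (by simp [hl])]

theorem IsCompactStencil2.residual_eq {r : ℝ} {a b d₁ d₂ : ℕ → ℕ → ℝ} {C : Stencil2}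
    (h : IsCompactStencil2 r a b d₁ d₂ C) (e : ℕ × ℕ × ℕ) (he : e.1 ≤ 1 ∧ e.2.2 = 0) (i : ℕ)
    (hi : order e + i ≤ 5) :
    (dataJets r (liftJet a) (liftJet b) 0 (liftJet d₁) (liftJet d₂)).residual pos2
      (fun k => C k.1 k.2) e i = 0 := by
  obtain ⟨m, n, o⟩ := e
  obtain ⟨hm, rfl : o = 0⟩ := he
  simp only [order] at hi
  have h1 := h.1 m n hm (by omega)
  simp only [applyStencil2_eq, polyG2_eq, liftJet_reaction2] at h1
  refine (isBigO_iff_residual (liftJet a) (liftJet b) 0 (liftJet d₁) (liftJet d₂) r pos2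
    (fun k => C k.1 k.2) m n 0).mp ?_ i hi
  simpa only [pos2, zero_mul] using h1

theorem IsCompactStencil2.vanish {r : ℝ} {a b d₁ d₂ : ℕ → ℕ → ℝ} {C : Stencil2}
    (h : IsCompactStencil2 r a b d₁ d₂ C) (k : SignType × SignType) :
    VanishFrom (lev2 k) (C k.1 k.2) := by
  obtain ⟨-, -, -, h1, h2, h3, h4, h5, h6, h7, h8⟩ := h
  obtain ⟨k1, k2⟩ := k
  cases k1 <;> cases k2 <;> first
  | exact h1 | exact h2 | exact h3 | exact h4 | exact h5 | exact h6 | exact h7 | exact h8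
  | (intro p hp; simp only [lev2] at hp; omega)

theorem CoeffJets.IsPartial.isCompactStencil2 {r : ℝ} {a b d₁ d₂ : ℕ → ℕ → ℝ}
    {s : SignType × SignType → Fin 6 → ℝ}
    (h : (dataJets r (liftJet a) (liftJet b) 0 (liftJet d₁) (liftJet d₂)).IsPartial pos2 lap2 lev2
      (fun e => e.1 ≤ 1 ∧ e.2.2 = 0) 6 s) :
    IsCompactStencil2 r a b d₁ d₂ (fun k l => s (k, l)) := by
  have hv : ∀ k l q, lev2 (k, l) = q → VanishFrom q (s (k, l)) := by
    rintro k l q rfl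
    exact h.vanish (k, l)
  refine ⟨fun m n hm hmn => ?_, fun f => ?_, h.lap_eq (0, 0),
    hv (-1) 0 5 (by decide), hv (-1) 1 4 (by decide), hv 0 (-1) 5 (by decide), hv 0 0 4 (by decide),
    hv 0 1 3 (by decide), hv 1 (-1) 3 (by decide), hv 1 0 2 (by decide), hv 1 1 1 (by decide)⟩
  · simp only [applyStencil2_eq, polyG2_eq, liftJet_reaction2]
    have := (isBigO_iff_residual (liftJet a) (liftJet b) 0 (liftJet d₁) (liftJet d₂) r pos2 s
      m n 0).mpr fun j hj => h.residual_eq (m, n, 0) ⟨hm, rfl⟩ j (by omega) hj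
    simpa only [pos2, zero_mul] using this
  · have ht := tendsto_source (liftJet a) (liftJet b) 0 (liftJet d₁) (liftJet d₂) r pos2 s (by
      simp only [h.lap_eq]; exact sum_lap2_mul_sq)
    have := tendsto_finsetSum (Finset.range 4) fun m _ =>
      tendsto_finsetSum (Finset.range (4 - m)) fun n _ => (ht m n 0).const_mul (f m n)
    simp only [applyStencil2_eq, polyH2_eq, liftJet_reaction2]
    refine (this.congr fun t => ?_).trans_eq ?_
    · simp only [Finset.sum_div, mul_div_assoc, pos2, zero_mul]
    · congr 1
      simp [Finset.sum_range_succ]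

theorem IsCompactStencil2.eq {r : ℝ} {a b d₁ d₂ : ℕ → ℕ → ℝ} {C C' : Stencil2}
    (h : IsCompactStencil2 r a b d₁ d₂ C) (h' : IsCompactStencil2 r a b d₁ d₂ C') :
    C = C' := by
  have key := eq_of_residual_eq (E := fun e => e.1 ≤ 1 ∧ e.2.2 = 0) free2 basis2 basis2_spec
    eq_zero_of_harm2
    (c := fun k => C k.1 k.2) (c' := fun k => C' k.1 k.2) (fun j k hk => ?_)
    h.residual_eq h'.residual_eq
  · funext k l
    exact congrFun key (k, l)
  · by_cases hj : 1 ≤ (j : ℕ)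
    · rw [free2_eq_false_iff _ hj] at hk
      rw [h.vanish k j hk, h'.vanish k j hk]
    · have hj0 : j = 0 := by ext; simp; omega
      subst hj0
      have hk0 : k = (0, 0) := by
        revert hk
        obtain ⟨k1, k2⟩ := k
        cases k1 <;> cases k2 <;> decide
      subst hk0
      exact h.2.2.1.trans h'.2.2.1.symm

/-- Since `harm (0, 0, 0) = 1`, this is the level-1 equation of `e = 0`. In `dataJets` the entry
`d₁` already contains the division by `r`. -/
theorem CoeffJets.IsPartial.sum_one3 {J : CoeffJets ℝ}
    {s : SignType × SignType × SignType → Fin 6 → ℝ}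
    (h : J.IsPartial pos3 lap3 lev3 (fun e => e.1 ≤ 1) 6 s) : ∑ k, s k 1 = J.d₁ 0 0 0 := by
  have h1 := h.residual_eq (0, 0, 0) (by simp) 1 (by norm_num) (by simp [order])
  have h2 := residual_eq_add J pos3 s (0, 0, 0) 1
  rw [Fin.val_one, h1, lower_one_of_lap3 J s h.lap_eq] at h2
  simp [kron, harm_000] at h2
  linarith

theorem CoeffJets.IsPartial.sum_one2 {J : CoeffJets ℝ} (hJ : J.c 0 0 0 = 0)
    {s : SignType × SignType → Fin 6 → ℝ}
    (h : J.IsPartial pos2 lap2 lev2 (fun e => e.1 ≤ 1 ∧ e.2.2 = 0) 6 s) :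
    ∑ k, s k 1 = J.d₁ 0 0 0 := by
  have h1 := h.residual_eq (0, 0, 0) (by simp) 1 (by norm_num) (by simp [order])
  have h2 := residual_eq_add J pos2 s (0, 0, 0) 1
  rw [Fin.val_one, h1, lower_one_of_lap2 J hJ s h.lap_eq _ rfl] at h2
  simp [kron, harm_000] at h2
  linarith

/-! ### Uniform bounds -/

/-- The algebra of bounded functions. -/
def boundedFun (Ω : Type*) : Subalgebra ℝ (Ω → ℝ) where
  carrier := {f | ∃ B, ∀ t, |f t| ≤ B}
  mul_mem' := by
    rintro f g ⟨B, hB⟩ ⟨D, hD⟩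
    exact ⟨B * D, fun t => by
      rw [Pi.mul_apply, abs_mul]
      exact mul_le_mul (hB t) (hD t) (abs_nonneg _) ((abs_nonneg _).trans (hB t))⟩
  add_mem' := by
    rintro f g ⟨B, hB⟩ ⟨D, hD⟩
    exact ⟨B + D, fun t => (abs_add_le _ _).trans (add_le_add (hB t) (hD t))⟩
  algebraMap_mem' := fun t => ⟨|t|, fun t => by simp⟩

/-- Evaluation of bounded functions. -/
def boundedFun.eval {Ω : Type*} (t : Ω) : boundedFun Ω →ₐ[ℝ] ℝ :=
  (Pi.evalAlgHom ℝ (fun _ : Ω => ℝ) t).comp (boundedFun Ω).val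

theorem boundedFun.eval_apply {Ω : Type*} (t : Ω) (f : boundedFun Ω) :
    boundedFun.eval t f = (f : Ω → ℝ) t := rfl

/-- All derivatives are bounded functions of the parameter. -/
def BoundedJets {Ω : Type*} (a : Ω → ℕ → ℕ → ℕ → ℝ) : Prop :=
  ∀ m n o, ∃ B, ∀ t, |a t m n o| ≤ B

/-- Data with bounded derivatives have stencils with bounded coefficients. -/
theorem exists_bounded_isPartial {Ω K : Type*} [Fintype K] {pos : K → ℝ × ℝ × ℝ} {lap : K → ℝ}
    {lev : K → ℕ} {E : ℕ × ℕ × ℕ → Prop} (J : Ω → CoeffJets ℝ)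
    (ha : BoundedJets fun t => (J t).a) (hb : BoundedJets fun t => (J t).b)
    (hc : BoundedJets fun t => (J t).c) (hd₁ : BoundedJets fun t => (J t).d₁)
    (hd₂ : BoundedJets fun t => (J t).d₂)
    (hex : ∀ J' : CoeffJets (boundedFun Ω), (∀ t, J'.map (boundedFun.eval t : _ →+* ℝ) = J t) →
      ∃ c, J'.IsPartial pos lap lev E 6 c) :
    ∃ B, ∀ t, ∃ c, (J t).IsPartial pos lap lev E 6 c ∧ ∀ k p, |c k p| ≤ B := by
  -- The whole family becomes a single set of data over the bounded functions. A solution over that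
  -- algebra has bounded coefficients by construction, and evaluation at `t` makes it a solution for
  -- `J t`.
  let J' : CoeffJets (boundedFun Ω) := ⟨fun m n o => ⟨fun t => (J t).a m n o, ha m n o⟩,
    fun m n o => ⟨fun t => (J t).b m n o, hb m n o⟩,
    fun m n o => ⟨fun t => (J t).c m n o, hc m n o⟩,
    fun m n o => ⟨fun t => (J t).d₁ m n o, hd₁ m n o⟩,
    fun m n o => ⟨fun t => (J t).d₂ m n o, hd₂ m n o⟩⟩
  obtain ⟨c, h⟩ := hex J' (fun t => rfl)
  have hB : ∀ k p, ∃ B, ∀ t, |(c k p : Ω → ℝ) t| ≤ B := fun k p => (c k p).2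
  choose B hB using hB
  -- The point `t` is needed: over an empty `Ω` the bounds could be negative.
  have hB0 : ∀ (t : Ω) k p, 0 ≤ B k p := fun t k p => (abs_nonneg _).trans (hB k p t)
  refine ⟨∑ k, ∑ p, B k p, fun t => ⟨fun k p => (c k p : Ω → ℝ) t, ⟨fun k => ?_, fun k p hp => ?_,
    fun e he i hi ho => ?_⟩, fun k p => ?_⟩⟩
  · rw [h.lap_eq k]; rfl
  · rw [h.vanish k p hp]; rfl
  · have h1 := residual_map (boundedFun.eval t) J' pos c e i
    rw [h.residual_eq e he i hi ho, map_zero] at h1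
    exact h1
  · refine (hB k p t).trans ?_
    refine le_trans ?_ (Finset.single_le_sum (f := fun k => ∑ p, B k p)
      (fun k _ => Finset.sum_nonneg fun p _ => hB0 t k p) (Finset.mem_univ k))
    exact Finset.single_le_sum (fun p _ => hB0 t k p) (Finset.mem_univ p)

theorem exists_bounded_isPartial3 {Ω : Type*} (J : Ω → CoeffJets ℝ)
    (ha : BoundedJets fun t => (J t).a) (hb : BoundedJets fun t => (J t).b)
    (hc : BoundedJets fun t => (J t).c) (hd₁ : BoundedJets fun t => (J t).d₁)
    (hd₂ : BoundedJets fun t => (J t).d₂) :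
    ∃ B, ∀ t, ∃ c, (J t).IsPartial pos3 lap3 lev3 (fun e => e.1 ≤ 1) 6 c ∧ ∀ k p, |c k p| ≤ B :=
  exists_bounded_isPartial J ha hb hc hd₁ hd₂ fun J' _ => exists_isPartial3 J'

theorem exists_bounded_isPartial2 {Ω : Type*} (J : Ω → CoeffJets ℝ)
    (ha : BoundedJets fun t => (J t).a) (hb : BoundedJets fun t => (J t).b)
    (hc : ∀ t, (J t).c = 0) (hd₁ : BoundedJets fun t => (J t).d₁)
    (hd₂ : BoundedJets fun t => (J t).d₂) :
    ∃ B, ∀ t, ∃ c, (J t).IsPartial pos2 lap2 lev2 (fun e => e.1 ≤ 1 ∧ e.2.2 = 0) 6 c ∧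
      ∀ k p, |c k p| ≤ B := by
  refine exists_bounded_isPartial J ha hb (fun m n o => ⟨0, fun t => by simp [hc]⟩) hd₁ hd₂
    fun J' hJ' => exists_isPartial2 J' ?_
  ext t
  have := congrArg (fun J : CoeffJets ℝ => J.c 0 0 0) (hJ' t)
  simpa [CoeffJets.map, hc, boundedFun.eval_apply] using this

end

noncomputable section

/-! ### Bounds for the derivatives of the coefficients -/

/-- The closed space-time box. -/
def box (l₁ l₂ T : ℝ) : Set (ℝ × ℝ × ℝ × ℝ) :=
  Set.Icc l₁ l₂ ×ˢ Set.Icc l₁ l₂ ×ˢ Set.Icc l₁ l₂ ×ˢ Set.Icc 0 T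

/-- Space-time points in the interior of the spatial domain. -/
def openBox (l₁ l₂ T : ℝ) : Set (ℝ × ℝ × ℝ × ℝ) :=
  Set.Ioo l₁ l₂ ×ˢ Set.Ioo l₁ l₂ ×ˢ Set.Ioo l₁ l₂ ×ˢ Set.Icc 0 T

theorem openBox_subset_box (l₁ l₂ T : ℝ) : openBox l₁ l₂ T ⊆ box l₁ l₂ T :=
  Set.prod_mono Set.Ioo_subset_Icc_self (Set.prod_mono Set.Ioo_subset_Icc_self
    (Set.prod_mono Set.Ioo_subset_Icc_self subset_rfl))

/-- In the interior of the domain, `F` agrees with a function that is smooth on the closed box. -/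
def InteriorSmooth (l₁ l₂ T : ℝ) (F : ℝ → ℝ → ℝ → ℝ → ℝ) : Prop :=
  ∃ G : ℝ × ℝ × ℝ × ℝ → ℝ, ContDiffOn ℝ ∞ G (box l₁ l₂ T) ∧
    ∀ x y z t, (x, y, z, t) ∈ openBox l₁ l₂ T → F x y z t = G (x, y, z, t)

section

variable {l₁ l₂ T : ℝ} {F : ℝ → ℝ → ℝ → ℝ → ℝ}

theorem SmoothOnBox3.interiorSmooth (hF : SmoothOnBox3 l₁ l₂ T F) :
    InteriorSmooth l₁ l₂ T F :=
  ⟨_, hF, fun _ _ _ _ _ => rfl⟩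

/-- Compactness of the closed box is the source of all bounds that are uniform in the node and the
time. -/
theorem InteriorSmooth.exists_bound (hF : InteriorSmooth l₁ l₂ T F) :
    ∃ B, ∀ x y z t, (x, y, z, t) ∈ openBox l₁ l₂ T → |F x y z t| ≤ B := by
  obtain ⟨G, hG, hFG⟩ := hF
  have hc : IsCompact (box l₁ l₂ T) :=
    isCompact_Icc.prod (isCompact_Icc.prod (isCompact_Icc.prod isCompact_Icc))
  obtain ⟨B, hB⟩ := hc.exists_bound_of_continuousOn hG.continuousOn
  refine ⟨B, fun x y z t h => ?_⟩
  rw [hFG x y z t h]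
  exact hB _ (openBox_subset_box _ _ _ h)

/-- Nondegenerate sides make derivatives within the closed box unique, so that they are again smooth
up to its boundary. -/
theorem uniqueDiffOn_box (hl : l₁ < l₂) (hT : 0 < T) : UniqueDiffOn ℝ (box l₁ l₂ T) :=
  (uniqueDiffOn_Icc hl).prod ((uniqueDiffOn_Icc hl).prod
    ((uniqueDiffOn_Icc hl).prod (uniqueDiffOn_Icc hT)))

theorem contDiffOn_fderivWithin_box (hl : l₁ < l₂) (hT : 0 < T) {G : ℝ × ℝ × ℝ × ℝ → ℝ}
    (hG : ContDiffOn ℝ ∞ G (box l₁ l₂ T)) (v : ℝ × ℝ × ℝ × ℝ) :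
    ContDiffOn ℝ ∞ (fun p => fderivWithin ℝ G (box l₁ l₂ T) p v) (box l₁ l₂ T) :=
  (hG.fderivWithin (uniqueDiffOn_box hl hT) le_rfl).clm_apply contDiffOn_const

/-- `deriv` looks at a full neighbourhood, and outside the box nothing is known about the functions.
At spatially interior points the line stays in the box near `s`, so the derivative is a directional
derivative of `G` within the box. -/
theorem deriv_comp_line {G : ℝ × ℝ × ℝ × ℝ → ℝ}
    (hG : ContDiffOn ℝ ∞ G (box l₁ l₂ T)) {γ : ℝ → ℝ × ℝ × ℝ × ℝ} {v : ℝ × ℝ × ℝ × ℝ} {s : ℝ}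
    (hγ : HasDerivAt γ v s) (hmem : ∀ s' ∈ Set.Ioo l₁ l₂, γ s' ∈ openBox l₁ l₂ T)
    (hs : s ∈ Set.Ioo l₁ l₂) {f : ℝ → ℝ} (hf : ∀ s' ∈ Set.Ioo l₁ l₂, f s' = G (γ s')) :
    deriv f s = fderivWithin ℝ G (box l₁ l₂ T) (γ s) v := by
  have hN : Set.Ioo l₁ l₂ ∈ 𝓝 s := isOpen_Ioo.mem_nhds hs
  have h1 : HasFDerivWithinAt G (fderivWithin ℝ G (box l₁ l₂ T) (γ s)) (box l₁ l₂ T) (γ s) :=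
    ((hG.differentiableOn (by simp)) _ (openBox_subset_box _ _ _ (hmem s hs))).hasFDerivWithinAt
  have h2 := h1.comp_hasDerivWithinAt s (s := Set.Ioo l₁ l₂) hγ.hasDerivWithinAt
    (fun s' hs' => openBox_subset_box _ _ _ (hmem s' hs'))
  have h3 : f =ᶠ[𝓝 s] G ∘ γ := by
    filter_upwards [hN] with s' hs' using hf s' hs'
  rw [h3.deriv_eq]
  exact (h2.hasDerivAt hN).deriv

theorem InteriorSmooth.deriv_x (hl : l₁ < l₂) (hT : 0 < T) (hF : InteriorSmooth l₁ l₂ T F) :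
    InteriorSmooth l₁ l₂ T (fun x y z t => deriv (fun x' => F x' y z t) x) := by
  obtain ⟨G, hG, hFG⟩ := hF
  refine ⟨_, contDiffOn_fderivWithin_box hl hT hG (1, 0, 0, 0), fun x y z t h => ?_⟩
  obtain ⟨hx, hy, hz, ht⟩ := h
  exact deriv_comp_line hG ((hasDerivAt_id x).prodMk (hasDerivAt_const x (y, z, t)))
    (fun s hs => ⟨hs, hy, hz, ht⟩) hx (fun s hs => hFG s y z t ⟨hs, hy, hz, ht⟩)

theorem InteriorSmooth.deriv_y (hl : l₁ < l₂) (hT : 0 < T) (hF : InteriorSmooth l₁ l₂ T F) :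
    InteriorSmooth l₁ l₂ T (fun x y z t => deriv (fun y' => F x y' z t) y) := by
  obtain ⟨G, hG, hFG⟩ := hF
  refine ⟨_, contDiffOn_fderivWithin_box hl hT hG (0, 1, 0, 0), fun x y z t h => ?_⟩
  obtain ⟨hx, hy, hz, ht⟩ := h
  exact deriv_comp_line hG
    ((hasDerivAt_const y x).prodMk ((hasDerivAt_id y).prodMk (hasDerivAt_const y (z, t))))
    (fun s hs => ⟨hx, hs, hz, ht⟩) hy (fun s hs => hFG x s z t ⟨hx, hs, hz, ht⟩)

theorem InteriorSmooth.deriv_z (hl : l₁ < l₂) (hT : 0 < T) (hF : InteriorSmooth l₁ l₂ T F) :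
    InteriorSmooth l₁ l₂ T (fun x y z t => deriv (fun z' => F x y z' t) z) := by
  obtain ⟨G, hG, hFG⟩ := hF
  refine ⟨_, contDiffOn_fderivWithin_box hl hT hG (0, 0, 1, 0), fun x y z t h => ?_⟩
  obtain ⟨hx, hy, hz, ht⟩ := h
  exact deriv_comp_line hG
    ((hasDerivAt_const z x).prodMk ((hasDerivAt_const z y).prodMk
      ((hasDerivAt_id z).prodMk (hasDerivAt_const z t))))
    (fun s hs => ⟨hx, hy, hs, ht⟩) hz (fun s hs => hFG x y s t ⟨hx, hy, hs, ht⟩)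

theorem InteriorSmooth.iteratedDeriv_x (hl : l₁ < l₂) (hT : 0 < T)
    (hF : InteriorSmooth l₁ l₂ T F) (n : ℕ) :
    InteriorSmooth l₁ l₂ T (fun x y z t => iteratedDeriv n (fun x' => F x' y z t) x) := by
  induction n with
  | zero => simpa using hF
  | succ n ih => simpa only [iteratedDeriv_succ] using ih.deriv_x hl hT

theorem InteriorSmooth.iteratedDeriv_y (hl : l₁ < l₂) (hT : 0 < T)
    (hF : InteriorSmooth l₁ l₂ T F) (n : ℕ) :
    InteriorSmooth l₁ l₂ T (fun x y z t => iteratedDeriv n (fun y' => F x y' z t) y) := by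
  induction n with
  | zero => simpa using hF
  | succ n ih => simpa only [iteratedDeriv_succ] using ih.deriv_y hl hT

theorem InteriorSmooth.iteratedDeriv_z (hl : l₁ < l₂) (hT : 0 < T)
    (hF : InteriorSmooth l₁ l₂ T F) (n : ℕ) :
    InteriorSmooth l₁ l₂ T (fun x y z t => iteratedDeriv n (fun z' => F x y z' t) z) := by
  induction n with
  | zero => simpa using hF
  | succ n ih => simpa only [iteratedDeriv_succ] using ih.deriv_z hl hT

theorem InteriorSmooth.boundedJets (hl : l₁ < l₂) (hT : 0 < T) (hF : InteriorSmooth l₁ l₂ T F) :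
    BoundedJets fun p : openBox l₁ l₂ T => jet3 F p.1.1 p.1.2.1 p.1.2.2.1 p.1.2.2.2 := by
  intro m n o
  obtain ⟨B, hB⟩ := (((hF.iteratedDeriv_z hl hT o).iteratedDeriv_y hl hT n).iteratedDeriv_x
    hl hT m).exists_bound
  exact ⟨B, fun p => hB _ _ _ _ p.2⟩

theorem InteriorSmooth.sub_div {A κ : ℝ → ℝ → ℝ → ℝ → ℝ} (hF : InteriorSmooth l₁ l₂ T F)
    (hA : SmoothOnBox3 l₁ l₂ T A) (hκ : SmoothOnBox3 l₁ l₂ T κ)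
    (hpos : ∀ x ∈ Set.Icc l₁ l₂, ∀ y ∈ Set.Icc l₁ l₂, ∀ z ∈ Set.Icc l₁ l₂, ∀ t ∈ Set.Icc 0 T,
      0 < κ x y z t) :
    InteriorSmooth l₁ l₂ T (fun x y z t => (F x y z t - A x y z t) / κ x y z t) := by
  obtain ⟨G, hG, hFG⟩ := hF
  refine ⟨_, (hG.sub hA).div hκ fun p hp =>
    (hpos _ hp.1 _ hp.2.1 _ hp.2.2.1 _ hp.2.2.2).ne', fun x y z t h => ?_⟩
  simp only [hFG x y z t h]
  rfl

end

/-- Positivity of the bound is needed because it will be the denominator of the lower bound for `-d₁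
/ r`. -/
theorem exists_upper_bound {l₁ l₂ T : ℝ} {F : ℝ → ℝ → ℝ → ℝ → ℝ}
    (hF : SmoothOnBox3 l₁ l₂ T F) : ∃ B, 0 < B ∧
      ∀ x y z t, (x, y, z, t) ∈ openBox l₁ l₂ T → F x y z t ≤ B := by
  obtain ⟨B, hB⟩ := hF.interiorSmooth.exists_bound
  exact ⟨max B 1, by positivity, fun x y z t h =>
    ((le_abs_self _).trans (hB x y z t h)).trans (le_max_left _ _)⟩

/-- The data of the parabolic equation at a space-time point. -/
def parabolicJets (S : TimeScheme) (r : ℝ) (κ α β γ lam : ℝ → ℝ → ℝ → ℝ → ℝ)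
    (p : ℝ × ℝ × ℝ × ℝ) : CoeffJets ℝ :=
  dataJets r (jet3 (convX3 κ α) p.1 p.2.1 p.2.2.1 p.2.2.2)
    (jet3 (convY3 κ β) p.1 p.2.1 p.2.2.1 p.2.2.2)
    (jet3 (convZ3 κ γ) p.1 p.2.1 p.2.2.1 p.2.2.2)
    (jet3 (fun x y z t => -S.weight / κ x y z t) p.1 p.2.1 p.2.2.1 p.2.2.2)
    (jet3 (fun x y z t => -lam x y z t / κ x y z t) p.1 p.2.1 p.2.2.1 p.2.2.2)

section

variable {l₁ l₂ T : ℝ} {κ α : ℝ → ℝ → ℝ → ℝ → ℝ}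

theorem boundedJets_convX3 (hl : l₁ < l₂) (hT : 0 < T) (hκ : SmoothOnBox3 l₁ l₂ T κ)
    (hα : SmoothOnBox3 l₁ l₂ T α)
    (hpos : ∀ x ∈ Set.Icc l₁ l₂, ∀ y ∈ Set.Icc l₁ l₂, ∀ z ∈ Set.Icc l₁ l₂, ∀ t ∈ Set.Icc 0 T,
      0 < κ x y z t) :
    BoundedJets fun p : openBox l₁ l₂ T =>
      jet3 (convX3 κ α) p.1.1 p.1.2.1 p.1.2.2.1 p.1.2.2.2 :=
  ((hκ.interiorSmooth.deriv_x hl hT).sub_div hα hκ hpos).boundedJets hl hT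

theorem boundedJets_convY3 (hl : l₁ < l₂) (hT : 0 < T) (hκ : SmoothOnBox3 l₁ l₂ T κ)
    (hα : SmoothOnBox3 l₁ l₂ T α)
    (hpos : ∀ x ∈ Set.Icc l₁ l₂, ∀ y ∈ Set.Icc l₁ l₂, ∀ z ∈ Set.Icc l₁ l₂, ∀ t ∈ Set.Icc 0 T,
      0 < κ x y z t) :
    BoundedJets fun p : openBox l₁ l₂ T =>
      jet3 (convY3 κ α) p.1.1 p.1.2.1 p.1.2.2.1 p.1.2.2.2 :=
  ((hκ.interiorSmooth.deriv_y hl hT).sub_div hα hκ hpos).boundedJets hl hT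

theorem boundedJets_convZ3 (hl : l₁ < l₂) (hT : 0 < T) (hκ : SmoothOnBox3 l₁ l₂ T κ)
    (hα : SmoothOnBox3 l₁ l₂ T α)
    (hpos : ∀ x ∈ Set.Icc l₁ l₂, ∀ y ∈ Set.Icc l₁ l₂, ∀ z ∈ Set.Icc l₁ l₂, ∀ t ∈ Set.Icc 0 T,
      0 < κ x y z t) :
    BoundedJets fun p : openBox l₁ l₂ T =>
      jet3 (convZ3 κ α) p.1.1 p.1.2.1 p.1.2.2.1 p.1.2.2.2 :=
  ((hκ.interiorSmooth.deriv_z hl hT).sub_div hα hκ hpos).boundedJets hl hT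

theorem boundedJets_neg_div (hl : l₁ < l₂) (hT : 0 < T) (hκ : SmoothOnBox3 l₁ l₂ T κ)
    (hα : SmoothOnBox3 l₁ l₂ T α)
    (hpos : ∀ x ∈ Set.Icc l₁ l₂, ∀ y ∈ Set.Icc l₁ l₂, ∀ z ∈ Set.Icc l₁ l₂, ∀ t ∈ Set.Icc 0 T,
      0 < κ x y z t) :
    BoundedJets fun p : openBox l₁ l₂ T =>
      jet3 (fun x y z t => -α x y z t / κ x y z t) p.1.1 p.1.2.1 p.1.2.2.1 p.1.2.2.2 := by
  have h0 : InteriorSmooth l₁ l₂ T (fun _ _ _ _ => 0) :=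
    ⟨fun _ => 0, contDiffOn_const, fun _ _ _ _ _ => rfl⟩
  simpa only [zero_sub] using (h0.sub_div hα hκ hpos).boundedJets hl hT

end

theorem BoundedJets.div_const {Ω : Type*} {a : Ω → ℕ → ℕ → ℕ → ℝ} (ha : BoundedJets a) (r : ℝ) :
    BoundedJets fun t m n o => a t m n o / r := by
  intro m n o
  obtain ⟨B, hB⟩ := ha m n o
  exact ⟨B / |r|, fun t => by rw [abs_div]; gcongr; exact hB t⟩

theorem smoothOnBox3_const (l₁ l₂ T w : ℝ) : SmoothOnBox3 l₁ l₂ T (fun _ _ _ _ => w) :=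
  contDiffOn_const

theorem exists_bounded_parabolic3 {l₁ l₂ T r : ℝ} {κ α β γ lam : ℝ → ℝ → ℝ → ℝ → ℝ}
    (S : TimeScheme) (hl : l₁ < l₂) (hT : 0 < T)
    (hκ : SmoothOnBox3 l₁ l₂ T κ) (hα : SmoothOnBox3 l₁ l₂ T α) (hβ : SmoothOnBox3 l₁ l₂ T β)
    (hγ : SmoothOnBox3 l₁ l₂ T γ) (hlam : SmoothOnBox3 l₁ l₂ T lam)
    (hpos : ∀ x ∈ Set.Icc l₁ l₂, ∀ y ∈ Set.Icc l₁ l₂, ∀ z ∈ Set.Icc l₁ l₂, ∀ t ∈ Set.Icc 0 T,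
      0 < κ x y z t) :
    ∃ B, ∀ p ∈ openBox l₁ l₂ T, ∃ c, (parabolicJets S r κ α β γ lam p).IsPartial pos3 lap3 lev3
      (fun e => e.1 ≤ 1) 6 c ∧ ∀ k q, |c k q| ≤ B := by
  obtain ⟨B, hB⟩ := exists_bounded_isPartial3
    (fun p : openBox l₁ l₂ T => parabolicJets S r κ α β γ lam p.1)
    (boundedJets_convX3 hl hT hκ hα hpos) (boundedJets_convY3 hl hT hκ hβ hpos)
    (boundedJets_convZ3 hl hT hκ hγ hpos)
    ((boundedJets_neg_div hl hT hκ (smoothOnBox3_const l₁ l₂ T S.weight) hpos).div_const r)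
    (boundedJets_neg_div hl hT hκ hlam hpos)
  exact ⟨B, fun p hp => hB ⟨p, hp⟩⟩

/-! ### Functions that do not depend on `z` -/

/-- A function of `x, y, t` as a function of `x, y, z, t`. -/
def liftFun (F : ℝ → ℝ → ℝ → ℝ) : ℝ → ℝ → ℝ → ℝ → ℝ := fun x y _ t => F x y t

theorem jet3_liftFun (F : ℝ → ℝ → ℝ → ℝ) (x y z t : ℝ) :
    jet3 (liftFun F) x y z t = liftJet (jet2 F x y t) := by
  funext m n o
  simp only [jet3, liftFun, liftJet, jet2, iteratedDeriv_const]
  split_ifs with h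
  · rfl
  · simp

theorem SmoothOnBox2.liftFun {l₁ l₂ T : ℝ} {F : ℝ → ℝ → ℝ → ℝ} (hF : SmoothOnBox2 l₁ l₂ T F) :
    SmoothOnBox3 l₁ l₂ T (liftFun F) := by
  have h1 : ContDiff ℝ ∞ (fun p : ℝ × ℝ × ℝ × ℝ => (p.1, p.2.1, p.2.2.2)) := by fun_prop
  exact ContDiffOn.comp hF h1.contDiffOn fun p hp => ⟨hp.1, hp.2.1, hp.2.2.2⟩

theorem exists_bounded_parabolic2 {l₁ l₂ T r : ℝ} {κ α β lam : ℝ → ℝ → ℝ → ℝ}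
    (S : TimeScheme) (hl : l₁ < l₂) (hT : 0 < T)
    (hκ : SmoothOnBox2 l₁ l₂ T κ) (hα : SmoothOnBox2 l₁ l₂ T α) (hβ : SmoothOnBox2 l₁ l₂ T β)
    (hlam : SmoothOnBox2 l₁ l₂ T lam)
    (hpos : ∀ x ∈ Set.Icc l₁ l₂, ∀ y ∈ Set.Icc l₁ l₂, ∀ t ∈ Set.Icc 0 T, 0 < κ x y t) :
    ∃ B, ∀ x ∈ Set.Ioo l₁ l₂, ∀ y ∈ Set.Ioo l₁ l₂, ∀ t ∈ Set.Icc 0 T,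
      ∃ c, (dataJets r (liftJet (jet2 (convX2 κ α) x y t)) (liftJet (jet2 (convY2 κ β) x y t)) 0
        (liftJet (jet2 (fun x y t => -S.weight / κ x y t) x y t))
        (liftJet (jet2 (fun x y t => -lam x y t / κ x y t) x y t))).IsPartial pos2 lap2 lev2
          (fun e => e.1 ≤ 1 ∧ e.2.2 = 0) 6 c ∧ ∀ k q, |c k q| ≤ B := by
  have hpos' : ∀ x ∈ Set.Icc l₁ l₂, ∀ y ∈ Set.Icc l₁ l₂, ∀ z ∈ Set.Icc l₁ l₂,
      ∀ t ∈ Set.Icc 0 T, 0 < liftFun κ x y z t := fun x hx y hy _ _ t ht => hpos x hx y hy t ht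
  have h1 := boundedJets_convX3 hl hT hκ.liftFun hα.liftFun hpos'
  have h2 := boundedJets_convY3 hl hT hκ.liftFun hβ.liftFun hpos'
  have h3 := boundedJets_neg_div hl hT hκ.liftFun (smoothOnBox3_const l₁ l₂ T S.weight) hpos'
  have h4 := boundedJets_neg_div hl hT hκ.liftFun hlam.liftFun hpos'
  have e1 : convX3 (liftFun κ) (liftFun α) = liftFun (convX2 κ α) := rfl
  have e2 : convY3 (liftFun κ) (liftFun β) = liftFun (convY2 κ β) := rfl
  have e3 : (fun x y z t => -S.weight / liftFun κ x y z t) =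
    liftFun (fun x y t => -S.weight / κ x y t) := rfl
  have e4 : (fun x y z t => -liftFun lam x y z t / liftFun κ x y z t) =
    liftFun (fun x y t => -lam x y t / κ x y t) := rfl
  simp only [e1, jet3_liftFun] at h1
  simp only [e2, jet3_liftFun] at h2
  simp only [e3, jet3_liftFun] at h3
  simp only [e4, jet3_liftFun] at h4
  obtain ⟨B, hB⟩ := exists_bounded_isPartial2 (fun p : openBox l₁ l₂ T =>
    dataJets r (liftJet (jet2 (convX2 κ α) p.1.1 p.1.2.1 p.1.2.2.2))
      (liftJet (jet2 (convY2 κ β) p.1.1 p.1.2.1 p.1.2.2.2)) 0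
      (liftJet (jet2 (fun x y t => -S.weight / κ x y t) p.1.1 p.1.2.1 p.1.2.2.2))
      (liftJet (jet2 (fun x y t => -lam x y t / κ x y t) p.1.1 p.1.2.1 p.1.2.2.2)))
    h1 h2 (fun _ => rfl) (h3.div_const r) h4
  -- The third coordinate is a dummy; `x` is a value known to lie in the open interval.
  exact ⟨B, fun x hx y hy t ht => hB ⟨(x, y, x, t), hx, hy, hx, ht⟩⟩

end

noncomputable section

/-! ### Schemes with sign and sum conditions -/

section scheme

variable {ι : Type} {K : Type*} [Fintype K]

/-- The difference operator with weights `w p k` and neighbours `nbr p k`. -/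
def stencilOp (s : ℝ) (w : ι → K → ℝ) (nbr : ι → K → ι) (v : ι → ℝ) (p : ι) : ℝ :=
  s * ∑ k, w p k * v (nbr p k)

/-- Positive scaling, nonpositive outer weights, and positive sums of weights; the neighbours of
inner nodes are nodes. -/
structure IsMonotoneStencil (inner bdry : Finset ι) (s : ℝ) (w : ι → K → ℝ) (nbr : ι → K → ι)
    (k₀ : K) : Prop where
  scale_pos : 0 < s
  center : ∀ p, nbr p k₀ = p
  nbr_ne : ∀ p k, k ≠ k₀ → nbr p k ≠ p
  nbr_mem : ∀ p ∈ inner, ∀ k, nbr p k ∈ inner ∨ nbr p k ∈ bdry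
  outer_nonpos : ∀ p ∈ inner, ∀ k, k ≠ k₀ → w p k ≤ 0
  center_pos : ∀ p ∈ inner, 0 < w p k₀
  sum_pos : ∀ p ∈ inner, 0 < ∑ k, w p k

variable {inner bdry : Finset ι} {s : ℝ} {w : ι → K → ℝ} {nbr : ι → K → ι} {k₀ : K}

/-- At a node `q` where the inner maximum exceeds `M ≥ 0`, no neighbour has a larger value. As the
outer weights are nonpositive, the operator at `q` is at least `s * (∑ w) * v q`, which is positive
because the sum of weights is strictly positive. -/
theorem IsMonotoneStencil.discreteMaxPrinciple
    (h : IsMonotoneStencil inner bdry s w nbr k₀) :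
    DiscreteMaxPrinciple inner bdry (stencilOp s w nbr) := by
  intro v hv M hM hb p hp
  by_contra hlt
  rw [not_le] at hlt
  obtain ⟨q, hq, hmax⟩ := inner.exists_max_image v ⟨p, hp⟩
  have hMq : M < v q := hlt.trans_le (hmax p hp)
  have h1 : ∑ k, w q k * v q ≤ ∑ k, w q k * v (nbr q k) := by
    refine Finset.sum_le_sum fun k _ => ?_
    by_cases hk : k = k₀
    · rw [hk, h.center]
    · refine mul_le_mul_of_nonpos_left ?_ (h.outer_nonpos q hq k hk)
      rcases h.nbr_mem q hq k with hi | hi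
      · exact hmax _ hi
      · exact (hb _ hi).trans hMq.le
  rw [← Finset.sum_mul] at h1
  have h2 : 0 < (∑ k, w q k) * v q := mul_pos (h.sum_pos q hq) (hM.trans_lt hMq)
  have h3 := hv q hq
  have h4 : 0 < stencilOp s w nbr v q := mul_pos h.scale_pos (h2.trans_le h1)
  exact absurd h3 (not_le.mpr h4)

theorem stencilOp_neg (v : ι → ℝ) (p : ι) :
    stencilOp s w nbr (fun q => - v q) p = - stencilOp s w nbr v p := by
  simp [stencilOp]

theorem IsMonotoneStencil.monotoneScheme (h : IsMonotoneStencil inner bdry s w nbr k₀) :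
    MonotoneScheme inner bdry (stencilOp s w nbr) := by
  intro v hv hb p hp
  have := h.discreteMaxPrinciple (fun q => - v q)
    (fun q hq => by rw [stencilOp_neg]; linarith [hv q hq]) 0 le_rfl
    (fun q hq => by linarith [hb q hq]) p hp
  linarith

variable [DecidableEq ι]

/-- The extension of a function on the inner nodes by zero. -/
def extendZero (x : inner → ℝ) (p : ι) : ℝ := if hp : p ∈ inner then x ⟨p, hp⟩ else 0

theorem systemMatrix_apply (p q : inner) : systemMatrix inner (stencilOp s w nbr) p q =
    s * ∑ k, if nbr p k = q then w p k else 0 := by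
  simp [systemMatrix, stencilOp, Pi.single_apply]

/-- The matrix acts as the operator on functions extended by zero, so statements about the scheme
carry over to it. -/
theorem sum_systemMatrix_mul (x : inner → ℝ) (p : inner) :
    ∑ q, systemMatrix inner (stencilOp s w nbr) p q * x q =
      stencilOp s w nbr (extendZero x) p := by
  simp only [systemMatrix_apply, stencilOp, mul_assoc, ← Finset.mul_sum, Finset.sum_mul]
  congr 1
  rw [Finset.sum_comm]
  refine Finset.sum_congr rfl fun k _ => ?_
  by_cases hk : nbr p k ∈ inner
  · rw [extendZero, dif_pos hk, Finset.sum_eq_single_of_mem ⟨nbr p k, hk⟩ (Finset.mem_univ _)]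
    · simp
    · intro q _ hq
      rw [if_neg, zero_mul]
      intro he
      exact hq (Subtype.ext he.symm)
  · rw [extendZero, dif_neg hk, mul_zero]
    refine Finset.sum_eq_zero fun q _ => ?_
    rw [if_neg, zero_mul]
    intro he
    exact hk (he ▸ q.2)

/-- A row sum is the operator applied to the indicator of `inner`. Leaving out neighbours outside
`inner` removes only nonpositive weights, so every row sum stays strictly positive; `hne` provides a
row. -/
theorem IsMonotoneStencil.isMMatrix (h : IsMonotoneStencil inner bdry s w nbr k₀)
    (hne : inner.Nonempty) : IsMMatrix (systemMatrix inner (stencilOp s w nbr)) := by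
  have hrow : ∀ p : inner, 0 < ∑ q, systemMatrix inner (stencilOp s w nbr) p q := by
    intro p
    have h1 := sum_systemMatrix_mul (s := s) (w := w) (nbr := nbr) (fun _ : inner => (1 : ℝ)) p
    simp only [mul_one] at h1
    rw [h1]
    refine mul_pos h.scale_pos ((h.sum_pos p p.2).trans_le (Finset.sum_le_sum fun k _ => ?_))
    simp only [extendZero]
    split_ifs with hk
    · rw [mul_one]
    · rw [mul_zero]
      refine h.outer_nonpos p p.2 k ?_
      rintro rfl
      exact hk (by rw [h.center]; exact p.2)
  refine ⟨fun p => ?_, fun p q hpq => ?_, fun p => (hrow p).le, ?_⟩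
  · rw [systemMatrix_apply, Finset.sum_eq_single_of_mem k₀ (Finset.mem_univ _), h.center,
      if_pos rfl]
    · exact mul_pos h.scale_pos (h.center_pos p p.2)
    · intro k _ hk
      exact if_neg (h.nbr_ne p k hk)
  · rw [systemMatrix_apply]
    refine mul_nonpos_of_nonneg_of_nonpos h.scale_pos.le (Finset.sum_nonpos fun k _ => ?_)
    split_ifs with hk
    · refine h.outer_nonpos p p.2 k ?_
      rintro rfl
      rw [h.center] at hk
      exact hpq (Subtype.ext hk)
    · exact le_rfl
  · obtain ⟨p, hp⟩ := hne
    exact ⟨⟨p, hp⟩, hrow _⟩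

theorem IsMonotoneStencil.nonneg_of_mulVec_nonneg (h : IsMonotoneStencil inner bdry s w nbr k₀)
    (x : inner → ℝ)
    (hx : ∀ p, 0 ≤ (systemMatrix inner (stencilOp s w nbr)).mulVec x p) (p : inner) :
    0 ≤ x p := by
  have h1 := h.monotoneScheme (extendZero x) (fun q hq => by
    have := hx ⟨q, hq⟩
    rwa [Matrix.mulVec, dotProduct, sum_systemMatrix_mul] at this)
  -- A direct minimum argument: `inner` and `bdry` are not assumed disjoint, so the extension is not
  -- known to vanish on `bdry`. It is zero off `inner`, hence a negative minimum over `inner` is a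
  -- global one.
  have h2 : ∀ q ∈ inner, 0 ≤ extendZero x q := by
    intro q hq
    by_contra hlt
    rw [not_le] at hlt
    obtain ⟨q', hq', hmin⟩ := inner.exists_min_image (extendZero x) ⟨q, hq⟩
    have hneg : extendZero x q' < 0 := (hmin q hq).trans_lt hlt
    have hall : ∀ i, extendZero x q' ≤ extendZero x i := by
      intro i
      by_cases hi : i ∈ inner
      · exact hmin i hi
      · rw [extendZero.eq_def x i, dif_neg hi]; exact hneg.le
    have h3 : ∑ k, w q' k * extendZero x (nbr q' k) ≤ ∑ k, w q' k * extendZero x q' := by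
      refine Finset.sum_le_sum fun k _ => ?_
      by_cases hk : k = k₀
      · rw [hk, h.center]
      · exact mul_le_mul_of_nonpos_left (hall _) (h.outer_nonpos q' hq' k hk)
    rw [← Finset.sum_mul] at h3
    have h4 : (∑ k, w q' k) * extendZero x q' < 0 :=
      mul_neg_of_pos_of_neg (h.sum_pos q' hq') hneg
    have h5 := hx ⟨q', hq'⟩
    rw [Matrix.mulVec, dotProduct, sum_systemMatrix_mul, stencilOp] at h5
    have h6 := nonneg_of_mul_nonneg_right h5 h.scale_pos
    linarith
  have := h2 p p.2
  rwa [extendZero, dif_pos p.2] at this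

/-- Positivity applied to `x - y` and to `y - x` gives injectivity. The columns of the inverse are
solutions with unit vectors as data, hence nonnegative. -/
theorem IsMonotoneStencil.inversePositive (h : IsMonotoneStencil inner bdry s w nbr k₀) :
    InversePositive (systemMatrix inner (stencilOp s w nbr)) := by
  have hinj : Function.Injective (systemMatrix inner (stencilOp s w nbr)).mulVec := by
    intro x y hxy
    have h1 := h.nonneg_of_mulVec_nonneg (x - y) (fun p => by
      rw [Matrix.mulVec_sub, hxy]; simp)
    have h2 := h.nonneg_of_mulVec_nonneg (y - x) (fun p => by
      rw [Matrix.mulVec_sub, hxy]; simp)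
    funext p
    have h1 := h1 p
    have h2 := h2 p
    simp only [Pi.sub_apply] at h1 h2
    linarith
  have hu : IsUnit (systemMatrix inner (stencilOp s w nbr)).det :=
    (Matrix.isUnit_iff_isUnit_det _).mp (Matrix.mulVec_injective_iff_isUnit.mp hinj)
  refine ⟨hu, fun p q => ?_⟩
  have h1 := h.nonneg_of_mulVec_nonneg
    ((systemMatrix inner (stencilOp s w nbr))⁻¹.mulVec (Pi.single q 1)) (fun i => by
      rw [Matrix.mulVec_mulVec, Matrix.mul_nonsing_inv _ hu, Matrix.one_mulVec, Pi.single_apply]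
      split_ifs <;> norm_num) p
  simpa using h1

end scheme

/-! ### Stencils for small mesh sizes -/

theorem abs_coeffPoly_sub_le {c : Fin 6 → ℝ} {B h : ℝ} (hc : ∀ p, |c p| ≤ B) (h0 : 0 ≤ h)
    (h1 : h ≤ 1) : |coeffPoly c h - c 0| ≤ 5 * B * h := by
  have hp : ∀ p : Fin 6, ∀ n : ℕ, |c p * h ^ (n + 1)| ≤ B * h := by
    intro p n
    rw [abs_mul, abs_of_nonneg (pow_nonneg h0 _), pow_succ]
    have hh : h ^ n * h ≤ 1 * h := mul_le_mul_of_nonneg_right (pow_le_one₀ h0 h1) h0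
    rw [one_mul] at hh
    exact mul_le_mul (hc p) hh (by positivity) ((abs_nonneg _).trans (hc p))
  have he : coeffPoly c h - c 0 =
      c 1 * h ^ (0 + 1) + c 2 * h ^ (1 + 1) + c 3 * h ^ (2 + 1) + c 4 * h ^ (3 + 1)
        + c 5 * h ^ (4 + 1) := by
    simp [coeffPoly, Fin.sum_univ_six]
    ring
  rw [he]
  have a1 := abs_le.mp (hp 1 0)
  have a2 := abs_le.mp (hp 2 1)
  have a3 := abs_le.mp (hp 3 2)
  have a4 := abs_le.mp (hp 4 3)
  have a5 := abs_le.mp (hp 5 4)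
  rw [abs_le]
  constructor <;> linarith

theorem coeffPoly_le {c : Fin 6 → ℝ} {B h : ℝ} (hc : ∀ p, |c p| ≤ B) (h0 : 0 ≤ h)
    (h1 : h ≤ 1) : coeffPoly c h ≤ c 0 + c 1 * h + 4 * B * h ^ 2 := by
  have hp : ∀ p : Fin 6, ∀ n : ℕ, c p * h ^ (n + 2) ≤ B * h ^ 2 := by
    intro p n
    rw [pow_add]
    have hh : h ^ n * h ^ 2 ≤ 1 * h ^ 2 :=
      mul_le_mul_of_nonneg_right (pow_le_one₀ h0 h1) (by positivity)
    rw [one_mul] at hh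
    calc c p * (h ^ n * h ^ 2) ≤ |c p| * (h ^ n * h ^ 2) :=
          mul_le_mul_of_nonneg_right (le_abs_self _) (by positivity)
      _ ≤ B * h ^ 2 := mul_le_mul (hc p) hh (by positivity) ((abs_nonneg _).trans (hc p))
  have he : coeffPoly c h = c 0 + c 1 * h + c 2 * h ^ (0 + 2) + c 3 * h ^ (1 + 2)
        + c 4 * h ^ (2 + 2) + c 5 * h ^ (3 + 2) := by
    simp [coeffPoly, Fin.sum_univ_six]
  rw [he]
  linarith [hp 2 0, hp 3 1, hp 4 2, hp 5 3]

theorem coeffPoly_zero (c : Fin 6 → ℝ) : coeffPoly c 0 = c 0 := by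
  simp [coeffPoly, Fin.sum_univ_six]

theorem sum_coeffPoly {K : Type*} [Fintype K] (c : K → Fin 6 → ℝ) (h : ℝ) :
    ∑ k, coeffPoly (c k) h = ∑ q : Fin 6, (∑ k, c k q) * h ^ (q : ℕ) := by
  simp only [coeffPoly, Finset.sum_mul]
  rw [Finset.sum_comm]

/-- A negative `h¹` coefficient of the sum makes the sum negative for small `h`. -/
theorem sum_coeffPoly_neg {K : Type*} [Fintype K] {c : K → Fin 6 → ℝ} {B δ h : ℝ}
    (hc : ∀ k p, |c k p| ≤ B) (h0 : 0 < h) (h1 : h ≤ 1) (hs0 : ∑ k, c k 0 = 0)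
    (hs1 : ∑ k, c k 1 ≤ -δ) (hh : Fintype.card K * (4 * B) * h < δ) :
    ∑ k, coeffPoly (c k) h < 0 := by
  have h2 : ∑ k, coeffPoly (c k) h ≤ ∑ k, (c k 0 + c k 1 * h + 4 * B * h ^ 2) :=
    Finset.sum_le_sum fun k _ => coeffPoly_le (hc k) h0.le h1
  rw [Finset.sum_add_distrib, Finset.sum_add_distrib, hs0, ← Finset.sum_mul, Finset.sum_const,
    Finset.card_univ, nsmul_eq_mul] at h2
  have h3 : (∑ k, c k 1) * h ≤ -δ * h := mul_le_mul_of_nonneg_right hs1 h0.le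
  have h4 : Fintype.card K * (4 * B) * h * h < δ * h := mul_lt_mul_of_pos_right hh h0
  nlinarith

end

noncomputable section

open CoeffJets

/-! ### Sign and sum conditions for small mesh sizes -/

/-- A positive weight at `k₀`, nonpositive weights elsewhere, and a positive sum of weights. -/
def SignSumPositive {K : Type*} [Fintype K] (w : K → ℝ) (k₀ : K) : Prop :=
  0 < w k₀ ∧ (∀ k, k ≠ k₀ → w k ≤ 0) ∧ 0 < ∑ k, w k

/-- The mesh size is small compared with a bound `B` of `m` coefficients, a lower bound `δ` of the
leading term of their sum, and the width `L` of the domain. -/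
def SmallMesh (m : ℕ) (B δ L h : ℝ) : Prop :=
  h < 1 ∧ h < L ∧ 5 * B * h < 1 / 6 ∧ m * (4 * B) * h < δ

theorem exists_smallMesh (m : ℕ) (B : ℝ) {δ L : ℝ} (hδ : 0 < δ) (hL : 0 < L) :
    ∃ h₀ : ℝ, 0 < h₀ ∧ ∀ h, 0 < h → h < h₀ → SmallMesh m B δ L h := by
  have hlin : ∀ q e : ℝ, 0 < e → ∀ᶠ h in 𝓝 (0 : ℝ), q * h < e := fun q e he =>
    (continuous_const_mul q).tendsto' 0 0 (mul_zero q) |>.eventually_lt_const he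
  have hall : ∀ᶠ h in 𝓝 (0 : ℝ), SmallMesh m B δ L h :=
    (eventually_lt_nhds one_pos).and ((eventually_lt_nhds hL).and
      ((hlin _ _ (by norm_num)).and (hlin _ _ hδ)))
  obtain ⟨h₀, h0, hsub⟩ := Metric.eventually_nhds_iff.mp hall
  refine ⟨h₀, h0, fun h hh hlt => hsub ?_⟩
  rwa [Real.dist_eq, sub_zero, abs_of_pos hh]

/-- A coefficient moves by at most `5 B h < 1/6` from its value at `h = 0`, so outer coefficients
that start at `1/6` or more stay nonnegative and the centre stays negative. The alternative `c k =
0` is for the corners of the spatial stencil. -/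
theorem signSumPositive_of_smallMesh {K : Type*} [Fintype K] {c : K → Fin 6 → ℝ} {k₀ : K}
    {B δ L h : ℝ} (hc : ∀ k p, |c k p| ≤ B) (hh : 0 < h)
    (hsmall : SmallMesh (Fintype.card K) B δ L h) (h₀ : c k₀ 0 ≤ -1)
    (hk : ∀ k, k ≠ k₀ → c k = 0 ∨ 1 / 6 ≤ c k 0) (hs0 : ∑ k, c k 0 = 0)
    (hs1 : ∑ k, c k 1 ≤ -δ) :
    SignSumPositive (fun k => -coeffPoly (c k) h) k₀ := by
  obtain ⟨h1, -, h6, hδ⟩ := hsmall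
  have habs := fun k => abs_le.mp (abs_coeffPoly_sub_le (hc k) hh.le h1.le)
  refine ⟨?_, fun k hne => ?_, ?_⟩
  · linarith [(habs k₀).2]
  · rcases hk k hne with h | h
    · simp [h, coeffPoly]
    · linarith [(habs k).1]
  · rw [Finset.sum_neg_distrib]
    linarith [sum_coeffPoly_neg hc hh h1.le hs0 hs1 hδ]

/-! ### Schemes on the grids -/

theorem TimeScheme.shift_pos (S : TimeScheme) : 0 < S.shift := by
  cases S <;> norm_num [TimeScheme.shift]

theorem TimeScheme.weight_pos (S : TimeScheme) : 0 < S.weight := by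
  cases S <;> norm_num [TimeScheme.weight]

theorem time_mem_Icc (S : TimeScheme) {r h T : ℝ} (hr : 0 < r) (hh : 0 < h) (n : ℕ)
    (hn : ((n : ℝ) + S.shift) * (r * h) ≤ T) :
    ((n : ℝ) + S.shift) * (r * h) ∈ Set.Icc 0 T :=
  ⟨mul_nonneg (add_nonneg n.cast_nonneg S.shift_pos.le) (mul_pos hr hh).le, hn⟩

theorem node_mem_Ioo {l₁ l₂ h : ℝ} {N : ℕ} (hN : 0 < N) (hh : h = (l₂ - l₁) / N) (h0 : 0 < h)
    {i : ℤ} (hi : i ∈ Finset.Ioo (0 : ℤ) N) : l₁ + i * h ∈ Set.Ioo l₁ l₂ := by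
  rw [Finset.mem_Ioo] at hi
  have hi0 : (0 : ℝ) < i := by exact_mod_cast hi.1
  have hiN : (i : ℝ) < N := by exact_mod_cast hi.2
  have hNh : N * h = l₂ - l₁ := by rw [hh]; field_simp
  constructor
  · linarith [mul_pos hi0 h0]
  · linarith [mul_lt_mul_of_pos_right hiN h0]

/-- `h < L` excludes `N = 1`, where there are no inner nodes and the matrix has no row whose sum
could be positive. -/
theorem one_mem_Ioo {L h : ℝ} {N : ℕ} (hN : 0 < N) (hh : h = L / N)
    (hlt : h < L) : (1 : ℤ) ∈ Finset.Ioo (0 : ℤ) N := by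
  rw [Finset.mem_Ioo]
  refine ⟨one_pos, ?_⟩
  by_contra hle
  have h1 : N = 1 := by omega
  rw [hh, h1] at hlt
  simp at hlt

theorem add_sign_mem_Icc {N : ℕ} {i : ℤ} (hi : i ∈ Finset.Ioo (0 : ℤ) N) (k : SignType) :
    i + (k : ℤ) ∈ Finset.Icc (0 : ℤ) N := by
  rw [Finset.mem_Ioo] at hi
  rw [Finset.mem_Icc]
  cases k <;> simp <;> omega

/-- The neighbours of a node of the plane grid. -/
def neighbour2 (p : ℤ × ℤ) (k : SignType × SignType) : ℤ × ℤ :=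
  (p.1 + (k.1 : ℤ), p.2 + (k.2 : ℤ))

/-- The neighbours of a node of the space grid. -/
def neighbour3 (p : ℤ × ℤ × ℤ) (k : SignType × SignType × SignType) : ℤ × ℤ × ℤ :=
  (p.1 + (k.1 : ℤ), p.2.1 + (k.2.1 : ℤ), p.2.2 + (k.2.2 : ℤ))

theorem negL2_eq (h : ℝ) (C : ℤ × ℤ → Stencil2) :
    negL2 h C = stencilOp (1 / h ^ 2) (fun p k => -coeffPoly (C p k.1 k.2) h) neighbour2 := by
  funext v p
  rw [negL2, stencilOp, Fintype.sum_prod_type]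
  rfl

theorem negL3_eq (h : ℝ) (C : ℤ × ℤ × ℤ → Stencil3) :
    negL3 h C =
      stencilOp (1 / h ^ 2) (fun p k => -coeffPoly (C p k.1 k.2.1 k.2.2) h) neighbour3 := by
  funext v p
  rw [negL3, stencilOp, sum_triple]
  rfl

theorem isMonotoneStencil2 {N : ℕ} {h : ℝ} (hh : 0 < h) {C : ℤ × ℤ → Stencil2}
    (hC : ∀ p ∈ gridInner2 N, SignSumPositive
      (fun k : SignType × SignType => -coeffPoly (C p k.1 k.2) h) (0, 0)) :
    IsMonotoneStencil (gridInner2 N) (gridBdry2 N) (1 / h ^ 2)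
      (fun p k => -coeffPoly (C p k.1 k.2) h) neighbour2 (0, 0) where
  scale_pos := by positivity
  center p := by simp [neighbour2]
  nbr_ne p k hk := by
    obtain ⟨k, l⟩ := k
    revert hk
    cases k <;> cases l <;> simp [neighbour2, Prod.ext_iff]
  nbr_mem p hp k := by
    rw [gridBdry2, Finset.mem_sdiff, Finset.mem_product]
    rw [gridInner2, Finset.mem_product] at hp
    exact (em _).imp_right fun h => ⟨⟨add_sign_mem_Icc hp.1 _, add_sign_mem_Icc hp.2 _⟩, h⟩
  outer_nonpos p hp := (hC p hp).2.1
  center_pos p hp := (hC p hp).1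
  sum_pos p hp := (hC p hp).2.2

theorem isMonotoneStencil3 {N : ℕ} {h : ℝ} (hh : 0 < h) {C : ℤ × ℤ × ℤ → Stencil3}
    (hC : ∀ p ∈ gridInner3 N, SignSumPositive
      (fun k : SignType × SignType × SignType => -coeffPoly (C p k.1 k.2.1 k.2.2) h) (0, 0, 0)) :
    IsMonotoneStencil (gridInner3 N) (gridBdry3 N) (1 / h ^ 2)
      (fun p k => -coeffPoly (C p k.1 k.2.1 k.2.2) h) neighbour3 (0, 0, 0) where
  scale_pos := by positivity
  center p := by simp [neighbour3]
  nbr_ne p k hk := by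
    obtain ⟨k, l, s⟩ := k
    revert hk
    cases k <;> cases l <;> cases s <;> simp [neighbour3, Prod.ext_iff]
  nbr_mem p hp k := by
    rw [gridBdry3, Finset.mem_sdiff, Finset.mem_product, Finset.mem_product]
    rw [gridInner3, Finset.mem_product, Finset.mem_product] at hp
    exact (em _).imp_right fun h => ⟨⟨add_sign_mem_Icc hp.1 _, add_sign_mem_Icc hp.2.1 _,
      add_sign_mem_Icc hp.2.2 _⟩, h⟩
  outer_nonpos p hp := (hC p hp).2.1
  center_pos p hp := (hC p hp).1
  sum_pos p hp := (hC p hp).2.2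

theorem SignSumPositive.signSumCondition2 {h : ℝ} {c : Stencil2}
    (hc : SignSumPositive (fun k : SignType × SignType => -coeffPoly (c k.1 k.2) h) (0, 0)) :
    SignSumCondition2 h c :=
  ⟨hc.1, fun k l hk => hc.2.1 (k, l) hk, by
    have := hc.2.2.le
    rwa [Fintype.sum_prod_type] at this⟩

theorem SignSumPositive.signSumCondition3 {h : ℝ} {C : Stencil3}
    (hC : SignSumPositive
      (fun k : SignType × SignType × SignType => -coeffPoly (C k.1 k.2.1 k.2.2) h) (0, 0, 0)) :
    SignSumCondition3 h C :=
  ⟨hC.1, fun k l s hk => hC.2.1 (k, l, s) hk, by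
    have := hC.2.2.le
    rwa [← sum_triple (fun k l s => -coeffPoly (C k l s) h)] at this⟩

theorem neg_weight_div_neg (S : TimeScheme) {κ : ℝ} (hκ : 0 < κ) : -S.weight / κ < 0 :=
  div_neg_of_neg_of_pos (neg_lt_zero.mpr S.weight_pos) hκ

/-- An upper bound of `κ` keeps `d₁ / r` uniformly away from zero; this is the `δ` of `SmallMesh`.
-/
theorem neg_weight_div_le (S : TimeScheme) {κ B r : ℝ} (hκ : 0 < κ) (hB : κ ≤ B) (hr : 0 < r) :
    -S.weight / κ / r ≤ -(S.weight / B / r) := by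
  have := div_le_div_of_nonneg_left S.weight_pos.le hκ hB
  rw [neg_div, neg_div, neg_le_neg_iff]
  gcongr

/-! ### Stencils of parabolic equations -/

theorem parabolic_sum_one3 {S : TimeScheme} {r : ℝ} {κ α β γ lam : ℝ → ℝ → ℝ → ℝ → ℝ}
    {x y z t : ℝ} {s : SignType × SignType × SignType → Fin 6 → ℝ}
    (hs : (parabolicJets S r κ α β γ lam (x, y, z, t)).IsPartial pos3 lap3 lev3
      (fun e => e.1 ≤ 1) 6 s) : ∑ k, s k 1 = -S.weight / κ x y z t / r := by
  rw [hs.sum_one3]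
  simp [parabolicJets, dataJets, jet3]

theorem parabolic_sum_one2 {S : TimeScheme} {r : ℝ} {κ : ℝ → ℝ → ℝ → ℝ} {a b d₂ : ℕ → ℕ → ℝ}
    {x y t : ℝ} {s : SignType × SignType → Fin 6 → ℝ}
    (hs : (dataJets r (liftJet a) (liftJet b) 0
      (liftJet (jet2 (fun x y t => -S.weight / κ x y t) x y t)) (liftJet d₂)).IsPartial
        pos2 lap2 lev2 (fun e => e.1 ≤ 1 ∧ e.2.2 = 0) 6 s) :
    ∑ k, s k 1 = -S.weight / κ x y t / r := by
  rw [hs.sum_one2 rfl]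
  simp [dataJets, liftJet, jet2]

theorem CoeffJets.IsPartial.signSumPositive3 {J : CoeffJets ℝ}
    {s : SignType × SignType × SignType → Fin 6 → ℝ}
    (hs : J.IsPartial pos3 lap3 lev3 (fun e => e.1 ≤ 1) 6 s) {B δ L h : ℝ}
    (hB : ∀ k q, |s k q| ≤ B) (hδ : ∑ k, s k 1 ≤ -δ) (hh : 0 < h)
    (hsmall : SmallMesh 27 B δ L h) :
    SignSumPositive (fun k => -coeffPoly (s k) h) (0, 0, 0) := by
  refine signSumPositive_of_smallMesh hB hh hsmall ?_ (fun k hk => ?_) ?_ hδ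
  · rw [hs.lap_eq]; norm_num [lap3]
  · rw [hs.lap_eq]
    -- Level zero singles out the corners, whose coefficients vanish identically; all other outer
    -- values at `h = 0` are `1/6` or `1/3`.
    by_cases h0 : lev3 k = 0
    · exact Or.inl (funext fun p => hs.vanish k p (by omega))
    · right
      revert hk h0
      obtain ⟨k1, k2, k3⟩ := k
      cases k1 <;> cases k2 <;> cases k3 <;> simp [lap3, lev3] <;> norm_num
  · simp only [hs.lap_eq]; exact sum_lap3

theorem CoeffJets.IsPartial.signSumPositive2 {J : CoeffJets ℝ} {s : SignType × SignType → Fin 6 → ℝ}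
    (hs : J.IsPartial pos2 lap2 lev2 (fun e => e.1 ≤ 1 ∧ e.2.2 = 0) 6 s) {B δ L h : ℝ}
    (hB : ∀ k q, |s k q| ≤ B) (hδ : ∑ k, s k 1 ≤ -δ) (hh : 0 < h)
    (hsmall : SmallMesh 9 B δ L h) :
    SignSumPositive (fun k => -coeffPoly (s k) h) (0, 0) := by
  refine signSumPositive_of_smallMesh hB hh hsmall ?_ (fun k hk => ?_) ?_ hδ
  · rw [hs.lap_eq]; norm_num [lap2]
  · rw [hs.lap_eq]
    right
    revert hk
    obtain ⟨k1, k2⟩ := k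
    cases k1 <;> cases k2 <;> simp [lap2] <;> norm_num
  · simp only [hs.lap_eq]; exact sum_lap2

end

/-! ### Values of the stencils at `h = 0`. -/

noncomputable section

open CoeffJets

theorem CoeffJets.IsPartial.stencil_values2 {J : CoeffJets ℝ}
    {s : SignType × SignType → Fin 6 → ℝ}
    (hs : J.IsPartial pos2 lap2 lev2 (fun e => e.1 ≤ 1 ∧ e.2.2 = 0) 6 s) :
    (∀ k l : SignType, k ≠ 0 → l ≠ 0 → coeffPoly (s (k, l)) 0 = 1 / 6) ∧
    (∀ k : SignType, k ≠ 0 →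
      coeffPoly (s (k, 0)) 0 = 2 / 3 ∧ coeffPoly (s (0, k)) 0 = 2 / 3) ∧
    coeffPoly (s (0, 0)) 0 = -10 / 3 := by
  have hz : ∀ k, coeffPoly (s k) 0 = lap2 k := fun k => by
    rw [coeffPoly_zero, hs.lap_eq]; rfl
  simp only [hz]
  refine ⟨fun k l hk hl => ?_, fun k hk => ?_, rfl⟩
  · revert hk hl
    cases k <;> cases l <;> simp [lap2]
  · revert hk
    cases k
    · exact fun hk => absurd rfl hk
    · exact fun _ => ⟨rfl, rfl⟩
    · exact fun _ => ⟨rfl, rfl⟩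

theorem CoeffJets.IsPartial.stencil_values3 {J : CoeffJets ℝ}
    {s : SignType × SignType × SignType → Fin 6 → ℝ}
    (hs : J.IsPartial pos3 lap3 lev3 (fun e => e.1 ≤ 1) 6 s) :
    (∀ k l o : SignType, k ≠ 0 → l ≠ 0 → o ≠ 0 → ∀ h : ℝ, coeffPoly (s (k, l, o)) h = 0) ∧
    (∀ k l : SignType, k ≠ 0 → l ≠ 0 →
      coeffPoly (s (0, k, l)) 0 = 1 / 6 ∧ coeffPoly (s (k, 0, l)) 0 = 1 / 6 ∧
      coeffPoly (s (k, l, 0)) 0 = 1 / 6) ∧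
    (∀ k : SignType, k ≠ 0 →
      coeffPoly (s (0, 0, k)) 0 = 1 / 3 ∧ coeffPoly (s (0, k, 0)) 0 = 1 / 3 ∧
      coeffPoly (s (k, 0, 0)) 0 = 1 / 3) ∧
    coeffPoly (s (0, 0, 0)) 0 = -4 := by
  have hz : ∀ k, coeffPoly (s k) 0 = lap3 k := fun k => by
    rw [coeffPoly_zero, hs.lap_eq]; rfl
  refine ⟨fun k l o hk hl ho h => ?_, ?_⟩
  · have h0 : lev3 (k, l, o) = 0 := by
      revert hk hl ho; cases k <;> cases l <;> cases o <;> decide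
    have : s (k, l, o) = 0 := funext fun p => hs.vanish _ p (by omega)
    simp [this, coeffPoly]
  simp only [hz]
  refine ⟨fun k l hk hl => ?_, fun k hk => ?_, rfl⟩
  · revert hk hl
    cases k <;> cases l <;> intro hk hl <;>
      first
      | exact absurd rfl hk
      | exact absurd rfl hl
      | exact ⟨rfl, rfl, rfl⟩
  · revert hk
    cases k
    · exact fun hk => absurd rfl hk
    · exact fun _ => ⟨rfl, rfl, rfl⟩
    · exact fun _ => ⟨rfl, rfl, rfl⟩

end

/-! ### The theorem in two and three dimensions. -/

theorem mainTheorem9 :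
    -- two space dimensions
    (∀ (l₁ l₂ T r : ℝ) (κ α β lam : ℝ → ℝ → ℝ → ℝ) (S : TimeScheme),
      l₁ < l₂ → 0 < T → 0 < r →
      SmoothOnBox2 l₁ l₂ T κ → SmoothOnBox2 l₁ l₂ T α → SmoothOnBox2 l₁ l₂ T β →
      SmoothOnBox2 l₁ l₂ T lam →
      (∀ x ∈ Set.Icc l₁ l₂, ∀ y ∈ Set.Icc l₁ l₂, ∀ t ∈ Set.Icc 0 T, 0 < κ x y t) →
      -- the stencil at each point: well-definedness, values at `h = 0`, and coefficient sum
      (∀ x ∈ Set.Ioo l₁ l₂, ∀ y ∈ Set.Ioo l₁ l₂, ∀ t ∈ Set.Icc 0 T,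
        (∃! c : Stencil2, IsParabolicStencil2 S r κ α β lam x y t c) ∧
        ∀ c : Stencil2, IsParabolicStencil2 S r κ α β lam x y t c →
          (∀ k l : SignType, k ≠ 0 → l ≠ 0 → coeffPoly (c k l) 0 = 1 / 6) ∧
          (∀ k : SignType, k ≠ 0 →
            coeffPoly (c k 0) 0 = 2 / 3 ∧ coeffPoly (c 0 k) 0 = 2 / 3) ∧
          coeffPoly (c 0 0) 0 = -10 / 3 ∧
          -S.weight / κ x y t < 0 ∧
          ∃ ϖ : Fin 6 → ℝ,
            (∀ h : ℝ, ∑ k : SignType, ∑ l : SignType, coeffPoly (c k l) h =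
              ∑ q : Fin 6, ϖ q * h ^ (q : ℕ)) ∧
            ϖ 0 = 0 ∧ ϖ 1 = (-S.weight / κ x y t) / r) ∧
      -- the scheme for sufficiently small mesh sizes, at all time levels, with `τ = r h`
      ∃ h₀ : ℝ, 0 < h₀ ∧ ∀ (N : ℕ) (h : ℝ), 0 < N → h = (l₂ - l₁) / N → h < h₀ →
        ∀ n : ℕ, ((n : ℝ) + S.shift) * (r * h) ≤ T →
        ∀ C : ℤ × ℤ → Stencil2,
          (∀ p ∈ gridInner2 N, IsParabolicStencil2 S r κ α β lam
            (l₁ + p.1 * h) (l₁ + p.2 * h) (((n : ℝ) + S.shift) * (r * h)) (C p)) →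
          (∀ p ∈ gridInner2 N, SignSumCondition2 h (C p)) ∧
          DiscreteMaxPrinciple (gridInner2 N) (gridBdry2 N) (negL2 h C) ∧
          MonotoneScheme (gridInner2 N) (gridBdry2 N) (negL2 h C) ∧
          IsMMatrix (systemMatrix (gridInner2 N) (negL2 h C)) ∧
          InversePositive (systemMatrix (gridInner2 N) (negL2 h C))) ∧
    -- three space dimensions
    (∀ (l₁ l₂ T r : ℝ) (κ α β γ lam : ℝ → ℝ → ℝ → ℝ → ℝ) (S : TimeScheme),
      l₁ < l₂ → 0 < T → 0 < r →
      SmoothOnBox3 l₁ l₂ T κ → SmoothOnBox3 l₁ l₂ T α → SmoothOnBox3 l₁ l₂ T β →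
      SmoothOnBox3 l₁ l₂ T γ → SmoothOnBox3 l₁ l₂ T lam →
      (∀ x ∈ Set.Icc l₁ l₂, ∀ y ∈ Set.Icc l₁ l₂, ∀ z ∈ Set.Icc l₁ l₂, ∀ t ∈ Set.Icc 0 T,
        0 < κ x y z t) →
      (∀ x ∈ Set.Ioo l₁ l₂, ∀ y ∈ Set.Ioo l₁ l₂, ∀ z ∈ Set.Ioo l₁ l₂, ∀ t ∈ Set.Icc 0 T,
        (∃! C : Stencil3, IsParabolicStencil3 S r κ α β γ lam x y z t C) ∧
        ∀ C : Stencil3, IsParabolicStencil3 S r κ α β γ lam x y z t C →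
          (∀ k l s : SignType, k ≠ 0 → l ≠ 0 → s ≠ 0 → ∀ h : ℝ, coeffPoly (C k l s) h = 0) ∧
          (∀ k l : SignType, k ≠ 0 → l ≠ 0 →
            coeffPoly (C 0 k l) 0 = 1 / 6 ∧ coeffPoly (C k 0 l) 0 = 1 / 6 ∧
            coeffPoly (C k l 0) 0 = 1 / 6) ∧
          (∀ k : SignType, k ≠ 0 →
            coeffPoly (C 0 0 k) 0 = 1 / 3 ∧ coeffPoly (C 0 k 0) 0 = 1 / 3 ∧
            coeffPoly (C k 0 0) 0 = 1 / 3) ∧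
          coeffPoly (C 0 0 0) 0 = -4 ∧
          -S.weight / κ x y z t < 0 ∧
          ∃ ϖ : Fin 6 → ℝ,
            (∀ h : ℝ, ∑ k : SignType, ∑ l : SignType, ∑ s : SignType, coeffPoly (C k l s) h =
              ∑ q : Fin 6, ϖ q * h ^ (q : ℕ)) ∧
            ϖ 0 = 0 ∧ ϖ 1 = (-S.weight / κ x y z t) / r) ∧
      ∃ h₀ : ℝ, 0 < h₀ ∧ ∀ (N : ℕ) (h : ℝ), 0 < N → h = (l₂ - l₁) / N → h < h₀ →
        ∀ n : ℕ, ((n : ℝ) + S.shift) * (r * h) ≤ T →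
        ∀ C : ℤ × ℤ × ℤ → Stencil3,
          (∀ p ∈ gridInner3 N, IsParabolicStencil3 S r κ α β γ lam
            (l₁ + p.1 * h) (l₁ + p.2.1 * h) (l₁ + p.2.2 * h)
            (((n : ℝ) + S.shift) * (r * h)) (C p)) →
          (∀ p ∈ gridInner3 N, SignSumCondition3 h (C p)) ∧
          DiscreteMaxPrinciple (gridInner3 N) (gridBdry3 N) (negL3 h C) ∧
          MonotoneScheme (gridInner3 N) (gridBdry3 N) (negL3 h C) ∧
          IsMMatrix (systemMatrix (gridInner3 N) (negL3 h C)) ∧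
          InversePositive (systemMatrix (gridInner3 N) (negL3 h C))) := by
  constructor
  · intro l₁ l₂ T r κ α β lam S hl hT hr hκ hα hβ hlam hpos
    obtain ⟨B, hB⟩ := exists_bounded_parabolic2 (r := r) S hl hT hκ hα hβ hlam hpos
    have hκpos : ∀ x ∈ Set.Ioo l₁ l₂, ∀ y ∈ Set.Ioo l₁ l₂, ∀ t ∈ Set.Icc 0 T, 0 < κ x y t :=
      fun x hx y hy => hpos x (Set.Ioo_subset_Icc_self hx) y (Set.Ioo_subset_Icc_self hy)
    refine ⟨fun x hx y hy t ht => ?_, ?_⟩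
    · obtain ⟨s, hs, -⟩ := hB x hx y hy t ht
      refine ⟨⟨_, hs.isCompactStencil2, fun c hc => hc.eq hs.isCompactStencil2⟩,
        fun c hc => ?_⟩
      -- By uniqueness, a statement about any stencil at the point is one about the constructed
      -- stencil.
      obtain rfl := hc.eq hs.isCompactStencil2
      obtain ⟨h1, h2, h3⟩ := hs.stencil_values2
      refine ⟨h1, h2, h3, neg_weight_div_neg S (hκpos x hx y hy t ht), fun q => ∑ k, s k q,
        fun h => ?_, ?_, parabolic_sum_one2 hs⟩
      · rw [← sum_coeffPoly, Fintype.sum_prod_type]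
      · simp only [hs.lap_eq]; exact sum_lap2
    · obtain ⟨K, hK, hκK⟩ := exists_upper_bound hκ.liftFun
      -- Nine nodes, `δ = w / (K r)` and the width `l₂ - l₁`: none of these depends on the mesh, the
      -- time level or the node.
      obtain ⟨h₀, h0, hsmall⟩ := exists_smallMesh 9 B
        (div_pos (div_pos S.weight_pos hK) hr) (sub_pos.mpr hl)
      refine ⟨h₀, h0, fun N h hN hh hlt n hn C hC => ?_⟩
      have hpos_h : 0 < h := by
        rw [hh]; exact div_pos (sub_pos.mpr hl) (Nat.cast_pos.mpr hN)
      have hsm := hsmall h hpos_h hlt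
      have hsign : ∀ p ∈ gridInner2 N, SignSumPositive
          (fun k : SignType × SignType => -coeffPoly (C p k.1 k.2) h) (0, 0) := by
        intro p hp
        have hCp := hC p hp
        rw [gridInner2, Finset.mem_product] at hp
        have hx := node_mem_Ioo hN hh hpos_h hp.1
        have hy := node_mem_Ioo hN hh hpos_h hp.2
        have ht := time_mem_Icc S hr hpos_h n hn
        obtain ⟨s, hs, hsB⟩ := hB _ hx _ hy _ ht
        rw [hCp.eq hs.isCompactStencil2]
        refine hs.signSumPositive2 hsB ?_ hpos_h hsm
        rw [parabolic_sum_one2 hs]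
        exact neg_weight_div_le S (hκpos _ hx _ hy _ ht) (hκK _ _ _ _ ⟨hx, hy, hx, ht⟩) hr
      have hmono := isMonotoneStencil2 hpos_h hsign
      have h1 := one_mem_Ioo hN hh hsm.2.1
      rw [negL2_eq]
      exact ⟨fun p hp => (hsign p hp).signSumCondition2, hmono.discreteMaxPrinciple,
        hmono.monotoneScheme, hmono.isMMatrix ⟨(1, 1), Finset.mk_mem_product h1 h1⟩,
        hmono.inversePositive⟩
  · intro l₁ l₂ T r κ α β γ lam S hl hT hr hκ hα hβ hγ hlam hpos
    obtain ⟨B, hB⟩ := exists_bounded_parabolic3 (r := r) S hl hT hκ hα hβ hγ hlam hpos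
    have hκpos : ∀ x ∈ Set.Ioo l₁ l₂, ∀ y ∈ Set.Ioo l₁ l₂, ∀ z ∈ Set.Ioo l₁ l₂,
        ∀ t ∈ Set.Icc 0 T, 0 < κ x y z t :=
      fun x hx y hy z hz => hpos x (Set.Ioo_subset_Icc_self hx) y (Set.Ioo_subset_Icc_self hy)
        z (Set.Ioo_subset_Icc_self hz)
    refine ⟨fun x hx y hy z hz t ht => ?_, ?_⟩
    · obtain ⟨s, hs, -⟩ := hB (x, y, z, t) ⟨hx, hy, hz, ht⟩
      refine ⟨⟨_, hs.isCompactStencil3, fun c hc => hc.eq hs.isCompactStencil3⟩,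
        fun c hc => ?_⟩
      obtain rfl := hc.eq hs.isCompactStencil3
      obtain ⟨h1, h2, h3, h4⟩ := hs.stencil_values3
      refine ⟨h1, h2, h3, h4, neg_weight_div_neg S (hκpos x hx y hy z hz t ht),
        fun q => ∑ k, s k q, fun h => ?_, ?_, parabolic_sum_one3 hs⟩
      · rw [← sum_coeffPoly, sum_triple fun k l o => coeffPoly (s (k, l, o)) h]
      · simp only [hs.lap_eq]; exact sum_lap3
    · obtain ⟨K, hK, hκK⟩ := exists_upper_bound hκ
      -- All 27 nodes are counted, including the eight corners with zero coefficients.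
      obtain ⟨h₀, h0, hsmall⟩ := exists_smallMesh 27 B
        (div_pos (div_pos S.weight_pos hK) hr) (sub_pos.mpr hl)
      refine ⟨h₀, h0, fun N h hN hh hlt n hn C hC => ?_⟩
      have hpos_h : 0 < h := by
        rw [hh]; exact div_pos (sub_pos.mpr hl) (Nat.cast_pos.mpr hN)
      have hsm := hsmall h hpos_h hlt
      have hsign : ∀ p ∈ gridInner3 N, SignSumPositive
          (fun k : SignType × SignType × SignType => -coeffPoly (C p k.1 k.2.1 k.2.2) h)
          (0, 0, 0) := by
        intro p hp
        have hCp := hC p hp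
        rw [gridInner3, Finset.mem_product, Finset.mem_product] at hp
        have hx := node_mem_Ioo hN hh hpos_h hp.1
        have hy := node_mem_Ioo hN hh hpos_h hp.2.1
        have hz := node_mem_Ioo hN hh hpos_h hp.2.2
        have ht := time_mem_Icc S hr hpos_h n hn
        obtain ⟨s, hs, hsB⟩ := hB (_, _, _, _) ⟨hx, hy, hz, ht⟩
        rw [hCp.eq hs.isCompactStencil3]
        refine hs.signSumPositive3 hsB ?_ hpos_h hsm
        rw [parabolic_sum_one3 hs]
        exact neg_weight_div_le S (hκpos _ hx _ hy _ hz _ ht) (hκK _ _ _ _ ⟨hx, hy, hz, ht⟩) hr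
      have hmono := isMonotoneStencil3 hpos_h hsign
      have h1 := one_mem_Ioo hN hh hsm.2.1
      rw [negL3_eq]
      exact ⟨fun p hp => (hsign p hp).signSumCondition3, hmono.discreteMaxPrinciple,
        hmono.monotoneScheme, hmono.isMMatrix ⟨(1, 1, 1), Finset.mk_mem_product h1
          (Finset.mk_mem_product h1 h1)⟩, hmono.inversePositive⟩
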